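/- Let $f:\mathbb R\to\mathbb R$ be smooth and strictly convex, in the sense that $f''(v)>0$ for every $v\in\mathbb R$. Call $u:\mathbb R\times(0,\infty)\to\mathbb R$ an entropy solution of $$\partial_t u+\partial_x f(u)=0 \qquad (x\in\mathbb R,\ t>0)$$ if $u$ is measurable and bounded, if for every $t>0$ the function $u(\cdot,t)$ has bounded variation on $\mathbb R$ and is right-continuous, if $t\mapsto u(\cdot,t)$ is continuous from $(0,\infty)$ to $L^1_{loc}(\mathbb R)$, and if for every $k\in\mathbb R$ $$\partial_t|u-k|+\partial_x\bigl(\operatorname{sgn}(u-k)\,(f(u)-f(k))\bigr)\le 0$$ in the sense of distributions on $\mathbb R\times(0,\infty)$. Let $u^I$ and $u^{II}$ be two entropy solutions, and define their averaged speed by $$a(x,t)=\frac{f(u^{II}(x,t))-f(u^{I}(x,t))}{u^{II}(x,t)-u^{I}(x,t)}\ \text{ if } u^I(x,t)\ne u^{II}(x,t),\qquad a(x,t)=f'(u^I(x,t))\ \text{ if } u^I(x,t)=u^{II}(x,t).$$ Then there are real constants $C(u^I)$ and $C(u^{II})$ such that, for every $t>0$ and in the sense of distributions on $\mathbb R$,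 $$\partial_x u^I(\cdot,t)\le \frac{C(u^I)}{t},\qquad \partial_x u^{II}(\cdot,t)\le\frac{C(u^{II})}{t},$$ and for every choice of constants with this property, for every $t>0$, $a(\cdot,t)$ is locally integrable and, in the sense of distributions on $\mathbb R$, $$\partial_x a(\cdot,t)\le\frac{E}{t},\qquad E=\sup_J f''\cdot\frac{C(u^I)+C(u^{II})}{2},$$ where $J\subset\mathbb R$ is the smallest interval containing all values $u^I(x,t)$, $u^{II}(x,t)$ with $x\in\mathbb R$, $t>0$. -/

import Mathlib

open MeasureTheory Set Filter Topology
open scoped ContDiff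

namespace ScalarLaw

/-- Entropy solutions (in the sense of Kruzhkov) of the scalar conservation law
`∂ₜ u + ∂ₓ f(u) = 0` on `ℝ × (0, ∞)`, written `u x t`: bounded functions, of bounded variation in
space at every time, normalized to be right-continuous in space, continuous in time with values in
`L¹_loc(ℝ)`, and satisfying all Kruzhkov entropy inequalities in the sense of distributions.
Taking `k` above and below all values of `u` in `entropy_ineq` gives the equation itself in the
sense of distributions. Nothing is required at `t = 0`, so that every initial datum is allowed. -/
structure IsEntropySolution (f : ℝ → ℝ) (u : ℝ → ℝ → ℝ) : Prop where
  aestronglyMeasurable : AEStronglyMeasurable (fun p : ℝ × ℝ => u p.1 p.2)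
    (volume.restrict {p : ℝ × ℝ | 0 < p.2})
  bounded : ∃ M : ℝ, ∀ x t : ℝ, 0 < t → |u x t| ≤ M
  boundedVariation : ∀ t : ℝ, 0 < t → BoundedVariationOn (fun x => u x t) univ
  rightContinuous : ∀ t : ℝ, 0 < t → ∀ x : ℝ, ContinuousWithinAt (fun y => u y t) (Ici x) x
  continuous_L1loc : ∀ t : ℝ, 0 < t → ∀ R : ℝ, 0 < R →
    Tendsto (fun s : ℝ => ∫ x in Icc (-R) R, |u x s - u x t|) (𝓝 t) (𝓝 0)
  entropy_ineq : ∀ k : ℝ, ∀ φ : ℝ × ℝ → ℝ, ContDiff ℝ ∞ φ → HasCompactSupport φ →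
    tsupport φ ⊆ {p : ℝ × ℝ | 0 < p.2} → (∀ p, 0 ≤ φ p) →
    0 ≤ ∫ p in {p : ℝ × ℝ | 0 < p.2},
      (|u p.1 p.2 - k| * fderiv ℝ φ p (0, 1)
        + Real.sign (u p.1 p.2 - k) * (f (u p.1 p.2) - f k) * fderiv ℝ φ p (1, 0))

/-- The averaged speed `a(uᴵ, uᴵᴵ) = (f(uᴵᴵ) - f(uᴵ)) / (uᴵᴵ - uᴵ)`, extended by continuity, i.e. by
`f'(uᴵ)`, to the points where `uᴵ = uᴵᴵ`. -/
noncomputable def averagedSpeed (f : ℝ → ℝ) (uI uII : ℝ → ℝ → ℝ) (x t : ℝ) : ℝ :=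
  if uII x t = uI x t then deriv f (uI x t)
  else (f (uII x t) - f (uI x t)) / (uII x t - uI x t)

/-- `∂ₓ g ≤ K` on `ℝ` in the sense of distributions (equivalently, of measures). -/
def DistribDerivLE (g : ℝ → ℝ) (K : ℝ) : Prop :=
  LocallyIntegrable g volume ∧
    ∀ φ : ℝ → ℝ, ContDiff ℝ ∞ φ → HasCompactSupport φ → (∀ x, 0 ≤ φ x) →
      -(∫ x, g x * deriv φ x) ≤ K * ∫ x, φ x

/-- The one-sided bound `∂ₓ g ≤ C / t`, at every time `t > 0`. -/
def OneSidedBound (g : ℝ → ℝ → ℝ) (C : ℝ) : Prop :=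
  ∀ t : ℝ, 0 < t → DistribDerivLE (fun x => g x t) (C / t)

/-- The values taken by `uᴵ` and `uᴵᴵ` at positive times. -/
def valueSet (uI uII : ℝ → ℝ → ℝ) : Set ℝ :=
  {v | ∃ x t : ℝ, 0 < t ∧ (v = uI x t ∨ v = uII x t)}

/-- `sup f''` over the smallest interval containing all values of the two solutions. -/
noncomputable def supSecondDeriv (f : ℝ → ℝ) (uI uII : ℝ → ℝ → ℝ) : ℝ :=
  sSup (deriv (deriv f) '' convexHull ℝ (valueSet uI uII))

end ScalarLaw

/-! The estimate for the averaged speed is elementary once one-sided bounds are pointwise. For a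
right-continuous function, `DistribDerivLE g K` gives `g y - g x ≤ K * (y - x)` for `x ≤ y`
(`DistribDerivLE.sub_le`), and these increments imply it back (`distribDerivLE_of_sub_le`). Write `a
= ∫₀¹ f'((1-θ)uI + θ uII) dθ`. The interpolated state has increments at most `((1-θ)CI + θ
CII)(y-x)/t`, and `f'` is increasing with slope at most `sup f''` on the convex hull of the values.
Integrating in `θ` produces the mean `(CI + CII)/2` (`oneSidedBound_averagedSpeed`).

The substance is the existence of `C(u)`, Oleinik's estimate, derived here from the Kruzhkov
inequalities through the Lax–Oleinik formula. As `u` is bounded, `f` may be replaced by a flux `F`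
with `F'' ≥ c > 0`. Let `U` be a potential, `∂ₓU = u` and `∂ₜU = -F(u)`, and `L` the Legendre
transform of `F`. For `0 < s < T` the claim is `U(x,T) = inf_y [U(y,s) + (T-s) L((x-y)/(T-s))]`.

The inequality `≤` (`potential_le`) follows by integrating `U` along the segment from `(y,s)` to
`(x,T)` and using Young's inequality `p u - F(u) ≤ L(p)`. It holds for every weak solution.

The inequality `≥` (`le_potential`) is where entropy enters. Fix `(x₀,T)` and let `v =
(F')⁻¹((x₀-y)/(T-τ))` be the fan focusing there, a smooth solution for `τ < T`. Averaging the
Kruzhkov inequalities over `k`, with test functions concentrated near the characteristic on which `v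
= k`, yields `∂|u-v| + ∂ₓ(sgn(u-v)(F(u)-F(v))) ≤ 0` (`integral_fan_nonneg`). The Lax sum `w = U +
(T-τ) L((x₀-y)/(T-τ))` satisfies `∂ₓw = u - v` and `∂ₜw = F(v) - F(u)`, so in testing with a cutoff
`σ(m - w)` the terms containing `σ'` cancel, and `∫ σ(m-w)|u-v| dy` does not increase in time. If `w
≥ m` at time `s`, this integral vanishes later as well, so `σ(m-w)` is constant in `y`; it is zero
far away by coercivity, hence `w ≥ m` persists. Letting `τ → T` at `y = x₀` gives `U(x₀,T) ≥ m`.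

Since `L'` is `1/c`-Lipschitz, the formula makes `U(·,T) - x²/(2c(T-s))` concave, and `s = T/2`
gives the constant `C(u) = 2/c`. -/

namespace ScalarLaw

/-! ### One-sided mollifiers and smooth steps -/

/-- A smooth bump function supported to the right of the origin, within distance `1 / (n + 1)`. -/
noncomputable def rightBump (n : ℕ) : ContDiffBump (1 / (2 * ((n : ℝ) + 1))) where
  rIn := 1 / (8 * ((n : ℝ) + 1))
  rOut := 1 / (4 * ((n : ℝ) + 1))
  rIn_pos := by positivity
  rIn_lt_rOut := by
    apply one_div_lt_one_div_of_lt <;> nlinarith [(Nat.cast_nonneg n : (0 : ℝ) ≤ n)]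

/-- A one-sided mollification kernel. -/
noncomputable def rightKernel (n : ℕ) : ℝ → ℝ := (rightBump n).normed volume

theorem contDiff_rightKernel (n : ℕ) : ContDiff ℝ ∞ (rightKernel n) :=
  (rightBump n).contDiff_normed

theorem continuous_rightKernel (n : ℕ) : Continuous (rightKernel n) :=
  (contDiff_rightKernel n).continuous

theorem rightKernel_nonneg (n : ℕ) (x : ℝ) : 0 ≤ rightKernel n x :=
  (rightBump n).nonneg_normed x

theorem integral_rightKernel (n : ℕ) : ∫ x, rightKernel n x = 1 :=
  (rightBump n).integral_normed

theorem integrable_rightKernel (n : ℕ) : Integrable (rightKernel n) :=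
  (rightBump n).integrable_normed

theorem hasCompactSupport_rightKernel (n : ℕ) : HasCompactSupport (rightKernel n) :=
  (rightBump n).hasCompactSupport_normed

theorem mem_Ioo_of_rightKernel_ne_zero {n : ℕ} {x : ℝ} (h : rightKernel n x ≠ 0) :
    x ∈ Ioo 0 (1 / ((n : ℝ) + 1)) := by
  have h' : x ∈ Function.support ((rightBump n).normed volume) := h
  rw [ContDiffBump.support_normed_eq, Metric.mem_ball, Real.dist_eq, abs_lt] at h'
  obtain ⟨h1, h2⟩ := h'
  have hr : (rightBump n).rOut = (1 / 4) * (1 / ((n : ℝ) + 1)) := by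
    simp only [rightBump]; field_simp
  have hc : 1 / (2 * ((n : ℝ) + 1)) = (1 / 2) * (1 / ((n : ℝ) + 1)) := by field_simp
  have hp : 0 < 1 / ((n : ℝ) + 1) := by positivity
  rw [hr, hc] at h1 h2
  constructor <;> linarith

theorem rightKernel_eq_zero_of_nonpos {n : ℕ} {x : ℝ} (h : x ≤ 0) : rightKernel n x = 0 := by
  by_contra h'
  exact absurd (mem_Ioo_of_rightKernel_ne_zero h').1 (not_lt.2 h)

theorem one_div_nat_add_one_le (n : ℕ) : 1 / ((n : ℝ) + 1) ≤ 1 := by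
  rw [div_le_one (by positivity)]; simp

theorem rightKernel_eq_zero_of_one_le {n : ℕ} {x : ℝ} (h : 1 ≤ x) : rightKernel n x = 0 := by
  by_contra h'
  have := (mem_Ioo_of_rightKernel_ne_zero h').2
  linarith [one_div_nat_add_one_le n]

theorem integrable_mul_of_integrableOn {k h : ℝ → ℝ} {a b : ℝ} (hk : Continuous k)
    (hk0 : ∀ x, x ∉ Icc a b → k x = 0) (hh : IntegrableOn h (Icc a b)) :
    Integrable (fun x => k x * h x) := by
  have h1 : IntegrableOn (fun x => k x * h x) (Icc a b) :=
    hh.continuousOn_mul hk.continuousOn isCompact_Icc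
  refine (integrableOn_iff_integrable_of_support_subset ?_).1 h1
  intro x hx
  by_contra hx'
  exact hx (by simp [hk0 x hx'])

theorem integrable_rightKernel_mul {n : ℕ} {h : ℝ → ℝ} (hh : IntegrableOn h (Icc 0 1)) :
    Integrable (fun z => rightKernel n z * h z) := by
  refine integrable_mul_of_integrableOn (continuous_rightKernel n) (fun x hx => ?_) hh
  by_contra h'
  have := mem_Ioo_of_rightKernel_ne_zero h'
  exact hx ⟨this.1.le, by linarith [this.2, one_div_nat_add_one_le n]⟩

/-- The kernel lives strictly to the right of the origin, so right-continuity alone gives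
convergence, at every point and not merely almost everywhere. This is why all spatial mollifications
below are one-sided. -/
theorem tendsto_integral_rightKernel_mul {h : ℝ → ℝ} (hh : IntegrableOn h (Icc 0 1))
    (hc : ContinuousWithinAt h (Ici 0) 0) :
    Tendsto (fun n => ∫ z, rightKernel n z * h z) atTop (𝓝 (h 0)) := by
  rw [Metric.tendsto_atTop]
  intro ε hε
  obtain ⟨δ, hδ, hδ'⟩ := Metric.continuousWithinAt_iff.1 hc (ε / 2) (by positivity)
  obtain ⟨N, hN⟩ := exists_nat_one_div_lt hδ
  refine ⟨N, fun n hn => ?_⟩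
  have hint := integrable_rightKernel_mul (n := n) hh
  have e1 : (∫ z, rightKernel n z * h z) - h 0 = ∫ z, rightKernel n z * (h z - h 0) := by
    simp_rw [mul_sub]
    rw [integral_sub hint ((integrable_rightKernel n).mul_const _), integral_mul_const,
      integral_rightKernel, one_mul]
  rw [Real.dist_eq, e1]
  have hb : ‖∫ z, rightKernel n z * (h z - h 0)‖ ≤ ∫ z, rightKernel n z * (ε / 2) := by
    refine norm_integral_le_of_norm_le ((integrable_rightKernel n).mul_const _) (ae_of_all _ ?_)
    intro z
    rw [norm_mul, Real.norm_of_nonneg (rightKernel_nonneg n z)]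
    by_cases hz : rightKernel n z = 0
    · simp [hz]
    · have hz' := mem_Ioo_of_rightKernel_ne_zero hz
      refine mul_le_mul_of_nonneg_left ?_ (rightKernel_nonneg n z)
      have hlt : 1 / ((n : ℝ) + 1) ≤ 1 / ((N : ℝ) + 1) := by
        apply one_div_le_one_div_of_le (by positivity)
        have : (N : ℝ) ≤ n := by exact_mod_cast hn
        linarith
      have := hδ' (show z ∈ Ici 0 from hz'.1.le) (by
        rw [Real.dist_eq, sub_zero, abs_of_pos hz'.1]; linarith [hz'.2])
      rw [Real.dist_eq] at this
      exact this.le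
  rw [integral_mul_const, integral_rightKernel, one_mul] at hb
  rw [Real.norm_eq_abs] at hb
  linarith

/-- The primitive of the one-sided kernel: a smooth step from `0` to `1`. -/
noncomputable def rightStep (n : ℕ) (x : ℝ) : ℝ := ∫ z in 0..x, rightKernel n z

theorem hasDerivAt_rightStep (n : ℕ) (x : ℝ) : HasDerivAt (rightStep n) (rightKernel n x) x :=
  intervalIntegral.integral_hasDerivAt_right
    ((continuous_rightKernel n).intervalIntegrable _ _)
    ((continuous_rightKernel n).stronglyMeasurableAtFilter _ _) (continuous_rightKernel n).continuousAt

theorem deriv_rightStep (n : ℕ) : deriv (rightStep n) = rightKernel n :=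
  funext fun x => (hasDerivAt_rightStep n x).deriv

theorem contDiff_rightStep (n : ℕ) : ContDiff ℝ ∞ (rightStep n) := by
  rw [contDiff_infty_iff_deriv]
  exact ⟨fun x => (hasDerivAt_rightStep n x).differentiableAt,
    by rw [deriv_rightStep]; exact contDiff_rightKernel n⟩

theorem monotone_rightStep (n : ℕ) : Monotone (rightStep n) :=
  monotone_of_deriv_nonneg (fun x => (hasDerivAt_rightStep n x).differentiableAt)
    (fun x => by rw [deriv_rightStep]; exact rightKernel_nonneg n x)

theorem rightStep_of_nonpos {n : ℕ} {x : ℝ} (h : x ≤ 0) : rightStep n x = 0 := by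
  unfold rightStep
  apply intervalIntegral.integral_zero_ae
  refine ae_of_all _ fun z hz => rightKernel_eq_zero_of_nonpos ?_
  rw [uIoc_of_ge h] at hz
  exact hz.2

theorem rightStep_of_le {n : ℕ} {x : ℝ} (h : 1 / ((n : ℝ) + 1) ≤ x) : rightStep n x = 1 := by
  have hx : (0 : ℝ) ≤ x := le_trans (by positivity) h
  unfold rightStep
  rw [intervalIntegral.integral_of_le hx, ← integral_rightKernel n]
  apply setIntegral_eq_integral_of_forall_compl_eq_zero
  intro z hz
  by_cases h0 : z ≤ 0
  · exact rightKernel_eq_zero_of_nonpos h0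
  · by_contra h1
    exact hz ⟨not_le.1 h0, (mem_Ioo_of_rightKernel_ne_zero h1).2.le.trans h⟩

/-- A smooth approximation of the indicator function of `[x, y]`. -/
noncomputable def stepDiff (n : ℕ) (x y z : ℝ) : ℝ := rightStep n (z - x) - rightStep n (z - y)

theorem contDiff_stepDiff (n : ℕ) (x y : ℝ) : ContDiff ℝ ∞ (stepDiff n x y) :=
  ((contDiff_rightStep n).comp (contDiff_id.sub contDiff_const)).sub
    ((contDiff_rightStep n).comp (contDiff_id.sub contDiff_const))

theorem hasDerivAt_stepDiff (n : ℕ) (x y z : ℝ) :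
    HasDerivAt (stepDiff n x y) (rightKernel n (z - x) - rightKernel n (z - y)) z :=
  ((hasDerivAt_rightStep n (z - x)).comp_sub_const z x).sub
    ((hasDerivAt_rightStep n (z - y)).comp_sub_const z y)

theorem deriv_stepDiff (n : ℕ) (x y z : ℝ) :
    deriv (stepDiff n x y) z = rightKernel n (z - x) - rightKernel n (z - y) :=
  (hasDerivAt_stepDiff n x y z).deriv

theorem stepDiff_nonneg (n : ℕ) {x y : ℝ} (hxy : x ≤ y) (z : ℝ) : 0 ≤ stepDiff n x y z :=
  sub_nonneg.2 (monotone_rightStep n (by linarith))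

theorem tsupport_stepDiff_subset (n : ℕ) {x y : ℝ} (hxy : x ≤ y) :
    tsupport (stepDiff n x y) ⊆ Icc x (y + 1 / ((n : ℝ) + 1)) := by
  apply closure_minimal _ isClosed_Icc
  intro z hz
  by_contra h
  apply hz
  unfold stepDiff
  rw [mem_Icc, not_and_or, not_le, not_le] at h
  rcases h with h | h
  · rw [rightStep_of_nonpos (by linarith), rightStep_of_nonpos (by linarith), sub_zero]
  · rw [rightStep_of_le (by linarith), rightStep_of_le (by linarith), sub_self]

theorem hasCompactSupport_stepDiff (n : ℕ) {x y : ℝ} (hxy : x ≤ y) :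
    HasCompactSupport (stepDiff n x y) :=
  isCompact_Icc.of_isClosed_subset (isClosed_tsupport _) (tsupport_stepDiff_subset n hxy)

theorem integrableOn_comp_add_left {g : ℝ → ℝ} {x a b : ℝ} (hg : IntegrableOn g (Icc (x + a) (x + b))) :
    IntegrableOn (fun z => g (x + z)) (Icc a b) := by
  have := (measurePreserving_add_left volume x).integrableOn_comp_preimage
    (measurableEmbedding_addLeft x) (f := g) (s := Icc (x + a) (x + b))
  simp only [preimage_const_add_Icc, add_sub_cancel_left] at this
  exact this.2 hg

theorem integral_rightKernel_sub_mul (n : ℕ) (g : ℝ → ℝ) (x : ℝ) :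
    ∫ z, rightKernel n (z - x) * g z = ∫ z, rightKernel n z * g (x + z) := by
  rw [← integral_add_left_eq_self (fun z => rightKernel n (z - x) * g z) x]
  simp

theorem integrable_rightKernel_sub_mul {n : ℕ} {g : ℝ → ℝ} {x : ℝ}
    (hg : IntegrableOn g (Icc x (x + 1))) :
    Integrable (fun z => rightKernel n (z - x) * g z) := by
  refine integrable_mul_of_integrableOn
    ((continuous_rightKernel n).comp (continuous_id.sub continuous_const)) (fun z hz => ?_) hg
  by_contra h'
  have := mem_Ioo_of_rightKernel_ne_zero h'
  exact hz ⟨by linarith [this.1], by linarith [this.2, one_div_nat_add_one_le n]⟩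

/-! ### One-sided derivative bounds: distributional and pointwise forms -/

/-- A function which is right-continuous at two points and whose distributional derivative is
nonpositive between them takes a smaller value at the second one. -/
theorem le_of_integral_mul_deriv_nonneg {g : ℝ → ℝ} {x y b : ℝ} (hxy : x ≤ y) (hyb : y < b)
    (hint : IntegrableOn g (Icc x b)) (hcx : ContinuousWithinAt g (Ici x) x)
    (hcy : ContinuousWithinAt g (Ici y) y)
    (hg : ∀ θ : ℝ → ℝ, ContDiff ℝ ∞ θ → HasCompactSupport θ → tsupport θ ⊆ Icc x b →
      (∀ x, 0 ≤ θ x) → 0 ≤ ∫ x, g x * deriv θ x) : g y ≤ g x := by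
  set G : ℝ → ℝ := (Icc x b).indicator g with hG
  have hGi : Integrable G := (integrable_indicator_iff measurableSet_Icc).2 hint
  have key : ∀ w ∈ Ico x b, ContinuousWithinAt g (Ici w) w →
      Tendsto (fun n => ∫ z, rightKernel n (z - w) * G z) atTop (𝓝 (g w)) := by
    intro w hw hc
    simp_rw [integral_rightKernel_sub_mul]
    have hwm : w ∈ Icc x b := ⟨hw.1, hw.2.le⟩
    have h0 : (fun z => G (w + z)) 0 = g w := by
      simp only [add_zero, hG]
      exact indicator_of_mem hwm g
    have hcG : ContinuousWithinAt G (Ici w) w := by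
      refine hc.congr_of_eventuallyEq ?_ (indicator_of_mem hwm g)
      filter_upwards [self_mem_nhdsWithin, mem_nhdsWithin_of_mem_nhds (gt_mem_nhds hw.2)] with z h1 h2
      exact indicator_of_mem (show z ∈ Icc x b from ⟨hw.1.trans h1, le_of_lt h2⟩) g
    rw [← h0]
    apply tendsto_integral_rightKernel_mul
    · exact integrableOn_comp_add_left hGi.integrableOn
    · have : ContinuousWithinAt (fun z => w + z) (Ici 0) 0 := by fun_prop
      refine ContinuousWithinAt.comp (t := Ici w) (by simpa using hcG) this ?_
      intro z hz; simpa using hz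
  have hlim := (key x ⟨le_rfl, by linarith⟩ hcx).sub (key y ⟨hxy, hyb⟩ hcy)
  refine sub_nonneg.1 (ge_of_tendsto hlim ?_)
  obtain ⟨N, hN⟩ := exists_nat_one_div_lt (sub_pos.2 hyb)
  filter_upwards [eventually_ge_atTop N] with n hn
  have hnN : 1 / ((n : ℝ) + 1) ≤ 1 / ((N : ℝ) + 1) := by
    apply one_div_le_one_div_of_le (by positivity)
    have : (N : ℝ) ≤ n := by exact_mod_cast hn
    linarith
  -- The smoothed indicator of `[x, y]` spills over to the right by `1 / (n + 1)`, which is the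
  -- reason for the margin `y < b`. Its derivative is the difference of the kernels based at `x` and
  -- `y`, so testing with it compares the mollified values of `g` there.
  have hts : tsupport (stepDiff n x y) ⊆ Icc x b :=
    (tsupport_stepDiff_subset n hxy).trans (Icc_subset_Icc_right (by linarith))
  have h1 := hg (stepDiff n x y) (contDiff_stepDiff n x y) (hasCompactSupport_stepDiff n hxy)
    hts (stepDiff_nonneg n hxy)
  rw [← integral_sub (integrable_rightKernel_sub_mul hGi.integrableOn)
    (integrable_rightKernel_sub_mul hGi.integrableOn)]
  refine h1.trans_eq (integral_congr_ae (ae_of_all _ fun z => ?_))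
  simp only
  rw [← sub_mul, ← deriv_stepDiff, mul_comm]
  by_cases hz : z ∈ Icc x b
  · rw [hG, indicator_of_mem hz]
  · rw [image_eq_zero_of_notMem_tsupport fun h => hz (hts (tsupport_deriv_subset (𝕜 := ℝ) h))]
    ring

theorem integrable_mul_of_hasCompactSupport {g φ : ℝ → ℝ} (hg : LocallyIntegrable g)
    (hφ : Continuous φ) (hs : HasCompactSupport φ) : Integrable (fun x => g x * φ x) := by
  simpa [smul_eq_mul, mul_comm] using
    hg.integrable_smul_left_of_hasCompactSupport hφ hs

theorem integral_id_mul_deriv {φ : ℝ → ℝ} (hφ : ContDiff ℝ ∞ φ) (hs : HasCompactSupport φ) :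
    ∫ x, x * deriv φ x = -∫ x, φ x := by
  have hd : Continuous (deriv φ) := hφ.continuous_deriv (by simp)
  have h1 : Integrable (fun x : ℝ => x * deriv φ x) :=
    integrable_mul_of_hasCompactSupport continuous_id.locallyIntegrable hd hs.deriv
  have h2 : Integrable φ := hφ.continuous.integrable_of_hasCompactSupport hs
  have h3 : Integrable (fun x : ℝ => x * φ x) :=
    integrable_mul_of_hasCompactSupport continuous_id.locallyIntegrable hφ.continuous hs
  have := integral_mul_deriv_eq_deriv_mul_of_integrable (u := fun x : ℝ => x) (u' := fun _ => 1)
    (v := φ) (v' := deriv φ) (fun x _ => hasDerivAt_id x)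
    (fun x _ => (hφ.differentiable (by simp) x).hasDerivAt) h1 (by simpa [Pi.mul_def] using h2) h3
  simpa using this

theorem integral_sub_const_mul_id_mul_deriv {g φ : ℝ → ℝ} {K : ℝ} (hg : LocallyIntegrable g)
    (hφ : ContDiff ℝ ∞ φ) (hs : HasCompactSupport φ) :
    ∫ x, (g x - K * x) * deriv φ x = (∫ x, g x * deriv φ x) + K * ∫ x, φ x := by
  have hd : Continuous (deriv φ) := hφ.continuous_deriv (by simp)
  have h1 := integrable_mul_of_hasCompactSupport hg hd hs.deriv
  have h2 : Integrable (fun x : ℝ => x * deriv φ x) :=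
    integrable_mul_of_hasCompactSupport continuous_id.locallyIntegrable hd hs.deriv
  have e : ∫ x, (g x - K * x) * deriv φ x = (∫ x, g x * deriv φ x) - K * ∫ x, x * deriv φ x := by
    rw [← integral_const_mul, ← integral_sub h1 (h2.const_mul K)]
    congr 1; ext x; ring
  rw [e, integral_id_mul_deriv hφ hs]
  ring

/-- Subtracting `K * x` reduces to a nonpositive distributional derivative; right-continuity makes
the conclusion hold for all `x ≤ y` instead of almost all. -/
theorem DistribDerivLE.sub_le {g : ℝ → ℝ} {K : ℝ} (hg : DistribDerivLE g K)
    (hcont : ∀ x, ContinuousWithinAt g (Ici x) x) {x y : ℝ} (hxy : x ≤ y) :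
    g y - g x ≤ K * (y - x) := by
  have hl : LocallyIntegrable (fun x => g x - K * x) :=
    hg.1.sub (continuous_const.mul continuous_id).locallyIntegrable
  have := le_of_integral_mul_deriv_nonneg (g := fun x => g x - K * x) hxy (lt_add_one y)
    (hl.integrableOn_isCompact isCompact_Icc) ((hcont x).sub (by fun_prop))
    ((hcont y).sub (by fun_prop)) (fun θ h1 h2 _ h4 => by
      have := hg.2 θ h1 h2 h4
      rw [integral_sub_const_mul_id_mul_deriv hg.1 h1 h2]
      linarith)
  linarith

/-- Replace `φ'` by backward difference quotients. By translation invariance `∫ h (φ - φ(· - δ)) = ∫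
(h - h(· + δ)) φ`, which is nonnegative, and dominated convergence gives the limit `δ → 0`. -/
theorem integral_mul_deriv_nonneg_of_antitone {h φ : ℝ → ℝ} (hh : Antitone h)
    (hφ : ContDiff ℝ ∞ φ) (hs : HasCompactSupport φ) (h0 : ∀ x, 0 ≤ φ x) :
    0 ≤ ∫ x, h x * deriv φ x := by
  have hl : LocallyIntegrable h := hh.locallyIntegrable
  obtain ⟨C, hC⟩ := (hφ.continuous_deriv (by simp)).bounded_above_of_compact_support hs.deriv
  obtain ⟨R, hR⟩ := hs.isCompact.isBounded.subset_closedBall 0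
  have hR' : ∀ x, φ x ≠ 0 → |x| ≤ R := fun x hx => by
    simpa using hR (subset_tsupport _ hx)
  let δ : ℕ → ℝ := fun n => 1 / ((n : ℝ) + 1)
  have hδ : ∀ n, 0 < δ n := fun n => by positivity
  have hδ1 : ∀ n, δ n ≤ 1 := one_div_nat_add_one_le
  have hδ0 : Tendsto δ atTop (𝓝 0) := tendsto_one_div_add_atTop_nhds_zero_nat
  have hLip : ∀ x y, |φ x - φ y| ≤ C * |x - y| := fun x y => by
    have := Convex.norm_image_sub_le_of_norm_deriv_le (𝕜 := ℝ) (f := φ) (s := univ) (C := C)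
      (fun x _ => hφ.differentiable (by simp) x) (fun x _ => hC x) convex_univ (mem_univ y)
      (mem_univ x)
    simpa using this
  have hlim : Tendsto (fun n => ∫ x, h x * ((φ x - φ (x - δ n)) / δ n)) atTop
      (𝓝 (∫ x, h x * deriv φ x)) := by
    refine tendsto_integral_of_dominated_convergence
      (fun x => (Icc (-(R + 1)) (R + 1)).indicator (fun x => |h x| * C) x) ?_ ?_ ?_ ?_
    · intro n
      exact hl.aestronglyMeasurable.mul (((hφ.continuous.sub (hφ.continuous.comp
        (continuous_id.sub continuous_const))).div_const _).aestronglyMeasurable)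
    · rw [integrable_indicator_iff measurableSet_Icc]
      exact ((hl.integrableOn_isCompact isCompact_Icc).abs).mul_const C
    · intro n
      refine ae_of_all _ fun x => ?_
      by_cases hx : x ∈ Icc (-(R + 1)) (R + 1)
      · rw [indicator_of_mem hx, norm_mul, Real.norm_eq_abs]
        refine mul_le_mul_of_nonneg_left ?_ (abs_nonneg _)
        rw [norm_div, Real.norm_of_nonneg (hδ n).le, div_le_iff₀ (hδ n), Real.norm_eq_abs]
        have := hLip x (x - δ n)
        rwa [sub_sub_cancel, abs_of_pos (hδ n)] at this
      · rw [indicator_of_notMem hx]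
        have h1 : φ x = 0 := by
          by_contra hne
          have := hR' x hne
          rw [abs_le] at this
          exact hx ⟨by linarith, by linarith⟩
        have h2 : φ (x - δ n) = 0 := by
          by_contra hne
          have := hR' _ hne
          rw [abs_le] at this
          exact hx ⟨by linarith [hδ n], by linarith [hδ1 n]⟩
        simp [h1, h2]
    · refine ae_of_all _ fun x => ?_
      have hd := (hφ.differentiable (by simp) x).hasDerivAt
      have hs := hd.tendsto_slope_zero
      have ht : Tendsto (fun n => -δ n) atTop (𝓝[≠] 0) :=
        tendsto_nhdsWithin_iff.2 ⟨by simpa using hδ0.neg,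
          Eventually.of_forall fun n => by simpa using (hδ n).ne'⟩
      have := (hs.comp ht).const_mul (h x)
      refine this.congr fun n => ?_
      simp only [Function.comp, smul_eq_mul]
      have := (hδ n).ne'
      rw [← sub_eq_add_neg]
      field_simp
      ring
  refine ge_of_tendsto' hlim fun n => ?_
  have hi1 : Integrable (fun x => h x * φ x) :=
    integrable_mul_of_hasCompactSupport hl hφ.continuous hs
  have hi2 : Integrable (fun x => h x * φ (x - δ n)) :=
    integrable_mul_of_hasCompactSupport hl
      (hφ.continuous.comp (continuous_id.sub continuous_const))
      (hs.comp_homeomorph (Homeomorph.subRight (δ n)))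
  have e : ∫ x, h x * ((φ x - φ (x - δ n)) / δ n)
      = ((∫ x, h x * φ x) - ∫ x, h x * φ (x - δ n)) / δ n := by
    rw [← integral_sub hi1 hi2, ← integral_div]
    congr 1; ext x; ring
  rw [e]
  refine div_nonneg (sub_nonneg.2 ?_) (hδ n).le
  have e2 : ∫ x, h x * φ (x - δ n) = ∫ x, h (x + δ n) * φ x := by
    rw [← integral_add_right_eq_self (fun x => h x * φ (x - δ n)) (δ n)]
    simp
  have hi3 : Integrable (fun x => h (x + δ n) * φ x) := by
    have := hi2.comp_add_right (δ n)
    simpa using this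
  rw [e2]
  exact integral_mono hi3 hi1 fun x =>
    mul_le_mul_of_nonneg_right (hh (by linarith [hδ n])) (h0 x)

theorem distribDerivLE_of_sub_le {g : ℝ → ℝ} {K : ℝ}
    (hg : ∀ x y, x ≤ y → g y - g x ≤ K * (y - x)) : DistribDerivLE g K := by
  have ha : Antitone (fun x => g x - K * x) := fun x y hxy => by
    have := hg x y hxy
    simp only; linarith
  have hK : Continuous (fun x : ℝ => K * x) := continuous_const.mul continuous_id
  have hl : LocallyIntegrable g := by
    have := ha.locallyIntegrable.add (μ := volume) hK.locallyIntegrable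
    refine this.congr (ae_of_all _ fun x => ?_)
    simp
  refine ⟨hl, fun φ h1 h2 h3 => ?_⟩
  have := integral_mul_deriv_nonneg_of_antitone ha h1 h2 h3
  rw [integral_sub_const_mul_id_mul_deriv hl h1 h2] at this
  linarith

/-! ### The averaged speed -/

/-- This form removes the case distinction at `uI = uII` and turns the averaged speed into a mean of
`f'` over the segment joining the two states. -/
theorem averagedSpeed_eq_integral {f : ℝ → ℝ} (hf : ContDiff ℝ ∞ f) (uI uII : ℝ → ℝ → ℝ) (x t : ℝ) :
    averagedSpeed f uI uII x t =
      ∫ θ in (0 : ℝ)..1, deriv f (uI x t + θ * (uII x t - uI x t)) := by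
  unfold averagedSpeed
  split_ifs with h
  · simp [h]
  · have hne : uII x t - uI x t ≠ 0 := sub_ne_zero.2 h
    rw [div_eq_iff hne, ← intervalIntegral.integral_mul_const]
    have hcd : Continuous (deriv f) := hf.continuous_deriv (by simp)
    have := intervalIntegral.integral_eq_sub_of_hasDerivAt (a := 0) (b := 1)
      (f := fun θ => f (uI x t + θ * (uII x t - uI x t)))
      (f' := fun θ => deriv f (uI x t + θ * (uII x t - uI x t)) * (uII x t - uI x t))
      (fun θ _ => by
        have h1 : HasDerivAt (fun θ => uI x t + θ * (uII x t - uI x t)) (uII x t - uI x t) θ := by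
          simpa using ((hasDerivAt_id θ).mul_const (uII x t - uI x t)).const_add (uI x t)
        exact ((hf.differentiable (by simp) _).hasDerivAt).comp θ h1)
      ((Continuous.mul (hcd.comp (by fun_prop)) continuous_const).intervalIntegrable _ _)
    rw [this]
    simp

/-- A bounded function cannot decrease at a fixed rate on the whole line. The sign is needed because
an upper bound on an increment of a state controls the increment of `f'` through `sup f''` only when
that bound is nonnegative. -/
theorem OneSidedBound.nonneg {u : ℝ → ℝ → ℝ} {C M : ℝ} (h : OneSidedBound u C)
    (hc : ∀ x, ContinuousWithinAt (fun y => u y 1) (Ici x) x) (hM : ∀ x, |u x 1| ≤ M) : 0 ≤ C := by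
  by_contra hneg
  push Not at hneg
  have hM0 : 0 ≤ M := (abs_nonneg _).trans (hM 0)
  -- Over this distance the bound would force a drop of `2 * M + 1`, more than the oscillation `2 *
  -- M` allows.
  have hy : (0 : ℝ) ≤ (2 * M + 1) / (-C) := div_nonneg (by linarith) (by linarith)
  have h1 := (h 1 one_pos).sub_le hc hy
  have e : C / 1 * ((2 * M + 1) / (-C) - 0) = -(2 * M + 1) := by
    have := hneg.ne
    field_simp; ring
  rw [e] at h1
  have h2 := abs_le.1 (hM ((2 * M + 1) / (-C)))
  have h3 := abs_le.1 (hM 0)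
  linarith [h2.1, h3.2]

theorem convexHull_valueSet_subset {uI uII : ℝ → ℝ → ℝ} {M : ℝ}
    (hI : ∀ x t, 0 < t → |uI x t| ≤ M) (hII : ∀ x t, 0 < t → |uII x t| ≤ M) :
    convexHull ℝ (valueSet uI uII) ⊆ Icc (-M) M := by
  refine convexHull_min ?_ (convex_Icc _ _)
  rintro v ⟨x, t, ht, rfl | rfl⟩
  · exact abs_le.1 (hI x t ht)
  · exact abs_le.1 (hII x t ht)

/-- For `p ≤ q` this is the mean value inequality. For `q < p` the left side is nonpositive by
convexity, and `0 ≤ S * B` suffices. -/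
theorem deriv_sub_le_of_deriv_deriv_le {f : ℝ → ℝ} (hf : ContDiff ℝ ∞ f)
    (hconv : ∀ v, 0 < deriv (deriv f) v) {J : Set ℝ} (hJ : Convex ℝ J) {S B : ℝ}
    (hS : ∀ v ∈ J, deriv (deriv f) v ≤ S) (hB : 0 ≤ B) {p q : ℝ} (hp : p ∈ J) (hq : q ∈ J)
    (hpq : q - p ≤ B) : deriv f q - deriv f p ≤ S * B := by
  have hS0 : 0 ≤ S := (hconv p).le.trans (hS p hp)
  have hd : Differentiable ℝ (deriv f) :=
    (contDiff_infty_iff_deriv.1 hf).2.differentiable (by simp)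
  rcases le_total p q with h | h
  · have := Convex.image_sub_le_mul_sub_of_deriv_le (D := J) hJ hd.continuous.continuousOn
      hd.differentiableOn (fun x hx => hS x (interior_subset hx)) p hp q hq h
    exact this.trans (mul_le_mul_of_nonneg_left hpq hS0)
  · have hm : Monotone (deriv f) := monotone_of_deriv_nonneg hd fun x => (hconv x).le
    have := hm h
    have := mul_nonneg hS0 hB
    linarith

theorem oneSidedBound_averagedSpeed {f : ℝ → ℝ} (hf : ContDiff ℝ ∞ f)
    (hconv : ∀ v, 0 < deriv (deriv f) v) {uI uII : ℝ → ℝ → ℝ} (hI : IsEntropySolution f uI)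
    (hII : IsEntropySolution f uII) {CI CII : ℝ} (bI : OneSidedBound uI CI)
    (bII : OneSidedBound uII CII) :
    OneSidedBound (averagedSpeed f uI uII) (supSecondDeriv f uI uII * (CI + CII) / 2) := by
  intro t ht
  obtain ⟨MI, hMI⟩ := hI.bounded
  obtain ⟨MII, hMII⟩ := hII.bounded
  have hJ := convexHull_valueSet_subset (M := max MI MII)
    (fun x t ht => (hMI x t ht).trans (le_max_left _ _))
    (fun x t ht => (hMII x t ht).trans (le_max_right _ _))
  have hf1 := (contDiff_infty_iff_deriv.1 hf).2
  have hc2 : Continuous (deriv (deriv f)) := hf1.continuous_deriv (by simp)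
  -- `sSup` bounds the set only if the set is bounded above; this holds because `f''` is continuous
  -- and the values lie in a compact interval.
  have hS : ∀ v ∈ convexHull ℝ (valueSet uI uII), deriv (deriv f) v ≤ supSecondDeriv f uI uII :=
    fun v hv => le_csSup ((isCompact_Icc.image hc2).bddAbove.mono (image_mono hJ))
      (mem_image_of_mem _ hv)
  set S := supSecondDeriv f uI uII
  have hCI := bI.nonneg (hI.rightContinuous 1 one_pos) (fun x => hMI x 1 one_pos)
  have hCII := bII.nonneg (hII.rightContinuous 1 one_pos) (fun x => hMII x 1 one_pos)
  refine distribDerivLE_of_sub_le fun x y hxy => ?_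
  have h1 := (bI t ht).sub_le (hI.rightContinuous t ht) hxy
  have h2 := (bII t ht).sub_le (hII.rightContinuous t ht) hxy
  rw [averagedSpeed_eq_integral hf, averagedSpeed_eq_integral hf]
  have hi : ∀ x, IntervalIntegrable
      (fun θ : ℝ => deriv f (uI x t + θ * (uII x t - uI x t))) volume 0 1 := fun x =>
    (hf1.continuous.comp (by fun_prop)).intervalIntegrable _ _
  rw [← intervalIntegral.integral_sub (hi y) (hi x)]
  have hmem : ∀ x, ∀ θ ∈ Icc (0 : ℝ) 1,
      uI x t + θ * (uII x t - uI x t) ∈ convexHull ℝ (valueSet uI uII) := fun x θ hθ => by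
    have := (convex_convexHull ℝ (valueSet uI uII)).add_smul_sub_mem
      (subset_convexHull ℝ _ ⟨x, t, ht, Or.inl rfl⟩) (subset_convexHull ℝ _ ⟨x, t, ht, Or.inr rfl⟩)
      hθ
    simpa using this
  have hle : ∫ θ in (0 : ℝ)..1, (deriv f (uI y t + θ * (uII y t - uI y t))
      - deriv f (uI x t + θ * (uII x t - uI x t))) ≤
      ∫ θ in (0 : ℝ)..1, (S * ((y - x) / t)) * (CI + θ * (CII - CI)) := by
    refine intervalIntegral.integral_mono_on zero_le_one ((hi y).sub (hi x))
      ((by fun_prop : Continuous fun θ : ℝ =>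
        (S * ((y - x) / t)) * (CI + θ * (CII - CI))).intervalIntegrable _ _) fun θ hθ => ?_
    have hyx : 0 ≤ (y - x) / t := div_nonneg (by linarith) ht.le
    have hC : 0 ≤ CI + θ * (CII - CI) := by nlinarith [hθ.1, hθ.2]
    have := deriv_sub_le_of_deriv_deriv_le hf hconv (convex_convexHull ℝ _) hS
      (B := ((y - x) / t) * (CI + θ * (CII - CI))) (mul_nonneg hyx hC) (hmem x θ hθ) (hmem y θ hθ)
      (by
        have a1 := mul_le_mul_of_nonneg_left h1 (sub_nonneg.2 hθ.2)
        have a2 := mul_le_mul_of_nonneg_left h2 hθ.1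
        have e : (y - x) / t * (CI + θ * (CII - CI))
          = (1 - θ) * (CI / t * (y - x)) + θ * (CII / t * (y - x)) := by ring
        rw [e]; linarith)
    rwa [← mul_assoc] at this
  -- The mean of `CI + θ * (CII - CI)` over `[0, 1]` is `(CI + CII) / 2`.
  refine hle.trans_eq ?_
  rw [intervalIntegral.integral_const_mul, intervalIntegral.integral_add (by simp)
    ((by fun_prop : Continuous fun θ : ℝ => θ * (CII - CI)).intervalIntegrable _ _),
    intervalIntegral.integral_mul_const, integral_id]
  simp only [intervalIntegral.integral_const, smul_eq_mul]
  ring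

/-! ### Uniformly convex fluxes and the Legendre transform -/

/-- `F` is twice continuously differentiable with derivatives `F₁`, `F₂`, and `F₂ ≥ c > 0`. -/
structure IsUniformlyConvexFlux (F F₁ F₂ : ℝ → ℝ) (c : ℝ) : Prop where
  hasDerivAt : ∀ v, HasDerivAt F (F₁ v) v
  hasDerivAt_deriv : ∀ v, HasDerivAt F₁ (F₂ v) v
  continuous_deriv_deriv : Continuous F₂
  pos : 0 < c
  le : ∀ v, c ≤ F₂ v

/-- A strictly convex flux agrees on a bounded interval with a uniformly convex one. -/
theorem exists_isUniformlyConvexFlux {f : ℝ → ℝ} (hf : ContDiff ℝ ∞ f)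
    (hconv : ∀ v, 0 < deriv (deriv f) v) {M : ℝ} (hM : 0 ≤ M) :
    ∃ F F₁ F₂ c, IsUniformlyConvexFlux F F₁ F₂ c ∧ ∀ v ∈ Icc (-M) M, F v = f v := by
  have hf1 := (contDiff_infty_iff_deriv.1 hf).2
  have hc2 : Continuous (deriv (deriv f)) := hf1.continuous_deriv (by simp)
  have hMM : -M ≤ M := by linarith
  -- Freeze `f''` at its endpoint values outside `[-M, M]` and integrate twice from `0`. The
  -- convexity constant is then the minimum of `f''` on `[-M, M]`.
  let h : ℝ → ℝ := fun v => deriv (deriv f) (projIcc (-M) M hMM v)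
  have hh : Continuous h := hc2.comp (continuous_subtype_val.comp continuous_projIcc)
  let F₁ : ℝ → ℝ := fun v => deriv f 0 + ∫ s in (0 : ℝ)..v, h s
  have hF₁ : ∀ v, HasDerivAt F₁ (h v) v := fun v =>
    (intervalIntegral.integral_hasDerivAt_right (hh.intervalIntegrable _ _)
      (hh.stronglyMeasurableAtFilter _ _) hh.continuousAt).const_add _
  have hF₁c : Continuous F₁ := continuous_iff_continuousAt.2 fun v => (hF₁ v).continuousAt
  let F : ℝ → ℝ := fun v => f 0 + ∫ s in (0 : ℝ)..v, F₁ s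
  have hF : ∀ v, HasDerivAt F (F₁ v) v := fun v =>
    (intervalIntegral.integral_hasDerivAt_right (hF₁c.intervalIntegrable _ _)
      (hF₁c.stronglyMeasurableAtFilter _ _) hF₁c.continuousAt).const_add _
  obtain ⟨v0, hv0, hmin⟩ := isCompact_Icc.exists_isMinOn (nonempty_Icc.2 hMM) hc2.continuousOn
  have hsub : ∀ v ∈ Icc (-M) M, ∀ s ∈ uIcc 0 v, s ∈ Icc (-M) M := fun v hv s hs =>
    (uIcc_subset_Icc ⟨by linarith, hM⟩ hv) hs
  have e1 : ∀ v ∈ Icc (-M) M, F₁ v = deriv f v := fun v hv => by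
    have : ∫ s in (0 : ℝ)..v, h s = ∫ s in (0 : ℝ)..v, deriv (deriv f) s :=
      intervalIntegral.integral_congr fun s hs => by
        simp only [h]; rw [projIcc_of_mem hMM (hsub v hv s hs)]
    simp only [F₁]
    rw [this, intervalIntegral.integral_deriv_eq_sub
      (fun x _ => hf1.differentiable (by simp) x) (hc2.intervalIntegrable _ _)]
    ring
  refine ⟨F, F₁, h, deriv (deriv f) v0, ⟨hF, hF₁, hh, hconv _, fun v => ?_⟩, fun v hv => ?_⟩
  · exact hmin (projIcc (-M) M hMM v).2
  · have : ∫ s in (0 : ℝ)..v, F₁ s = ∫ s in (0 : ℝ)..v, deriv f s :=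
      intervalIntegral.integral_congr fun s hs => e1 s (hsub v hv s hs)
    simp only [F]
    rw [this, intervalIntegral.integral_deriv_eq_sub
      (fun x _ => hf.differentiable (by simp) x) (hf1.continuous.intervalIntegrable _ _)]
    ring

/-- The inverse of the derivative of the flux. -/
noncomputable def invDeriv (F₁ : ℝ → ℝ) : ℝ → ℝ := Function.invFun F₁

/-- The Legendre transform of the flux. -/
noncomputable def legendre (F F₁ : ℝ → ℝ) (p : ℝ) : ℝ := p * invDeriv F₁ p - F (invDeriv F₁ p)

namespace IsUniformlyConvexFlux

variable {F F₁ F₂ : ℝ → ℝ} {c : ℝ}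

theorem continuous (h : IsUniformlyConvexFlux F F₁ F₂ c) : Continuous F :=
  continuous_iff_continuousAt.2 fun v => (h.hasDerivAt v).continuousAt

theorem continuous_deriv (h : IsUniformlyConvexFlux F F₁ F₂ c) : Continuous F₁ :=
  continuous_iff_continuousAt.2 fun v => (h.hasDerivAt_deriv v).continuousAt

theorem mul_sub_le (h : IsUniformlyConvexFlux F F₁ F₂ c) {a b : ℝ} (hab : a ≤ b) :
    c * (b - a) ≤ F₁ b - F₁ a :=
  mul_sub_le_image_sub_of_le_deriv (fun v => (h.hasDerivAt_deriv v).differentiableAt)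
    (fun v => by rw [(h.hasDerivAt_deriv v).deriv]; exact h.le v) hab

theorem strictMono (h : IsUniformlyConvexFlux F F₁ F₂ c) : StrictMono F₁ := fun a b hab => by
  have := h.mul_sub_le hab.le
  have := mul_pos h.pos (sub_pos.2 hab)
  linarith

theorem surjective (h : IsUniformlyConvexFlux F F₁ F₂ c) : Function.Surjective F₁ := by
  refine h.continuous_deriv.surjective ?_ ?_
  · refine tendsto_atTop_mono' atTop (f₁ := fun v => c * v + F₁ 0) ?_
      (tendsto_atTop_add_const_right _ _ (tendsto_id.const_mul_atTop h.pos))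
    filter_upwards [eventually_ge_atTop 0] with v hv
    have := h.mul_sub_le hv
    linarith
  · refine tendsto_atBot_mono' atBot (f₁ := fun v => c * v + F₁ 0) ?_
      (tendsto_atBot_add_const_right _ _ (tendsto_id.const_mul_atBot h.pos))
    filter_upwards [eventually_le_atBot 0] with v hv
    have := h.mul_sub_le hv
    linarith

theorem apply_invDeriv (h : IsUniformlyConvexFlux F F₁ F₂ c) (p : ℝ) : F₁ (invDeriv F₁ p) = p :=
  Function.rightInverse_invFun h.surjective p

theorem invDeriv_apply (h : IsUniformlyConvexFlux F F₁ F₂ c) (v : ℝ) : invDeriv F₁ (F₁ v) = v :=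
  Function.leftInverse_invFun h.strictMono.injective v

theorem monotone_invDeriv (h : IsUniformlyConvexFlux F F₁ F₂ c) : Monotone (invDeriv F₁) :=
  fun p q hpq => by
    rw [← h.strictMono.le_iff_le, h.apply_invDeriv, h.apply_invDeriv]
    exact hpq

theorem invDeriv_sub_le (h : IsUniformlyConvexFlux F F₁ F₂ c) {p q : ℝ} (hpq : p ≤ q) :
    invDeriv F₁ q - invDeriv F₁ p ≤ (q - p) / c := by
  have := h.mul_sub_le (h.monotone_invDeriv hpq)
  rw [h.apply_invDeriv, h.apply_invDeriv] at this
  rw [le_div_iff₀ h.pos]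
  linarith

theorem continuous_invDeriv (h : IsUniformlyConvexFlux F F₁ F₂ c) : Continuous (invDeriv F₁) :=
  h.monotone_invDeriv.continuous_of_surjective fun v => ⟨F₁ v, h.invDeriv_apply v⟩

theorem tangent_le (h : IsUniformlyConvexFlux F F₁ F₂ c) (v k : ℝ) :
    F v + F₁ v * (k - v) ≤ F k := by
  have hd : Differentiable ℝ F := fun v => (h.hasDerivAt v).differentiableAt
  have hdv : ∀ v, deriv F v = F₁ v := fun v => (h.hasDerivAt v).deriv
  rcases le_total v k with hk | hk
  · have := Convex.mul_sub_le_image_sub_of_le_deriv (convex_Ici v) hd.continuous.continuousOn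
      hd.differentiableOn (C := F₁ v) (fun x hx => by
        rw [hdv]; exact h.strictMono.monotone (interior_subset hx)) v self_mem_Ici k hk hk
    linarith
  · have := Convex.image_sub_le_mul_sub_of_deriv_le (convex_Iic v) hd.continuous.continuousOn
      hd.differentiableOn (C := F₁ v) (fun x hx => by
        rw [hdv]; exact h.strictMono.monotone (interior_subset (s := Iic v) hx)) k hk v self_mem_Iic hk
    linarith

theorem mul_sub_le_legendre (h : IsUniformlyConvexFlux F F₁ F₂ c) (k p : ℝ) :
    k * p - F k ≤ legendre F F₁ p := by
  have := h.tangent_le (invDeriv F₁ p) k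
  rw [h.apply_invDeriv] at this
  unfold legendre
  linarith

/-- Young's inequality at `p` and at `q` traps the remainder `L q - L p - g p * (q - p)`, with `g`
the inverse of `F₁`, between `0` and `(g q - g p) * (q - p) ≤ (q - p)² / c`. No differentiability of
`g` is needed. -/
theorem hasDerivAt_legendre (h : IsUniformlyConvexFlux F F₁ F₂ c) (p : ℝ) :
    HasDerivAt (legendre F F₁) (invDeriv F₁ p) p := by
  rw [hasDerivAt_iff_isLittleO]
  have hsq : (fun q => (q - p) * (q - p)) =o[𝓝 p] fun q => q - p := by
    have h0 : (fun q : ℝ => q - p) =o[𝓝 p] fun _ => (1 : ℝ) := by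
      rw [Asymptotics.isLittleO_one_iff]
      have : Continuous fun q : ℝ => q - p := by fun_prop
      simpa using this.tendsto p
    simpa using (Asymptotics.isBigO_refl (fun q : ℝ => q - p) (𝓝 p)).mul_isLittleO h0
  refine Asymptotics.IsBigO.trans_isLittleO (Asymptotics.IsBigO.of_bound (1 / c)
    (Eventually.of_forall fun q => ?_)) hsq
  have e : ∀ p, legendre F F₁ p = invDeriv F₁ p * p - F (invDeriv F₁ p) := fun p => by
    unfold legendre; ring
  have h1 := h.mul_sub_le_legendre (invDeriv F₁ p) q
  have h2 := h.mul_sub_le_legendre (invDeriv F₁ q) p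
  have e1 := e p
  have e2 := e q
  have h3 : (invDeriv F₁ q - invDeriv F₁ p) * (q - p) ≤ 1 / c * ((q - p) * (q - p)) := by
    rcases le_total p q with hpq | hpq
    · have := mul_le_mul_of_nonneg_right (h.invDeriv_sub_le hpq) (sub_nonneg.2 hpq)
      calc _ ≤ _ := this
        _ = _ := by ring
    · have := mul_le_mul_of_nonneg_right (h.invDeriv_sub_le hpq) (sub_nonneg.2 hpq)
      calc (invDeriv F₁ q - invDeriv F₁ p) * (q - p)
          = (invDeriv F₁ p - invDeriv F₁ q) * (p - q) := by ring
        _ ≤ _ := this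
        _ = _ := by ring
  simp only [smul_eq_mul, Real.norm_eq_abs]
  rw [abs_of_nonneg (mul_self_nonneg (q - p)), abs_of_nonneg (by linarith)]
  linarith

theorem continuous_legendre (h : IsUniformlyConvexFlux F F₁ F₂ c) : Continuous (legendre F F₁) :=
  continuous_iff_continuousAt.2 fun p => (h.hasDerivAt_legendre p).continuousAt

/-- The derivative of `L` increases at rate at most `1 / c`. This semiconcavity is what the
potential will inherit. -/
theorem concaveOn_legendre_sub (h : IsUniformlyConvexFlux F F₁ F₂ c) :
    ConcaveOn ℝ univ fun p => legendre F F₁ p - p ^ 2 / (2 * c) := by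
  have hd : ∀ p, HasDerivAt (fun p => legendre F F₁ p - p ^ 2 / (2 * c))
      (invDeriv F₁ p - p / c) p := fun p => by
    refine (h.hasDerivAt_legendre p).sub (((hasDerivAt_pow 2 p).div_const (2 * c)).congr_deriv ?_)
    have := h.pos.ne'
    push_cast
    field_simp
  refine Antitone.concaveOn_univ_of_deriv (fun p => (hd p).differentiableAt) ?_
  have : deriv (fun p => legendre F F₁ p - p ^ 2 / (2 * c)) = fun p => invDeriv F₁ p - p / c :=
    funext fun p => (hd p).deriv
  rw [this]
  intro p q hpq
  have := h.invDeriv_sub_le hpq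
  rw [sub_div] at this
  linarith

end IsUniformlyConvexFlux

/-! ### Kruzhkov inequalities for C¹ test functions and a modified flux -/

/-- The Kruzhkov entropy flux `sgn (r - k) * (F r - F k)`. -/
noncomputable def kruzhkovFlux (F : ℝ → ℝ) (r k : ℝ) : ℝ := F (max r k) - F (min r k)

theorem sign_mul_eq_kruzhkovFlux (F : ℝ → ℝ) (r k : ℝ) :
    Real.sign (r - k) * (F r - F k) = kruzhkovFlux F r k := by
  unfold kruzhkovFlux
  rcases lt_trichotomy r k with h | h | h
  · rw [Real.sign_of_neg (by linarith), max_eq_right h.le, min_eq_left h.le]; ring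
  · simp [h]
  · rw [Real.sign_of_pos (by linarith), max_eq_left h.le, min_eq_right h.le]; ring

theorem continuous_kruzhkovFlux {F : ℝ → ℝ} (hF : Continuous F) :
    Continuous fun q : ℝ × ℝ => kruzhkovFlux F q.1 q.2 := by
  unfold kruzhkovFlux
  fun_prop

/-- The identity behind the cancellation of the cutoff's derivatives in
`integral_deriv_mul_cutoff_nonneg`. -/
theorem kruzhkovFlux_mul_sub (F : ℝ → ℝ) (r k : ℝ) :
    kruzhkovFlux F r k * (r - k) = |r - k| * (F r - F k) := by
  rw [← sign_mul_eq_kruzhkovFlux]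
  rcases lt_trichotomy r k with h | h | h
  · rw [Real.sign_of_neg (by linarith), abs_of_neg (by linarith)]; ring
  · simp [h]
  · rw [Real.sign_of_pos (by linarith), abs_of_pos (by linarith)]; ring

/-- The open half-plane of positive times. -/
def posTime : Set (ℝ × ℝ) := {p | 0 < p.2}

theorem isOpen_posTime : IsOpen posTime := isOpen_lt continuous_const continuous_snd

theorem measurableSet_posTime : MeasurableSet posTime := isOpen_posTime.measurableSet

/-- Bounded solutions of the Kruzhkov entropy inequalities, tested against `C¹` functions. -/
structure IsKruzhkovSolution (F : ℝ → ℝ) (u : ℝ → ℝ → ℝ) (M : ℝ) : Prop where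
  aestronglyMeasurable : AEStronglyMeasurable (fun p : ℝ × ℝ => u p.1 p.2) (volume.restrict posTime)
  abs_apply_le : ∀ x t, 0 < t → |u x t| ≤ M
  measurable : ∀ t, 0 < t → Measurable fun x => u x t
  rightContinuous : ∀ t, 0 < t → ∀ x, ContinuousWithinAt (fun y => u y t) (Ici x) x
  continuous_L1loc : ∀ t, 0 < t → ∀ R, 0 < R →
    Tendsto (fun s => ∫ x in Icc (-R) R, |u x s - u x t|) (𝓝 t) (𝓝 0)
  entropy : ∀ k, ∀ φ : ℝ × ℝ → ℝ, ContDiff ℝ 1 φ → HasCompactSupport φ → tsupport φ ⊆ posTime →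
    (∀ p, 0 ≤ φ p) → 0 ≤ ∫ p in posTime, (|u p.1 p.2 - k| * fderiv ℝ φ p (0, 1)
      + kruzhkovFlux F (u p.1 p.2) k * fderiv ℝ φ p (1, 0))

theorem integrable_restrict_mul {X : Type*} [TopologicalSpace X] [MeasurableSpace X]
    [OpensMeasurableSpace X] {μ : Measure X} [IsFiniteMeasureOnCompacts μ]
    {S : Set X} (hS : MeasurableSet S) {a ψ : X → ℝ} {C : ℝ}
    (ha : AEStronglyMeasurable a (μ.restrict S)) (hb : ∀ p ∈ S, |a p| ≤ C)
    (hψ : Continuous ψ) (hs : HasCompactSupport ψ) :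
    Integrable (fun p => a p * ψ p) (μ.restrict S) :=
  (hψ.integrable_of_hasCompactSupport hs).restrict.bdd_mul ha
    (ae_restrict_of_forall_mem hS hb)

theorem exists_bound_of_continuous {g : ℝ → ℝ} (hg : Continuous g) (M : ℝ) :
    ∃ C, ∀ r, |r| ≤ M → |g r| ≤ C := by
  obtain ⟨C, hC⟩ := isCompact_Icc.exists_bound_of_continuousOn (s := Icc (-M) M) hg.continuousOn
  exact ⟨C, fun r hr => hC r (abs_le.1 hr)⟩

theorem integrable_comp_mul {u : ℝ → ℝ → ℝ} {M : ℝ}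
    (hm : AEStronglyMeasurable (fun p : ℝ × ℝ => u p.1 p.2) (volume.restrict posTime))
    (hb : ∀ x t, 0 < t → |u x t| ≤ M) {g : ℝ → ℝ} (hg : Continuous g) {ψ : ℝ × ℝ → ℝ}
    (hψ : Continuous ψ) (hs : HasCompactSupport ψ) :
    Integrable (fun p => g (u p.1 p.2) * ψ p) (volume.restrict posTime) := by
  obtain ⟨C, hC⟩ := exists_bound_of_continuous hg M
  exact integrable_restrict_mul measurableSet_posTime (hg.comp_aestronglyMeasurable hm)
    (fun p hp => hC _ (hb p.1 p.2 hp)) hψ hs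

theorem setIntegral_posTime_fderiv_eq_zero {φ : ℝ × ℝ → ℝ} (hφ : ContDiff ℝ 1 φ)
    (hs : HasCompactSupport φ) (ht : tsupport φ ⊆ posTime) (v : ℝ × ℝ) :
    ∫ p in posTime, fderiv ℝ φ p v = 0 := by
  have hc : Continuous fun p => fderiv ℝ φ p v := (hφ.continuous_fderiv (by simp)).clm_apply continuous_const
  rw [setIntegral_eq_integral_of_forall_compl_eq_zero]
  · have := integral_mul_fderiv_eq_neg_fderiv_mul_of_integrable (𝕜 := ℝ) (μ := volume)
      (f := fun _ : ℝ × ℝ => (1 : ℝ)) (g := φ) (v := v) (by simp)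
      (by simpa using hc.integrable_of_hasCompactSupport (hs.fderiv_apply ℝ v))
      (by simpa using hφ.continuous.integrable_of_hasCompactSupport hs)
      (fun x _ => by simp) (fun x _ => hφ.differentiable (by simp) x)
    simpa using this
  · intro p hp
    have : p ∉ tsupport φ := fun h => hp (ht h)
    rw [fderiv_of_notMem_tsupport ℝ this]
    simp

/-- A sequence of smooth mollifiers on the plane. -/
noncomputable def planeBump (n : ℕ) : ContDiffBump (0 : ℝ × ℝ) where
  rIn := 1 / (2 * ((n : ℝ) + 1))
  rOut := 1 / ((n : ℝ) + 1)
  rIn_pos := by positivity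
  rIn_lt_rOut := by
    apply one_div_lt_one_div_of_lt (by positivity)
    linarith [(Nat.cast_nonneg n : (0 : ℝ) ≤ n)]

/-- Mollification in the plane. -/
noncomputable def mollify (n : ℕ) (φ : ℝ × ℝ → ℝ) : ℝ × ℝ → ℝ :=
  convolution ((planeBump n).normed volume) φ (ContinuousLinearMap.lsmul ℝ ℝ) volume

theorem contDiff_mollify (n : ℕ) {φ : ℝ × ℝ → ℝ} (hφ : Continuous φ) :
    ContDiff ℝ ∞ (mollify n φ) :=
  (planeBump n).hasCompactSupport_normed.contDiff_convolution_left _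
    (planeBump n).contDiff_normed hφ.locallyIntegrable

theorem mollify_nonneg (n : ℕ) {φ : ℝ × ℝ → ℝ} (h0 : ∀ p, 0 ≤ φ p) (p : ℝ × ℝ) :
    0 ≤ mollify n φ p :=
  integral_nonneg fun q => mul_nonneg ((planeBump n).nonneg_normed q) (h0 _)

theorem fderiv_mollify (n : ℕ) {φ : ℝ × ℝ → ℝ} (hφ : ContDiff ℝ 1 φ) (hs : HasCompactSupport φ)
    (p v : ℝ × ℝ) :
    fderiv ℝ (mollify n φ) p v = mollify n (fun q => fderiv ℝ φ q v) p := by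
  have hl : LocallyIntegrable ((planeBump n).normed volume) :=
    (planeBump n).integrable_normed.locallyIntegrable
  have := (hs.hasFDerivAt_convolution_right (ContinuousLinearMap.lsmul ℝ ℝ) hl hφ p).fderiv
  unfold mollify
  rw [this, convolution_precompR_apply (hf := hl) (hcg := hs.fderiv ℝ)
    (hg := hφ.continuous_fderiv (by simp))]

theorem tendsto_mollify {φ : ℝ × ℝ → ℝ} (hφ : Continuous φ) (p : ℝ × ℝ) :
    Tendsto (fun n => mollify n φ p) atTop (𝓝 (φ p)) :=
  ContDiffBump.convolution_tendsto_right_of_continuous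
    (by exact tendsto_one_div_add_atTop_nhds_zero_nat) hφ p

theorem abs_mollify_le (n : ℕ) {φ : ℝ × ℝ → ℝ} (hφ : Continuous φ) {C : ℝ} (hC : ∀ p, |φ p| ≤ C)
    (p : ℝ × ℝ) : |mollify n φ p| ≤ 3 * C := by
  have := (planeBump n).dist_normed_convolution_le (μ := volume) (x₀ := p) (ε := 2 * C)
    hφ.aestronglyMeasurable (fun x _ => by
      rw [Real.dist_eq]
      have := abs_sub (φ x) (φ p)
      linarith [hC x, hC p])
  rw [Real.dist_eq] at this
  have h2 := abs_sub_abs_le_abs_sub (mollify n φ p) (φ p)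
  have h3 := hC p
  unfold mollify at h2 ⊢
  linarith

theorem mollify_eq_zero {n : ℕ} {φ : ℝ × ℝ → ℝ} {K : Set (ℝ × ℝ)} {δ : ℝ}
    (hK : ∀ p, p ∉ K → φ p = 0) (hδ : 1 / ((n : ℝ) + 1) ≤ δ) {p : ℝ × ℝ}
    (hp : p ∉ Metric.cthickening δ K) : mollify n φ p = 0 := by
  have h : ∀ x ∈ Metric.ball p (planeBump n).rOut, φ x = 0 := fun x hx => by
    refine hK x fun hxK => hp ?_
    refine Metric.mem_cthickening_of_dist_le p x δ K hxK ?_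
    rw [Metric.mem_ball, dist_comm] at hx
    exact hx.le.trans hδ
  unfold mollify
  have h0 := h p (Metric.mem_ball_self (planeBump n).rOut_pos)
  rw [(planeBump n).normed_convolution_eq_right fun x hx => by rw [h x hx, h0], h0]

/-- Kruzhkov's inequalities extend from smooth to continuously differentiable test functions. -/
theorem nonneg_of_forall_smooth {u : ℝ → ℝ → ℝ} {M : ℝ} {F : ℝ → ℝ} (hF : Continuous F) {k : ℝ}
    (hm : AEStronglyMeasurable (fun p : ℝ × ℝ => u p.1 p.2) (volume.restrict posTime))
    (hb : ∀ x t, 0 < t → |u x t| ≤ M)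
    (h : ∀ φ : ℝ × ℝ → ℝ, ContDiff ℝ ∞ φ → HasCompactSupport φ → tsupport φ ⊆ posTime →
      (∀ p, 0 ≤ φ p) → 0 ≤ ∫ p in posTime, (|u p.1 p.2 - k| * fderiv ℝ φ p (0, 1)
        + kruzhkovFlux F (u p.1 p.2) k * fderiv ℝ φ p (1, 0)))
    {φ : ℝ × ℝ → ℝ} (hφ : ContDiff ℝ 1 φ) (hs : HasCompactSupport φ) (ht : tsupport φ ⊆ posTime)
    (h0 : ∀ p, 0 ≤ φ p) : 0 ≤ ∫ p in posTime, (|u p.1 p.2 - k| * fderiv ℝ φ p (0, 1)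
      + kruzhkovFlux F (u p.1 p.2) k * fderiv ℝ φ p (1, 0)) := by
  -- Mollification enlarges supports. The index is shifted by `N` so that all mollified test
  -- functions vanish outside one compact `δ`-thickening contained in the open half-plane.
  obtain ⟨δ, hδ, hδ'⟩ := hs.isCompact.exists_cthickening_subset_open isOpen_posTime ht
  have hKc : IsCompact (Metric.cthickening δ (tsupport φ)) := hs.isCompact.cthickening
  obtain ⟨N, hN⟩ := exists_nat_one_div_lt hδ
  have hn : ∀ n : ℕ, 1 / (((n + N : ℕ) : ℝ) + 1) ≤ δ := fun n => by
    refine le_trans ?_ hN.le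
    apply one_div_le_one_div_of_le (by positivity)
    push_cast; linarith [(Nat.cast_nonneg n : (0 : ℝ) ≤ n)]
  have hd : ∀ v, Continuous fun p => fderiv ℝ φ p v := fun v =>
    (hφ.continuous_fderiv (by simp)).clm_apply continuous_const
  have hd0 : ∀ v, ∀ p, p ∉ tsupport φ → fderiv ℝ φ p v = 0 := fun v p hp => by
    rw [fderiv_of_notMem_tsupport ℝ hp]; simp
  have hts : ∀ n, tsupport (mollify (n + N) φ) ⊆ Metric.cthickening δ (tsupport φ) := fun n => by
    refine closure_minimal (fun p hp => ?_) Metric.isClosed_cthickening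
    by_contra hp'
    exact hp (mollify_eq_zero (fun p hp => image_eq_zero_of_notMem_tsupport hp) (hn n) hp')
  obtain ⟨C1, hC1⟩ := exists_bound_of_continuous (g := fun r => |r - k|) (by fun_prop) M
  obtain ⟨C2, hC2⟩ := exists_bound_of_continuous (g := fun r => kruzhkovFlux F r k)
    ((continuous_kruzhkovFlux hF).comp (continuous_id.prodMk continuous_const)) M
  have hb1 : ∀ v, ∃ B, ∀ p, |fderiv ℝ φ p v| ≤ B := fun v =>
    (hd v).bounded_above_of_compact_support (hs.fderiv_apply ℝ v)
  obtain ⟨B1, hB1⟩ := hb1 (0, 1)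
  obtain ⟨B2, hB2⟩ := hb1 (1, 0)
  have hlim : Tendsto (fun n => ∫ p in posTime,
      (|u p.1 p.2 - k| * fderiv ℝ (mollify (n + N) φ) p (0, 1)
      + kruzhkovFlux F (u p.1 p.2) k * fderiv ℝ (mollify (n + N) φ) p (1, 0))) atTop
      (𝓝 (∫ p in posTime, (|u p.1 p.2 - k| * fderiv ℝ φ p (0, 1)
      + kruzhkovFlux F (u p.1 p.2) k * fderiv ℝ φ p (1, 0)))) := by
    simp_rw [fderiv_mollify _ hφ hs]
    refine tendsto_integral_of_dominated_convergence
      ((Metric.cthickening δ (tsupport φ)).indicator fun _ => C1 * (3 * B1) + C2 * (3 * B2))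
      ?_ ?_ ?_ ?_
    · intro n
      refine AEStronglyMeasurable.add ?_ ?_
      · exact ((by fun_prop : Continuous fun r : ℝ => |r - k|).comp_aestronglyMeasurable hm).mul
          (contDiff_mollify _ (hd _)).continuous.aestronglyMeasurable
      · exact (((continuous_kruzhkovFlux hF).comp
          (continuous_id.prodMk continuous_const)).comp_aestronglyMeasurable hm).mul
          (contDiff_mollify _ (hd _)).continuous.aestronglyMeasurable
    · refine Integrable.restrict ?_
      rw [integrable_indicator_iff hKc.measurableSet]
      exact integrableOn_const hKc.measure_lt_top.ne
    · intro n
      refine ae_restrict_of_forall_mem measurableSet_posTime fun p hp => ?_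
      by_cases hpK : p ∈ Metric.cthickening δ (tsupport φ)
      · rw [indicator_of_mem hpK]
        refine (norm_add_le _ _).trans (add_le_add ?_ ?_)
        · rw [norm_mul]
          exact mul_le_mul (hC1 _ (hb _ _ hp)) (abs_mollify_le _ (hd _) hB1 p) (norm_nonneg _)
            ((abs_nonneg _).trans (hC1 _ (hb p.1 p.2 hp)))
        · rw [norm_mul]
          exact mul_le_mul (hC2 _ (hb _ _ hp)) (abs_mollify_le _ (hd _) hB2 p) (norm_nonneg _)
            ((abs_nonneg _).trans (hC2 _ (hb p.1 p.2 hp)))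
      · rw [indicator_of_notMem hpK, mollify_eq_zero (hd0 _) (hn n) hpK,
          mollify_eq_zero (hd0 _) (hn n) hpK]
        simp
    · refine ae_of_all _ fun p => ?_
      exact (((tendsto_mollify (hd _) p).comp (tendsto_add_atTop_nat N)).const_mul _).add
        (((tendsto_mollify (hd _) p).comp (tendsto_add_atTop_nat N)).const_mul _)
  refine ge_of_tendsto' hlim fun n => h _ (contDiff_mollify _ hφ.continuous)
    (hKc.of_isClosed_subset (isClosed_tsupport _) (hts n)) ((hts n).trans hδ')
    (mollify_nonneg _ h0)

theorem measurable_of_boundedVariationOn {g : ℝ → ℝ} (h : BoundedVariationOn g univ) :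
    Measurable g := by
  obtain ⟨p, q, hp, hq, rfl⟩ := h.locallyBoundedVariationOn.exists_monotoneOn_sub_monotoneOn
  exact (monotoneOn_univ.1 hp).measurable.sub (monotoneOn_univ.1 hq).measurable

/-- An entropy solution also solves the law for a flux which differs only off its range. -/
theorem IsEntropySolution.isKruzhkovSolution {f F : ℝ → ℝ} (hf : Continuous f) (hF : Continuous F)
    {u : ℝ → ℝ → ℝ} (hu : IsEntropySolution f u) {M : ℝ} (hM : ∀ x t, 0 < t → |u x t| ≤ M)
    (hfF : ∀ v ∈ Icc (-M) M, F v = f v) : IsKruzhkovSolution F u M where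
  aestronglyMeasurable := hu.aestronglyMeasurable
  abs_apply_le := hM
  measurable t ht := measurable_of_boundedVariationOn (hu.boundedVariation t ht)
  rightContinuous := hu.rightContinuous
  continuous_L1loc := hu.continuous_L1loc
  entropy k φ := by
    refine nonneg_of_forall_smooth hF hu.aestronglyMeasurable hM fun φ h1 h2 h3 h4 => ?_
    have hφ1 : ContDiff ℝ 1 φ := h1.of_le (by simp)
    have hd : ∀ v, Continuous fun p => fderiv ℝ φ p v := fun v =>
      (hφ1.continuous_fderiv (by simp)).clm_apply continuous_const
    -- On the range of `u` the two entropy fluxes differ by a constant depending on `k` alone, zero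
    -- if `k` lies in `[-M, M]`. A constant flux contributes nothing against a compactly supported
    -- derivative.
    obtain ⟨d, hd'⟩ : ∃ d, ∀ r ∈ Icc (-M) M, kruzhkovFlux F r k = kruzhkovFlux f r k + d := by
      unfold kruzhkovFlux
      rcases lt_or_ge k (-M) with hk | hk
      · refine ⟨f k - F k, fun r hr => ?_⟩
        rw [max_eq_left (by linarith [hr.1]), min_eq_right (by linarith [hr.1]), hfF r hr]; ring
      · rcases lt_or_ge M k with hk' | hk'
        · refine ⟨F k - f k, fun r hr => ?_⟩
          rw [max_eq_right (by linarith [hr.2]), min_eq_left (by linarith [hr.2]), hfF r hr]; ring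
        · refine ⟨0, fun r hr => ?_⟩
          rw [hfF _ ⟨le_max_of_le_left hr.1, max_le hr.2 hk'⟩,
            hfF _ ⟨le_min hr.1 hk, min_le_of_left_le hr.2⟩, add_zero]
    have hent := hu.entropy_ineq k φ h1 h2 h3 h4
    simp_rw [sign_mul_eq_kruzhkovFlux] at hent
    have hi1 := integrable_comp_mul hu.aestronglyMeasurable hM (g := fun r => |r - k|)
      (by fun_prop) (hd (0, 1)) (h2.fderiv_apply ℝ _)
    have hi2 := integrable_comp_mul hu.aestronglyMeasurable hM (g := fun r => kruzhkovFlux f r k)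
      ((continuous_kruzhkovFlux hf).comp (continuous_id.prodMk continuous_const))
      (hd (1, 0)) (h2.fderiv_apply ℝ _)
    have hi3 : Integrable (fun p => d * fderiv ℝ φ p (1, 0)) (volume.restrict posTime) :=
      (((hd (1, 0)).integrable_of_hasCompactSupport (h2.fderiv_apply ℝ _)).const_mul d).restrict
    have e : ∫ p in posTime, (|u p.1 p.2 - k| * fderiv ℝ φ p (0, 1)
        + kruzhkovFlux F (u p.1 p.2) k * fderiv ℝ φ p (1, 0)) =
        (∫ p in posTime, (|u p.1 p.2 - k| * fderiv ℝ φ p (0, 1)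
        + kruzhkovFlux f (u p.1 p.2) k * fderiv ℝ φ p (1, 0)))
        + ∫ p in posTime, d * fderiv ℝ φ p (1, 0) := by
      have hadd := integral_add (hi1.add hi2) hi3
      simp only [Pi.add_apply] at hadd
      rw [← hadd]
      refine setIntegral_congr_fun measurableSet_posTime fun p hp => ?_
      rw [hd' _ (abs_le.1 (hM p.1 p.2 hp))]
      ring
    rw [e, integral_const_mul, setIntegral_posTime_fderiv_eq_zero hφ1 h2 h3, mul_zero, add_zero]
    exact hent

/-! ### Continuity in time and the conservation law integrated in space -/

theorem integral_posTime {h : ℝ × ℝ → ℝ} (hi : Integrable h (volume.restrict posTime)) :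
    ∫ p in posTime, h p = ∫ t in Ioi (0 : ℝ), ∫ x, h (x, t) := by
  have e : (volume.restrict posTime : Measure (ℝ × ℝ)) =
      (volume : Measure ℝ).prod (volume.restrict (Ioi (0 : ℝ))) := by
    have h1 : posTime = univ ×ˢ Ioi (0 : ℝ) := by ext p; simp [posTime]
    rw [h1, Measure.volume_eq_prod, ← Measure.prod_restrict, Measure.restrict_univ]
  rw [e] at hi ⊢
  exact integral_prod_symm _ hi

theorem continuous_of_hasCompactSupport_of_continuousOn {S : Set ℝ} (hS : IsOpen S) {g θ : ℝ → ℝ}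
    (hg : ContinuousOn g S) (hθ : Continuous θ) (ht : tsupport θ ⊆ S) :
    Continuous fun t => g t * θ t := by
  refine continuous_of_tsupport fun x hx => ?_
  have hx' : x ∈ S := ht (closure_mono (Function.support_mul_subset_right _ _) hx)
  exact (hg.continuousAt (hS.mem_nhds hx')).mul hθ.continuousAt

namespace IsKruzhkovSolution

variable {F : ℝ → ℝ} {u : ℝ → ℝ → ℝ} {M : ℝ}

theorem nonneg (hu : IsKruzhkovSolution F u M) : 0 ≤ M :=
  (abs_nonneg _).trans (hu.abs_apply_le 0 1 one_pos)

theorem exists_subseq_tendsto_ae (hu : IsKruzhkovSolution F u M) {s : ℕ → ℝ} {t R : ℝ}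
    (hs : ∀ n, 0 < s n) (ht : 0 < t) (hR : 0 < R) (hst : Tendsto s atTop (𝓝 t)) :
    ∃ ns : ℕ → ℕ, StrictMono ns ∧
      ∀ᵐ x ∂volume.restrict (Icc (-R) R), Tendsto (fun n => u x (s (ns n))) atTop (𝓝 (u x t)) := by
  refine TendstoInMeasure.exists_seq_tendsto_ae
    (tendstoInMeasure_of_tendsto_eLpNorm (f := fun n x => u x (s n)) one_ne_zero
      (fun n => (hu.measurable _ (hs n)).aestronglyMeasurable)
      (hu.measurable _ ht).aestronglyMeasurable ?_)
  have h1 := ((hu.continuous_L1loc t ht R hR).comp hst)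
  have h2 := (ENNReal.continuous_ofReal.tendsto 0).comp h1
  rw [ENNReal.ofReal_zero] at h2
  refine h2.congr fun n => ?_
  rw [eLpNorm_one_eq_lintegral_enorm]
  simp only [Function.comp]
  have hint : Integrable (fun x => u x (s n) - u x t) (volume.restrict (Icc (-R) R)) := by
    refine Measure.integrableOn_of_bounded (M := M + M) isCompact_Icc.measure_lt_top.ne
      ((hu.measurable _ (hs n)).sub (hu.measurable _ ht)).aestronglyMeasurable
      (ae_of_all _ fun x => ?_)
    exact (norm_sub_le _ _).trans (add_le_add (hu.abs_apply_le _ _ (hs n)) (hu.abs_apply_le _ _ ht))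
  exact ofReal_integral_norm_eq_lintegral_enorm hint

/-- Nonlinear functionals of the spatial profile depend continuously on time and parameters. -/
theorem continuousAt_integral_comp (hu : IsKruzhkovSolution F u M) {X : Type*} [TopologicalSpace X]
    [FirstCountableTopology X] {α₀ : X} {τ : X → ℝ} (hτ : ContinuousAt τ α₀) (hτ0 : 0 < τ α₀)
    {Ψ : X → ℝ → ℝ → ℝ} {B R : ℝ}
    (hc : ∀ y r, ContinuousAt (fun q : X × ℝ => Ψ q.1 y q.2) (α₀, r))
    (hB : ∀ᶠ α in 𝓝 α₀, ∀ y r, |r| ≤ M → |Ψ α y r| ≤ B)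
    (hR : ∀ᶠ α in 𝓝 α₀, ∀ y r, |r| ≤ M → R < |y| → Ψ α y r = 0)
    (hm : ∀ᶠ α in 𝓝 α₀, AEStronglyMeasurable (fun y => Ψ α y (u y (τ α))) volume) :
    ContinuousAt (fun α => ∫ y, Ψ α y (u y (τ α))) α₀ := by
  -- Continuity in `L¹_loc` gives almost everywhere convergence only along a further subsequence.
  -- That is enough for a limit, and dominated convergence then handles the nonlinear integrand.
  refine tendsto_of_subseq_tendsto fun ns hns => ?_
  have hall : ∀ᶠ n in atTop, (0 < τ (ns n)) ∧ (∀ y r, |r| ≤ M → |Ψ (ns n) y r| ≤ B) ∧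
      (∀ y r, |r| ≤ M → R < |y| → Ψ (ns n) y r = 0) ∧
      AEStronglyMeasurable (fun y => Ψ (ns n) y (u y (τ (ns n)))) volume :=
    hns.eventually ((hτ.eventually (lt_mem_nhds hτ0)).and (hB.and (hR.and hm)))
  obtain ⟨N, hN⟩ := eventually_atTop.1 hall
  have hns' : Tendsto (fun n => ns (n + N)) atTop (𝓝 α₀) := hns.comp (tendsto_add_atTop_nat N)
  set R' := max R 1
  obtain ⟨ms, hms, hae⟩ := hu.exists_subseq_tendsto_ae (s := fun n => τ (ns (n + N)))
    (fun n => (hN _ (by omega)).1) hτ0 (lt_of_lt_of_le one_pos (le_max_right R 1))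
    (hτ.tendsto.comp hns')
  refine ⟨fun n => ms n + N, ?_⟩
  rw [ae_restrict_iff' measurableSet_Icc] at hae
  refine tendsto_integral_of_dominated_convergence ((Icc (-R') R').indicator fun _ => B)
    (fun n => (hN (ms n + N) (by omega)).2.2.2) ?_ ?_ ?_
  · rw [integrable_indicator_iff measurableSet_Icc]
    exact integrableOn_const isCompact_Icc.measure_lt_top.ne
  · intro n
    refine ae_of_all _ fun y => ?_
    have hn := hN (ms n + N) (by omega)
    by_cases hy : y ∈ Icc (-R') R'
    · rw [indicator_of_mem hy]
      exact hn.2.1 _ _ (hu.abs_apply_le _ _ hn.1)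
    · rw [indicator_of_notMem hy, hn.2.2.1 _ _ (hu.abs_apply_le _ _ hn.1), norm_zero]
      by_contra hlt
      exact hy (abs_le.1 ((not_lt.1 hlt).trans (le_max_left _ _)))
  · filter_upwards [hae] with y hy
    by_cases hyR : y ∈ Icc (-R') R'
    · have h1 := hns'.comp hms.tendsto_atTop
      exact (hc y (u y (τ α₀))).tendsto.comp (h1.prodMk_nhds (hy hyR))
    · have hlt : R < |y| := by
        by_contra hlt
        exact hyR (abs_le.1 ((not_lt.1 hlt).trans (le_max_left _ _)))
      have h0 : ∀ n, Ψ (ns (ms n + N)) y (u y (τ (ns (ms n + N)))) = 0 := fun n =>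
        (hN (ms n + N) (by omega)).2.2.1 _ _ (hu.abs_apply_le _ _ (hN (ms n + N) (by omega)).1) hlt
      rw [hR.self_of_nhds _ _ (hu.abs_apply_le _ _ hτ0) hlt]
      simp_rw [h0]
      exact tendsto_const_nhds

/-- A version of `continuousAt_integral_comp` for products with a compactly supported kernel. -/
theorem continuousAt_integral_mul_comp (hu : IsKruzhkovSolution F u M) {g : ℝ → ℝ}
    (hg : Continuous g) {ψ : ℝ → ℝ} (hψ : Measurable ψ) {C R : ℝ} (hψC : ∀ x, |ψ x| ≤ C)
    (hψR : ∀ x, R < |x| → ψ x = 0) {t : ℝ} (ht : 0 < t) :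
    ContinuousAt (fun t => ∫ x, ψ x * g (u x t)) t := by
  obtain ⟨B, hB⟩ := exists_bound_of_continuous hg M
  refine hu.continuousAt_integral_comp (X := ℝ) (τ := id) (Ψ := fun _ y r => ψ y * g r)
    (B := C * B) (R := R) continuousAt_id ht (fun y r => by fun_prop)
    (Eventually.of_forall fun _ y r hr => ?_) (Eventually.of_forall fun _ y r _ hy => ?_) ?_
  · rw [abs_mul]
    exact mul_le_mul (hψC y) (hB r hr) (abs_nonneg _) ((abs_nonneg _).trans (hψC y))
  · rw [hψR y hy, zero_mul]
  · filter_upwards [lt_mem_nhds ht] with s hs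
    exact (hψ.mul (hg.measurable.comp (hu.measurable s hs))).aestronglyMeasurable

/-- A version of `continuousAt_integral_mul_comp` with translations. -/
theorem continuousAt_integral_mul_comp_add (hu : IsKruzhkovSolution F u M) {g : ℝ → ℝ}
    (hg : Continuous g) {ψ : ℝ → ℝ} (hψ : Continuous ψ) (hs : HasCompactSupport ψ) {p : ℝ × ℝ}
    (hp : p ∈ posTime) :
    ContinuousAt (fun p : ℝ × ℝ => ∫ z, ψ z * g (u (p.1 + z) p.2)) p := by
  obtain ⟨B, hB⟩ := exists_bound_of_continuous hg M
  obtain ⟨C, hC⟩ := hψ.bounded_above_of_compact_support hs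
  obtain ⟨R, hR⟩ := hs.isCompact.isBounded.subset_closedBall 0
  have hR' : ∀ x, ψ x ≠ 0 → |x| ≤ R := fun x hx => by simpa using hR (subset_tsupport _ hx)
  have e : ∀ p : ℝ × ℝ, ∫ z, ψ z * g (u (p.1 + z) p.2) = ∫ y, ψ (y - p.1) * g (u y p.2) :=
    fun p => by
      rw [← integral_add_left_eq_self (fun y => ψ (y - p.1) * g (u y p.2)) p.1]
      simp
  simp_rw [e]
  refine hu.continuousAt_integral_comp (X := ℝ × ℝ) (τ := Prod.snd)
    (Ψ := fun p y r => ψ (y - p.1) * g r) (B := C * B) (R := R + |p.1| + 1)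
    continuousAt_snd hp (fun y r => by fun_prop)
    (Eventually.of_forall fun _ y r hr => ?_) ?_ ?_
  · rw [abs_mul]
    exact mul_le_mul (hC _) (hB r hr) (abs_nonneg _) ((abs_nonneg _).trans (hC 0))
  · filter_upwards [(continuous_fst.tendsto p).eventually (Metric.ball_mem_nhds p.1 one_pos)]
      with q hq y r _ hy
    have : ψ (y - q.1) = 0 := by
      by_contra hne
      have h1 := hR' _ hne
      change dist q.1 p.1 < 1 at hq
      rw [Real.dist_eq] at hq
      have h2 : |y| ≤ |y - q.1| + |q.1 - p.1| + |p.1| := by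
        calc |y| = |(y - q.1) + (q.1 - p.1) + p.1| := by ring_nf
          _ ≤ _ := abs_add_three _ _ _
      linarith
    rw [this, zero_mul]
  · filter_upwards [isOpen_posTime.mem_nhds hp] with q hq
    exact ((hψ.measurable.comp (measurable_id.sub_const _)).mul
      (hg.measurable.comp (hu.measurable q.2 hq))).aestronglyMeasurable

theorem integrable_mul_comp (hu : IsKruzhkovSolution F u M) {g : ℝ → ℝ} (hg : Continuous g)
    {ψ : ℝ → ℝ} (hψ : Continuous ψ) (hs : HasCompactSupport ψ) {t : ℝ} (ht : 0 < t) :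
    Integrable (fun x => ψ x * g (u x t)) := by
  obtain ⟨B, hB⟩ := exists_bound_of_continuous hg M
  exact (hψ.integrable_of_hasCompactSupport hs).mul_bdd
    (hg.measurable.comp (hu.measurable t ht)).aestronglyMeasurable
    (ae_of_all _ fun x => hB _ (hu.abs_apply_le x t ht))

/-- The conservation law in the sense of distributions. -/
theorem integral_weak_eq_zero (hu : IsKruzhkovSolution F u M) (hF : Continuous F)
    {φ : ℝ × ℝ → ℝ} (hφ : ContDiff ℝ 1 φ) (hs : HasCompactSupport φ) (ht : tsupport φ ⊆ posTime)
    (h0 : ∀ p, 0 ≤ φ p) :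
    ∫ p in posTime, (u p.1 p.2 * fderiv ℝ φ p (0, 1) + F (u p.1 p.2) * fderiv ℝ φ p (1, 0)) = 0 := by
  have hM := hu.nonneg
  have hd : ∀ v, Continuous fun p => fderiv ℝ φ p v := fun v =>
    (hφ.continuous_fderiv (by simp)).clm_apply continuous_const
  have hz := setIntegral_posTime_fderiv_eq_zero hφ hs ht
  have hi1 := integrable_comp_mul hu.aestronglyMeasurable hu.abs_apply_le (g := id)
      continuous_id (hd (0, 1)) (hs.fderiv_apply ℝ _)
  have hi2 := integrable_comp_mul hu.aestronglyMeasurable hu.abs_apply_le hF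
      (hd (1, 0)) (hs.fderiv_apply ℝ _)
  have hi3 : ∀ v, Integrable (fun p => fderiv ℝ φ p v) (volume.restrict posTime) := fun v =>
    ((hd v).integrable_of_hasCompactSupport (hs.fderiv_apply ℝ _)).restrict
  have key : ∀ a k, (∀ r, |r| ≤ M → |r - k| = a * (r - k) ∧
      kruzhkovFlux F r k = a * (F r - F k)) →
      0 ≤ a * ∫ p in posTime,
        (u p.1 p.2 * fderiv ℝ φ p (0, 1) + F (u p.1 p.2) * fderiv ℝ φ p (1, 0)) := by
    intro a k hk
    have h1 := hu.entropy k φ hφ hs ht h0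
    have e : ∫ p in posTime, (|u p.1 p.2 - k| * fderiv ℝ φ p (0, 1)
      + kruzhkovFlux F (u p.1 p.2) k * fderiv ℝ φ p (1, 0)) =
      ∫ p in posTime, (a * (u p.1 p.2 * fderiv ℝ φ p (0, 1) + F (u p.1 p.2) * fderiv ℝ φ p (1, 0))
        - (a * k * fderiv ℝ φ p (0, 1) + a * F k * fderiv ℝ φ p (1, 0))) := by
      refine setIntegral_congr_fun measurableSet_posTime fun p hp => ?_
      rw [(hk _ (hu.abs_apply_le p.1 p.2 hp)).1, (hk _ (hu.abs_apply_le p.1 p.2 hp)).2]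
      ring
    have i1 : Integrable (fun p => a * (u p.1 p.2 * fderiv ℝ φ p (0, 1)
        + F (u p.1 p.2) * fderiv ℝ φ p (1, 0))) (volume.restrict posTime) :=
      (hi1.add hi2).const_mul a
    have i2 : Integrable (fun p => a * k * fderiv ℝ φ p (0, 1) + a * F k * fderiv ℝ φ p (1, 0))
        (volume.restrict posTime) := ((hi3 _).const_mul _).add ((hi3 _).const_mul _)
    rw [e, integral_sub i1 i2, integral_const_mul,
      integral_add ((hi3 _).const_mul _) ((hi3 _).const_mul _), integral_const_mul,
      integral_const_mul, hz, hz] at h1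
    simpa using h1
  -- For `k` above, respectively below, all values of `u`, the entropy is affine on the range, and
  -- the two inequalities have opposite signs.
  have h1 := key (-1) (M + 1) fun r hr => by
    rw [abs_le] at hr
    unfold kruzhkovFlux
    rw [max_eq_right (by linarith), min_eq_left (by linarith), abs_of_neg (by linarith)]
    constructor <;> ring
  have h2 := key 1 (-(M + 1)) fun r hr => by
    rw [abs_le] at hr
    unfold kruzhkovFlux
    rw [max_eq_left (by linarith), min_eq_right (by linarith), abs_of_pos (by linarith)]
    constructor <;> ring
  linarith

/-- Testing the weak equation with products `ψ(x) θ(t)` shows that `A - ∫ B` has zero distributional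
derivative in time. Being continuous it is constant, and the fundamental theorem of calculus gives a
classical derivative. -/
theorem hasDerivAt_integral_mul_of_nonneg (hu : IsKruzhkovSolution F u M) (hF : Continuous F)
    {ψ : ℝ → ℝ} (hψ : ContDiff ℝ 1 ψ) (hs : HasCompactSupport ψ) (h0 : ∀ x, 0 ≤ ψ x) {t : ℝ}
    (ht : 0 < t) :
    HasDerivAt (fun t => ∫ x, ψ x * u x t) (∫ x, deriv ψ x * F (u x t)) t := by
  have hψ' : Continuous (deriv ψ) := hψ.continuous_deriv (by simp)
  set A : ℝ → ℝ := fun t => ∫ x, ψ x * u x t with hA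
  set B : ℝ → ℝ := fun t => ∫ x, deriv ψ x * F (u x t) with hB
  have aux : ∀ {ψ : ℝ → ℝ} {g : ℝ → ℝ}, Continuous ψ → HasCompactSupport ψ → Continuous g →
      ContinuousOn (fun t => ∫ x, ψ x * g (u x t)) (Ioi 0) := fun {ψ g} hψ hs hg s hs0 => by
    have := hu.continuousAt_integral_mul_comp_add hg hψ hs (p := (0, s)) hs0
    have h2 : ContinuousAt (fun s : ℝ => ((0 : ℝ), s)) s := by fun_prop
    have h3 := ContinuousAt.comp (f := fun s : ℝ => ((0 : ℝ), s)) this h2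
    simpa [Function.comp_def] using h3.continuousWithinAt
  have hAc : ContinuousOn A (Ioi 0) := aux hψ.continuous hs continuous_id
  have hBc : ContinuousOn B (Ioi 0) := aux hψ' hs.deriv hF
  have hBi : ∀ t, 0 < t → HasDerivAt (fun t => ∫ s in (1 : ℝ)..t, B s) (B t) t := fun t ht => by
    have hsub : uIcc 1 t ⊆ Ioi 0 := fun s hs => lt_of_lt_of_le (lt_min one_pos ht) hs.1
    exact intervalIntegral.integral_hasDerivAt_right (hBc.mono hsub).intervalIntegrable
      (hBc.stronglyMeasurableAtFilter isOpen_Ioi _ ht) (hBc.continuousAt (Ioi_mem_nhds ht))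
  set Z : ℝ → ℝ := fun t => A t - ∫ s in (1 : ℝ)..t, B s with hZ
  have hIc : ContinuousOn (fun t => ∫ s in (1 : ℝ)..t, B s) (Ioi 0) := fun t ht =>
    (hBi t ht).continuousAt.continuousWithinAt
  have hZc : ContinuousOn Z (Ioi 0) := hAc.sub hIc
  have hZ0 : ∀ θ : ℝ → ℝ, ContDiff ℝ ∞ θ → HasCompactSupport θ → tsupport θ ⊆ Ioi 0 →
      (∀ x, 0 ≤ θ x) → ∫ x, Z x * deriv θ x = 0 := by
    intro θ hθ hθs hθt hθ0
    have hθ' : Continuous (deriv θ) := hθ.continuous_deriv (by simp)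
    have hθt' : tsupport (deriv θ) ⊆ Ioi 0 := (tsupport_deriv_subset (𝕜 := ℝ)).trans hθt
    have hint : ∀ {g η : ℝ → ℝ}, ContinuousOn g (Ioi 0) → Continuous η → HasCompactSupport η →
        tsupport η ⊆ Ioi 0 → Integrable (fun t => g t * η t) := fun hg hη hηs hηt =>
      (continuous_of_hasCompactSupport_of_continuousOn isOpen_Ioi hg hη hηt).integrable_of_hasCompactSupport
        hηs.mul_left
    have i1 := hint hAc hθ' hθs.deriv hθt'
    have i2 := hint hIc hθ' hθs.deriv hθt'
    have i3 := hint hBc hθ.continuous hθs hθt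
    have i4 := hint hIc hθ.continuous hθs hθt
    have ibp := integral_mul_deriv_eq_deriv_mul_of_integrable
      (u := fun t => ∫ s in (1 : ℝ)..t, B s) (u' := B) (v := θ) (v' := deriv θ)
      (fun x hx => hBi x (hθt hx)) (fun x _ => (hθ.differentiable (by simp) x).hasDerivAt) i2 i3 i4
    set φ : ℝ × ℝ → ℝ := fun p => ψ p.1 * θ p.2 with hφ
    have hφd : ContDiff ℝ 1 φ := (hψ.comp contDiff_fst).mul
      ((hθ.of_le (by simp)).comp contDiff_snd)
    have hφsub : tsupport φ ⊆ tsupport ψ ×ˢ tsupport θ := by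
      refine closure_minimal (fun p hp => ?_) ((isClosed_tsupport _).prod (isClosed_tsupport _))
      exact ⟨subset_tsupport _ (left_ne_zero_of_mul hp), subset_tsupport _ (right_ne_zero_of_mul hp)⟩
    have hφs : HasCompactSupport φ :=
      (hs.isCompact.prod hθs.isCompact).of_isClosed_subset (isClosed_tsupport _) hφsub
    have hφt : tsupport φ ⊆ posTime := hφsub.trans fun p hp => hθt hp.2
    have hfd : ∀ p : ℝ × ℝ, HasFDerivAt φ
        (ψ p.1 • (deriv θ p.2 • ContinuousLinearMap.snd ℝ ℝ ℝ) +
          θ p.2 • (deriv ψ p.1 • ContinuousLinearMap.fst ℝ ℝ ℝ)) p := fun p => by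
      have h1 : HasFDerivAt (fun p : ℝ × ℝ => ψ p.1) (deriv ψ p.1 • ContinuousLinearMap.fst ℝ ℝ ℝ) p :=
        ((hψ.differentiable (by simp) p.1).hasDerivAt).comp_hasFDerivAt p hasFDerivAt_fst
      have h2 : HasFDerivAt (fun p : ℝ × ℝ => θ p.2) (deriv θ p.2 • ContinuousLinearMap.snd ℝ ℝ ℝ) p :=
        ((hθ.differentiable (by simp) p.2).hasDerivAt).comp_hasFDerivAt p hasFDerivAt_snd
      exact h1.mul h2
    have w := hu.integral_weak_eq_zero hF hφd hφs hφt fun p => mul_nonneg (h0 _) (hθ0 _)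
    have hd : ∀ v, Continuous fun p => fderiv ℝ φ p v := fun v =>
      (hφd.continuous_fderiv (by simp)).clm_apply continuous_const
    have j1 := integrable_comp_mul hu.aestronglyMeasurable hu.abs_apply_le (g := id)
      continuous_id (hd (0, 1)) (hφs.fderiv_apply ℝ _)
    have j2 := integrable_comp_mul hu.aestronglyMeasurable hu.abs_apply_le hF
      (hd (1, 0)) (hφs.fderiv_apply ℝ _)
    have j3 : Integrable (fun p => u p.1 p.2 * fderiv ℝ φ p (0, 1)
        + F (u p.1 p.2) * fderiv ℝ φ p (1, 0)) (volume.restrict posTime) := j1.add j2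
    have w' := w
    rw [integral_posTime j3] at w'
    have e : ∀ t ∈ Ioi (0 : ℝ), ∫ x, (u x t * fderiv ℝ φ (x, t) (0, 1)
        + F (u x t) * fderiv ℝ φ (x, t) (1, 0)) = A t * deriv θ t + B t * θ t := fun t ht => by
      have l1 := (hu.integrable_mul_comp continuous_id hψ.continuous hs ht).mul_const (deriv θ t)
      have l2 := (hu.integrable_mul_comp hF hψ' hs.deriv ht).mul_const (θ t)
      simp only [id] at l1
      simp only [hA, hB]
      rw [← integral_mul_const, ← integral_mul_const, ← integral_add l1 l2]
      refine integral_congr_ae (ae_of_all _ fun x => ?_)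
      simp only [(hfd (x, t)).fderiv]
      simp
      ring
    rw [setIntegral_congr_fun measurableSet_Ioi e,
      setIntegral_eq_integral_of_forall_compl_eq_zero, integral_add i1 i3] at w'
    · simp only [hZ, sub_mul]
      rw [integral_sub i1 i2, ibp]
      linarith
    · intro x hx
      rw [image_eq_zero_of_notMem_tsupport fun h => hx (hθt h),
        image_eq_zero_of_notMem_tsupport fun h => hx (hθt' h)]
      ring
  -- Used with `a = 1` and `a = -1`: both `Z` and `-Z` are nonincreasing.
  have hZmono : ∀ a : ℝ, ∀ x ∈ Ioi (0 : ℝ), ∀ y, x ≤ y → a * Z y ≤ a * Z x := fun a x hx y hxy => by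
    have hc : ContinuousOn (fun t => a * Z t) (Ioi 0) := continuousOn_const.mul hZc
    have hsub : ∀ b, Icc x b ⊆ Ioi 0 := fun b z hz => lt_of_lt_of_le hx hz.1
    refine le_of_integral_mul_deriv_nonneg (g := fun t => a * Z t) hxy (lt_add_one y)
      (hc.mono (hsub _)).integrableOn_Icc ((hc.continuousAt (Ioi_mem_nhds hx)).continuousWithinAt)
      ((hc.continuousAt (Ioi_mem_nhds (lt_of_lt_of_le hx hxy))).continuousWithinAt)
      (fun θ h1 h2 h3 h4 => ?_)
    · simp_rw [mul_assoc]
      rw [integral_const_mul, hZ0 θ h1 h2 (h3.trans (hsub _)) h4, mul_zero]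
  have hconst : ∀ s ∈ Ioi (0 : ℝ), Z s = Z t := fun s hs => by
    rcases le_total s t with h | h
    · have h1 := hZmono 1 s hs t h
      have h2 := hZmono (-1) s hs t h
      linarith
    · have h1 := hZmono 1 t ht s h
      have h2 := hZmono (-1) t ht s h
      linarith
  have hfin : A =ᶠ[𝓝 t] fun s => (∫ r in (1 : ℝ)..s, B r) + Z t := by
    filter_upwards [Ioi_mem_nhds ht] with s hs
    rw [← hconst s hs]
    simp only [hZ]; ring
  exact ((hBi t ht).add_const _).congr_of_eventuallyEq hfin

/-- The conservation law, integrated against a test function of space. -/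
theorem hasDerivAt_integral_mul (hu : IsKruzhkovSolution F u M) (hF : Continuous F)
    {ψ : ℝ → ℝ} (hψ : ContDiff ℝ 1 ψ) (hs : HasCompactSupport ψ) {t : ℝ} (ht : 0 < t) :
    HasDerivAt (fun t => ∫ x, ψ x * u x t) (∫ x, deriv ψ x * F (u x t)) t := by
  obtain ⟨C, hC⟩ := hψ.continuous.bounded_above_of_compact_support hs
  have hC0 : 0 ≤ C := (norm_nonneg _).trans (hC 0)
  obtain ⟨R, hR⟩ := hs.isCompact.isBounded.subset_closedBall 0
  -- The bump equals `1` on the support of `ψ`, so `ψ + C * b` and `C * b` are both nonnegative. The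
  -- result for `ψ` is their difference.
  let b : ContDiffBump (0 : ℝ) := ⟨max R 1, max R 1 + 1, by positivity, by linarith⟩
  have hb : ContDiff ℝ 1 (fun x => C * b x) := contDiff_const.mul b.contDiff
  have hbs : HasCompactSupport (fun x => C * b x) := b.hasCompactSupport.mul_left
  have h1 := hu.hasDerivAt_integral_mul_of_nonneg hF hb hbs (fun x => mul_nonneg hC0 b.nonneg) ht
  have h2 := hu.hasDerivAt_integral_mul_of_nonneg hF (hψ.add hb) (hs.add hbs) (fun x => by
    by_cases hx : ψ x = 0
    · simp only [hx, zero_add]; exact mul_nonneg hC0 b.nonneg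
    · have hx' : x ∈ Metric.closedBall (0 : ℝ) (max R 1) :=
        Metric.closedBall_subset_closedBall (le_max_left _ _) (hR (subset_tsupport _ hx))
      rw [b.one_of_mem_closedBall hx']
      have := (abs_le.1 (hC x)).1
      linarith) ht
  have hF' := hu.integrable_mul_comp hF (hψ.continuous_deriv (by simp)) hs.deriv ht
  have hFb := hu.integrable_mul_comp hF (hb.continuous_deriv (by simp)) hbs.deriv ht
  have h3 := h2.sub h1
  refine (h3.congr_of_eventuallyEq ?_).congr_deriv ?_
  · filter_upwards [Ioi_mem_nhds ht] with s hs0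
    have j1 := hu.integrable_mul_comp continuous_id hψ.continuous hs hs0
    have j2 := hu.integrable_mul_comp continuous_id hb.continuous hbs hs0
    simp only [id] at j1 j2
    simp only [Pi.sub_apply, add_mul]
    rw [integral_add j1 j2]
    ring
  · have : ∀ x, deriv (fun x => ψ x + C * b x) x = deriv ψ x + deriv (fun x => C * b x) x := fun x =>
      deriv_add (hψ.differentiable (by simp) x) (hb.differentiable (by simp) x)
    simp only [this, add_mul]
    rw [integral_add hF' hFb]
    ring

end IsKruzhkovSolution

/-! ### Calculus tools: partial derivatives, right derivatives, primitives -/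

theorem hasFDerivAt_of_partials {f a b : ℝ → ℝ → ℝ} {S : Set (ℝ × ℝ)} (hS : IsOpen S)
    (ha : ∀ q ∈ S, HasDerivAt (fun x => f x q.2) (a q.1 q.2) q.1)
    (hb : ∀ q ∈ S, HasDerivAt (fun t => f q.1 t) (b q.1 q.2) q.2)
    (ca : ∀ q ∈ S, ContinuousAt (fun q : ℝ × ℝ => a q.1 q.2) q)
    (cb : ∀ q ∈ S, ContinuousAt (fun q : ℝ × ℝ => b q.1 q.2) q) {p : ℝ × ℝ} (hp : p ∈ S) :
    HasFDerivAt (fun q : ℝ × ℝ => f q.1 q.2)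
      (a p.1 p.2 • ContinuousLinearMap.fst ℝ ℝ ℝ + b p.1 p.2 • ContinuousLinearMap.snd ℝ ℝ ℝ) p := by
  have hT : ∀ g : ℝ → ℝ → ℝ, ContinuousAt (fun q : ℝ × ℝ => g q.1 q.2) p →
      ContinuousAt (↿fun x t => ContinuousLinearMap.toSpanSingleton ℝ (g x t)) p := fun g hg =>
    (ContinuousLinearMap.toSpanSingletonCLE (𝕜 := ℝ) (E := ℝ)).continuous.continuousAt.comp hg
  have := hasStrictFDerivAt_uncurry_coprod (𝕜 := ℝ) (u := p) (f := f)
    (f₁ := fun x t => ContinuousLinearMap.toSpanSingleton ℝ (a x t))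
    (f₂ := fun x t => ContinuousLinearMap.toSpanSingleton ℝ (b x t))
    (by filter_upwards [hS.mem_nhds hp] with q hq using (ha q hq).hasFDerivAt)
    (by filter_upwards [hS.mem_nhds hp] with q hq using (hb q hq).hasFDerivAt)
    (hT a (ca p hp)) (hT b (cb p hp))
  refine this.hasFDerivAt.congr_fderiv ?_
  ext <;> simp [Function.HasUncurry.uncurry]

theorem contDiffAt_of_partials {f a b : ℝ → ℝ → ℝ} {S : Set (ℝ × ℝ)} (hS : IsOpen S)
    (ha : ∀ q ∈ S, HasDerivAt (fun x => f x q.2) (a q.1 q.2) q.1)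
    (hb : ∀ q ∈ S, HasDerivAt (fun t => f q.1 t) (b q.1 q.2) q.2)
    (ca : ∀ q ∈ S, ContinuousAt (fun q : ℝ × ℝ => a q.1 q.2) q)
    (cb : ∀ q ∈ S, ContinuousAt (fun q : ℝ × ℝ => b q.1 q.2) q) {p : ℝ × ℝ} (hp : p ∈ S) :
    ContDiffAt ℝ 1 (fun q : ℝ × ℝ => f q.1 q.2) p := by
  rw [contDiffAt_one_iff]
  refine ⟨fun p => a p.1 p.2 • ContinuousLinearMap.fst ℝ ℝ ℝ
    + b p.1 p.2 • ContinuousLinearMap.snd ℝ ℝ ℝ, S, hS.mem_nhds hp, fun q hq => ?_,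
    fun q hq => hasFDerivAt_of_partials hS ha hb ca cb hq⟩
  exact (((ca q hq).smul continuousAt_const).add
    ((cb q hq).smul continuousAt_const)).continuousWithinAt

/-- Integration by parts against a function which only has right derivatives. -/
theorem integral_deriv_mul_eq_neg {ψ V v : ℝ → ℝ} {C : ℝ} (hψ : ContDiff ℝ 1 ψ)
    (hs : HasCompactSupport ψ) (hV : Continuous V)
    (hd : ∀ x, HasDerivWithinAt V (v x) (Ioi x) x) (hv : Measurable v) (hC : ∀ x, |v x| ≤ C) :
    ∫ x, deriv ψ x * V x = -∫ x, ψ x * v x := by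
  have hψ' : Continuous (deriv ψ) := hψ.continuous_deriv (by simp)
  obtain ⟨R, hR⟩ := hs.isCompact.isBounded.subset_closedBall 0
  have h0 : ∀ x, R < |x| → x ∉ tsupport ψ := fun x hx hmem => by
    have := hR hmem
    rw [mem_closedBall_zero_iff, Real.norm_eq_abs] at this
    linarith
  set a := max R 0 + 1
  have ha : 0 < a := by positivity
  have haR : R < a := by linarith [le_max_left R 0]
  have i1 : Integrable (fun x => deriv ψ x * V x) :=
    (hψ'.mul hV).integrable_of_hasCompactSupport hs.deriv.mul_right
  have i2 : Integrable (fun x => ψ x * v x) :=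
    (hψ.continuous.integrable_of_hasCompactSupport hs).mul_bdd hv.aestronglyMeasurable
      (ae_of_all _ hC)
  have key := intervalIntegral.integral_eq_sub_of_hasDeriv_right_of_le (a := -a) (b := a)
    (f := fun x => ψ x * V x) (f' := fun x => deriv ψ x * V x + ψ x * v x) (by linarith)
    (hψ.continuous.mul hV).continuousOn
    (fun x _ => ((hψ.differentiable (by simp) x).hasDerivAt.hasDerivWithinAt).mul (hd x))
    ((i1.add i2).intervalIntegrable)
  have e1 : ψ a = 0 := image_eq_zero_of_notMem_tsupport (h0 _ (by rwa [abs_of_pos ha]))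
  have e2 : ψ (-a) = 0 := image_eq_zero_of_notMem_tsupport (h0 _ (by rwa [abs_neg, abs_of_pos ha]))
  simp only [e1, e2, zero_mul, sub_zero] at key
  rw [intervalIntegral.integral_of_le (by linarith),
    setIntegral_eq_integral_of_forall_compl_eq_zero, integral_add i1 i2] at key
  · linarith
  · intro x hx
    have hx' : R < |x| := by
      by_contra hlt
      have := abs_le.1 (not_lt.1 hlt)
      exact hx ⟨by linarith, by linarith⟩
    rw [image_eq_zero_of_notMem_tsupport (h0 x hx'), image_eq_zero_of_notMem_tsupport
      fun h => h0 x hx' (tsupport_deriv_subset (𝕜 := ℝ) h)]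
    ring

/-- A smooth compactly supported function of zero mean has a primitive of the same kind. -/
theorem exists_primitive {κ : ℝ → ℝ} (hκ : ContDiff ℝ ∞ κ) (hs : HasCompactSupport κ)
    (h0 : ∫ x, κ x = 0) :
    ∃ ψ : ℝ → ℝ, ContDiff ℝ ∞ ψ ∧ HasCompactSupport ψ ∧ deriv ψ = κ := by
  obtain ⟨R, hR⟩ := hs.isCompact.isBounded.subset_closedBall 0
  have hR' : ∀ x, R < |x| → κ x = 0 := fun x hx => by
    by_contra hne
    have := hR (subset_tsupport _ hne)
    rw [mem_closedBall_zero_iff, Real.norm_eq_abs] at this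
    linarith
  set a := max R 0 + 1
  have ha : 0 < a := by positivity
  have haR : R < a := by linarith [le_max_left R 0]
  let ψ : ℝ → ℝ := fun x => ∫ z in (-a)..x, κ z
  have hd : ∀ x, HasDerivAt ψ (κ x) x := fun x =>
    intervalIntegral.integral_hasDerivAt_right (hκ.continuous.intervalIntegrable _ _)
      (hκ.continuous.stronglyMeasurableAtFilter _ _) hκ.continuous.continuousAt
  have hψ' : deriv ψ = κ := funext fun x => (hd x).deriv
  refine ⟨ψ, ?_, ?_, hψ'⟩
  · rw [contDiff_infty_iff_deriv, hψ']
    exact ⟨fun x => (hd x).differentiableAt, hκ⟩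
  · refine HasCompactSupport.intro (isCompact_Icc (a := -a) (b := a)) fun x hx => ?_
    rw [mem_Icc, not_and_or, not_le, not_le] at hx
    rcases hx with hx | hx
    · refine intervalIntegral.integral_zero_ae (ae_of_all _ fun z hz => hR' z ?_)
      rw [uIoc_of_ge hx.le] at hz
      rw [abs_of_neg (by linarith [hz.2])]
      linarith [hz.2]
    · simp only [ψ]
      rw [intervalIntegral.integral_of_le (by linarith), ← h0]
      refine setIntegral_eq_integral_of_forall_compl_eq_zero fun z hz => hR' z ?_
      by_contra hlt
      have := abs_le.1 (not_lt.1 hlt)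
      exact hz ⟨by linarith, by linarith⟩

/-! ### The potential and its mollification -/

/-- The spatial primitive of `u` vanishing at the origin. -/
noncomputable def primitive (u : ℝ → ℝ → ℝ) (x t : ℝ) : ℝ := ∫ y in (0 : ℝ)..x, u y t

/-- A potential `U` with `∂ₓ U = u` and `∂ₜ U = -F(u)`. -/
noncomputable def potential (F : ℝ → ℝ) (u : ℝ → ℝ → ℝ) (x t : ℝ) : ℝ :=
  primitive u x t - (∫ z, rightKernel 0 z * primitive u z t)
    - ∫ s in (1 : ℝ)..t, ∫ z, rightKernel 0 z * F (u z s)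

/-- One-sided spatial mollification of the potential. -/
noncomputable def smoothPotential (F : ℝ → ℝ) (u : ℝ → ℝ → ℝ) (n : ℕ) (x t : ℝ) : ℝ :=
  ∫ z, rightKernel n z * potential F u (x + z) t

namespace IsKruzhkovSolution

variable {F : ℝ → ℝ} {u : ℝ → ℝ → ℝ} {M : ℝ}

theorem intervalIntegrable (hu : IsKruzhkovSolution F u M) {t : ℝ} (ht : 0 < t) (a b : ℝ) :
    IntervalIntegrable (fun y => u y t) volume a b := by
  rw [intervalIntegrable_iff]
  exact Measure.integrableOn_of_bounded (M := M) (by simp [uIoc])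
    (hu.measurable t ht).aestronglyMeasurable (ae_of_all _ fun x => hu.abs_apply_le x t ht)

theorem abs_integral_le (hu : IsKruzhkovSolution F u M) {t : ℝ} (ht : 0 < t) (a b : ℝ) :
    |∫ y in a..b, u y t| ≤ M * |b - a| := by
  rw [← Real.norm_eq_abs]
  exact intervalIntegral.norm_integral_le_of_norm_le_const fun x _ => hu.abs_apply_le x t ht

theorem primitive_sub (hu : IsKruzhkovSolution F u M) {t : ℝ} (ht : 0 < t) (a b : ℝ) :
    primitive u b t - primitive u a t = ∫ y in a..b, u y t :=
  intervalIntegral.integral_interval_sub_left (hu.intervalIntegrable ht _ _)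
    (hu.intervalIntegrable ht _ _)

theorem potential_sub (hu : IsKruzhkovSolution F u M) {t : ℝ} (ht : 0 < t) (a b : ℝ) :
    potential F u b t - potential F u a t = ∫ y in a..b, u y t := by
  rw [← hu.primitive_sub ht]
  unfold potential
  ring

theorem abs_potential_sub_le (hu : IsKruzhkovSolution F u M) {t : ℝ} (ht : 0 < t) (a b : ℝ) :
    |potential F u b t - potential F u a t| ≤ M * |b - a| := by
  rw [hu.potential_sub ht]
  exact hu.abs_integral_le ht a b

theorem abs_primitive_sub_le (hu : IsKruzhkovSolution F u M) {t : ℝ} (ht : 0 < t) (a b : ℝ) :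
    |primitive u b t - primitive u a t| ≤ M * |b - a| := by
  rw [hu.primitive_sub ht]
  exact hu.abs_integral_le ht a b

theorem continuous_of_abs_sub_le {V : ℝ → ℝ} {M : ℝ} (hM : 0 ≤ M)
    (h : ∀ a b, |V b - V a| ≤ M * |b - a|) : Continuous V :=
  (LipschitzWith.of_dist_le_mul (K := ⟨M, hM⟩) fun x y => by
    rw [Real.dist_eq, Real.dist_eq]; exact h y x).continuous

theorem continuous_potential_left (hu : IsKruzhkovSolution F u M) {t : ℝ} (ht : 0 < t) :
    Continuous fun x => potential F u x t :=
  continuous_of_abs_sub_le hu.nonneg (hu.abs_potential_sub_le ht)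

theorem continuous_primitive_left (hu : IsKruzhkovSolution F u M) {t : ℝ} (ht : 0 < t) :
    Continuous fun x => primitive u x t :=
  continuous_of_abs_sub_le hu.nonneg (hu.abs_primitive_sub_le ht)

theorem hasDerivWithinAt_primitive (hu : IsKruzhkovSolution F u M) {t : ℝ} (ht : 0 < t) (x : ℝ) :
    HasDerivWithinAt (fun x => primitive u x t) (u x t) (Ioi x) x :=
  (intervalIntegral.integral_hasDerivWithinAt_right (s := Ici x) (t := Ioi x)
    (hu.intervalIntegrable ht _ _)
    ((hu.measurable t ht).stronglyMeasurable.stronglyMeasurableAtFilter)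
    ((hu.rightContinuous t ht x).mono Ioi_subset_Ici_self)).mono Ioi_subset_Ici_self

theorem hasDerivWithinAt_potential (hu : IsKruzhkovSolution F u M) {t : ℝ} (ht : 0 < t) (x : ℝ) :
    HasDerivWithinAt (fun x => potential F u x t) (u x t) (Ioi x) x :=
  ((hu.hasDerivWithinAt_primitive ht x).sub_const _).sub_const _

theorem continuousAt_primitive_right (hu : IsKruzhkovSolution F u M) {t : ℝ} (ht : 0 < t) (x : ℝ) :
    ContinuousAt (fun t => primitive u x t) t := by
  have h1 := hu.continuousAt_integral_mul_comp (g := id) continuous_id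
    (ψ := (uIoc 0 x).indicator fun _ => (1 : ℝ)) (C := 1) (R := |x|)
    (measurable_const.indicator measurableSet_uIoc)
    (fun y => by by_cases hy : y ∈ uIoc 0 x <;> simp [hy])
    (fun y hy => indicator_of_notMem (fun hmem => by
      have := abs_sub_left_of_mem_uIcc (uIoc_subset_uIcc hmem)
      simp only [sub_zero] at this
      linarith) _) ht
  -- The sign accounts for the orientation of the interval integral from `0` to `x`.
  have h2 := h1.const_mul (if (0 : ℝ) ≤ x then (1 : ℝ) else -1)
  convert h2 using 2 with s
  unfold primitive
  rw [intervalIntegral.intervalIntegral_eq_integral_uIoc, smul_eq_mul,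
    ← integral_indicator measurableSet_uIoc]
  congr 2
  ext y
  by_cases hy : y ∈ uIoc 0 x <;> simp [hy]

theorem abs_primitive_le (hu : IsKruzhkovSolution F u M) {t : ℝ} (ht : 0 < t) (x : ℝ) :
    |primitive u x t| ≤ M * |x| := by
  have := hu.abs_integral_le ht 0 x
  rwa [sub_zero] at this

theorem continuousAt_integral_mul_primitive (hu : IsKruzhkovSolution F u M) {ρ : ℝ → ℝ}
    (hρ : Continuous ρ) (hs : HasCompactSupport ρ) {t : ℝ} (ht : 0 < t) :
    ContinuousAt (fun t => ∫ z, ρ z * primitive u z t) t := by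
  refine continuousAt_of_dominated (bound := fun z => |ρ z| * (M * |z|)) ?_ ?_ ?_ ?_
  · filter_upwards [Ioi_mem_nhds ht] with s hs
    exact (hρ.mul (hu.continuous_primitive_left hs)).aestronglyMeasurable
  · filter_upwards [Ioi_mem_nhds ht] with s hs
    refine ae_of_all _ fun z => ?_
    rw [norm_mul]
    exact mul_le_mul_of_nonneg_left (hu.abs_primitive_le hs z) (norm_nonneg _)
  · exact (by fun_prop : Continuous fun z => |ρ z| * (M * |z|)).integrable_of_hasCompactSupport
      (hs.norm.mul_right)
  · exact ae_of_all _ fun z => (hu.continuousAt_primitive_right ht z).const_mul _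

theorem continuousOn_integral_mul_flux (hu : IsKruzhkovSolution F u M) (hF : Continuous F)
    {ρ : ℝ → ℝ} (hρ : Continuous ρ) (hs : HasCompactSupport ρ) :
    ContinuousOn (fun t => ∫ z, ρ z * F (u z t)) (Ioi 0) := fun t ht => by
  have h1 := hu.continuousAt_integral_mul_comp_add hF hρ hs (p := (0, t)) ht
  have h2 : ContinuousAt (fun s : ℝ => ((0 : ℝ), s)) t := by fun_prop
  have h3 := ContinuousAt.comp (f := fun s : ℝ => ((0 : ℝ), s)) h1 h2
  simpa [Function.comp_def] using h3.continuousWithinAt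

theorem hasDerivAt_integral_integral_mul_flux (hu : IsKruzhkovSolution F u M) (hF : Continuous F)
    {ρ : ℝ → ℝ} (hρ : Continuous ρ) (hs : HasCompactSupport ρ) {t : ℝ} (ht : 0 < t) :
    HasDerivAt (fun t => ∫ s in (1 : ℝ)..t, ∫ z, ρ z * F (u z s)) (∫ z, ρ z * F (u z t)) t := by
  have hc := hu.continuousOn_integral_mul_flux hF hρ hs
  have hsub : uIcc 1 t ⊆ Ioi 0 := fun s hs => lt_of_lt_of_le (lt_min one_pos ht) hs.1
  exact intervalIntegral.integral_hasDerivAt_right (hc.mono hsub).intervalIntegrable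
    (hc.stronglyMeasurableAtFilter isOpen_Ioi _ ht) (hc.continuousAt (Ioi_mem_nhds ht))

theorem continuousAt_potential_right (hu : IsKruzhkovSolution F u M) (hF : Continuous F) {t : ℝ}
    (ht : 0 < t) (x : ℝ) : ContinuousAt (fun t => potential F u x t) t :=
  ((hu.continuousAt_primitive_right ht x).sub (hu.continuousAt_integral_mul_primitive
    (continuous_rightKernel 0) (hasCompactSupport_rightKernel 0) ht)).sub
    (hu.hasDerivAt_integral_integral_mul_flux hF (continuous_rightKernel 0)
      (hasCompactSupport_rightKernel 0) ht).continuousAt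

/-- Continuity in time at a fixed point combines with the Lipschitz bound in space, whose constant
`M` is the same at all times. -/
theorem continuousAt_potential (hu : IsKruzhkovSolution F u M) (hF : Continuous F) {p : ℝ × ℝ}
    (hp : p ∈ posTime) : ContinuousAt (fun p : ℝ × ℝ => potential F u p.1 p.2) p := by
  have h1 : Tendsto (fun q : ℝ × ℝ => potential F u p.1 q.2) (𝓝 p) (𝓝 (potential F u p.1 p.2)) :=
    (hu.continuousAt_potential_right hF hp p.1).tendsto.comp (continuous_snd.tendsto p)
  have h2 : Tendsto (fun q : ℝ × ℝ => potential F u q.1 q.2 - potential F u p.1 q.2) (𝓝 p) (𝓝 0) := by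
    refine squeeze_zero_norm' (a := fun q : ℝ × ℝ => M * |q.1 - p.1|) ?_ ?_
    · filter_upwards [isOpen_posTime.mem_nhds hp] with q hq
      exact hu.abs_potential_sub_le hq _ _
    · have : Continuous fun q : ℝ × ℝ => M * |q.1 - p.1| := by fun_prop
      simpa using this.tendsto p
  have h3 := h1.add h2
  rw [add_zero] at h3
  refine h3.congr fun q => ?_
  ring

/-- This is `∂ₜU = -F(u)` in weak form. With `m = ∫ ρ` and `χ` the normalizing kernel, `ρ - m χ` has
mean zero and is the derivative of some compactly supported `ψ`, to which the conservation law
applies. The remaining mass `m χ` is governed by the normalization in `potential`, which prescribes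
`∫ χ U = -∫∫ χ F(u)`. -/
theorem hasDerivAt_integral_mul_potential (hu : IsKruzhkovSolution F u M) (hF : Continuous F)
    {ρ : ℝ → ℝ} (hρ : ContDiff ℝ ∞ ρ) (hs : HasCompactSupport ρ) {t : ℝ} (ht : 0 < t) :
    HasDerivAt (fun t => ∫ z, ρ z * potential F u z t) (-∫ z, ρ z * F (u z t)) t := by
  set m := ∫ z, ρ z with hm
  set χ := rightKernel 0
  have hχc : Continuous χ := continuous_rightKernel 0
  have hχs : HasCompactSupport χ := hasCompactSupport_rightKernel 0
  have hρi : Integrable ρ := hρ.continuous.integrable_of_hasCompactSupport hs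
  obtain ⟨ψ, hψ, hψs, hψ'⟩ := exists_primitive (κ := fun z => ρ z - m * χ z)
    (hρ.sub (contDiff_const.mul (contDiff_rightKernel 0))) (hs.sub hχs.mul_left) (by
      rw [integral_sub hρi ((integrable_rightKernel 0).const_mul m), integral_const_mul,
        integral_rightKernel, ← hm]
      ring)
  have hψ1 : ContDiff ℝ 1 ψ := hψ.of_le (by simp)
  have iρ : ∀ {s}, 0 < s → Integrable (fun z => ρ z * primitive u z s) := fun hs0 =>
    (hρ.continuous.mul (hu.continuous_primitive_left hs0)).integrable_of_hasCompactSupport hs.mul_right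
  have iχ : ∀ {s}, 0 < s → Integrable (fun z => χ z * primitive u z s) := fun hs0 =>
    (hχc.mul (hu.continuous_primitive_left hs0)).integrable_of_hasCompactSupport hχs.mul_right
  have e : ∀ s, 0 < s → ∫ z, ρ z * potential F u z s =
      -(∫ z, ψ z * u z s) - m * ∫ r in (1 : ℝ)..s, ∫ z, χ z * F (u z r) := fun s hs0 => by
    have e1 := integral_deriv_mul_eq_neg hψ1 hψs (hu.continuous_primitive_left hs0)
      (hu.hasDerivWithinAt_primitive hs0) (hu.measurable s hs0) fun x => hu.abs_apply_le x s hs0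
    have i2 : Integrable fun z => m * (χ z * primitive u z s) := (iχ hs0).const_mul m
    rw [hψ'] at e1
    simp only [sub_mul, mul_assoc] at e1
    rw [integral_sub (iρ hs0) i2, integral_const_mul] at e1
    have e2 : ∀ z, ρ z * potential F u z s = ρ z * primitive u z s
        - ρ z * ((∫ z, χ z * primitive u z s) + ∫ r in (1 : ℝ)..s, ∫ z, χ z * F (u z r)) := fun z => by
      unfold potential; ring
    simp_rw [e2]
    rw [integral_sub (iρ hs0) (hρi.mul_const _), integral_mul_const, ← hm, ← e1]
    ring
  have hd := (hu.hasDerivAt_integral_mul hF hψ1 hψs ht).neg.sub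
    ((hu.hasDerivAt_integral_integral_mul_flux hF hχc hχs ht).const_mul m)
  refine (hd.congr_of_eventuallyEq ?_).congr_deriv ?_
  · filter_upwards [Ioi_mem_nhds ht] with s hs0 using e s hs0
  · have j1 := hu.integrable_mul_comp hF hρ.continuous hs ht
    have j2 : Integrable fun z => m * (χ z * F (u z t)) :=
      (hu.integrable_mul_comp hF hχc hχs ht).const_mul m
    rw [hψ']
    simp only [sub_mul, mul_assoc]
    rw [integral_sub j1 j2, integral_const_mul]
    ring

theorem smoothPotential_eq (n : ℕ) (x t : ℝ) :
    smoothPotential F u n x t = ∫ z, rightKernel n (z - x) * potential F u z t :=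
  (integral_rightKernel_sub_mul n (fun z => potential F u z t) x).symm

/-- The derivative falls on the kernel and is moved back onto the potential by parts; its right
derivative `u` suffices for that. -/
theorem hasDerivAt_smoothPotential_left (hu : IsKruzhkovSolution F u M) (n : ℕ) (x : ℝ) {t : ℝ}
    (ht : 0 < t) : HasDerivAt (fun x => smoothPotential F u n x t)
      (∫ z, rightKernel n z * u (x + z) t) x := by
  have hUc := hu.continuous_potential_left ht
  have hκ : ContDiff ℝ 1 (rightKernel n) := (contDiff_rightKernel n).of_le (by simp)
  have hg : ContDiff ℝ 1 (fun s => rightKernel n (-s)) := hκ.comp contDiff_neg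
  have hgs : HasCompactSupport (fun s => rightKernel n (-s)) :=
    (hasCompactSupport_rightKernel n).comp_homeomorph (Homeomorph.neg ℝ)
  have h1 := hgs.hasDerivAt_convolution_right (ContinuousLinearMap.mul ℝ ℝ) (μ := volume)
    hUc.locallyIntegrable hg x
  have h2 : (fun x => smoothPotential F u n x t) = convolution (fun z => potential F u z t)
      (fun s => rightKernel n (-s)) (ContinuousLinearMap.mul ℝ ℝ) volume := by
    ext x
    rw [smoothPotential_eq]
    simp only [convolution_def, ContinuousLinearMap.mul_apply', neg_sub]
    exact integral_congr_ae (ae_of_all _ fun z => mul_comm _ _)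
  rw [h2]
  refine h1.congr_deriv ?_
  have hκd : ∀ z, HasDerivAt (rightKernel n) (deriv (rightKernel n) z) z := fun z =>
    (hκ.differentiable (by simp) z).hasDerivAt
  have h3 : ∀ s, deriv (fun s => rightKernel n (-s)) s = -deriv (rightKernel n) (-s) := fun s => by
    rw [deriv_comp_neg]
  simp only [convolution_def, ContinuousLinearMap.mul_apply', h3, neg_sub]
  have hη : ContDiff ℝ 1 (fun z => rightKernel n (z - x)) :=
    hκ.comp (contDiff_id.sub contDiff_const)
  have hηs : HasCompactSupport (fun z => rightKernel n (z - x)) :=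
    (hasCompactSupport_rightKernel n).comp_homeomorph (Homeomorph.subRight x)
  have h4 := integral_deriv_mul_eq_neg hη hηs hUc (hu.hasDerivWithinAt_potential ht)
    (hu.measurable t ht) fun x => hu.abs_apply_le x t ht
  have h5 : ∀ z, deriv (fun z => rightKernel n (z - x)) z = deriv (rightKernel n) (z - x) := fun z =>
    ((hκd (z - x)).comp_sub_const z x).deriv
  simp only [h5] at h4
  rw [integral_rightKernel_sub_mul n (fun z => u z t) x] at h4
  rw [← neg_eq_iff_eq_neg] at h4
  rw [← h4, ← integral_neg]
  exact integral_congr_ae (ae_of_all _ fun z => by ring)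

theorem hasDerivAt_smoothPotential_right (hu : IsKruzhkovSolution F u M) (hF : Continuous F) (n : ℕ)
    (x : ℝ) {t : ℝ} (ht : 0 < t) : HasDerivAt (fun t => smoothPotential F u n x t)
      (-∫ z, rightKernel n z * F (u (x + z) t)) t := by
  simp_rw [smoothPotential_eq]
  rw [← integral_rightKernel_sub_mul n (fun z => F (u z t)) x]
  exact hu.hasDerivAt_integral_mul_potential hF
    ((contDiff_rightKernel n).comp (contDiff_id.sub contDiff_const))
    ((hasCompactSupport_rightKernel n).comp_homeomorph (Homeomorph.subRight x)) ht

theorem continuousAt_rightKernel_comp (hu : IsKruzhkovSolution F u M) {g : ℝ → ℝ}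
    (hg : Continuous g) (n : ℕ) {p : ℝ × ℝ} (hp : p ∈ posTime) :
    ContinuousAt (fun p : ℝ × ℝ => ∫ z, rightKernel n z * g (u (p.1 + z) p.2)) p :=
  hu.continuousAt_integral_mul_comp_add hg (continuous_rightKernel n)
    (hasCompactSupport_rightKernel n) hp

theorem hasFDerivAt_smoothPotential (hu : IsKruzhkovSolution F u M) (hF : Continuous F) (n : ℕ)
    {p : ℝ × ℝ} (hp : p ∈ posTime) :
    HasFDerivAt (fun q : ℝ × ℝ => smoothPotential F u n q.1 q.2)
      ((∫ z, rightKernel n z * u (p.1 + z) p.2) • ContinuousLinearMap.fst ℝ ℝ ℝ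
        + (-∫ z, rightKernel n z * F (u (p.1 + z) p.2)) • ContinuousLinearMap.snd ℝ ℝ ℝ) p :=
  hasFDerivAt_of_partials (f := smoothPotential F u n)
    (a := fun x t => ∫ z, rightKernel n z * u (x + z) t)
    (b := fun x t => -∫ z, rightKernel n z * F (u (x + z) t)) isOpen_posTime
    (fun q hq => hu.hasDerivAt_smoothPotential_left n q.1 hq)
    (fun q hq => hu.hasDerivAt_smoothPotential_right hF n q.1 hq)
    (fun _ hq => hu.continuousAt_rightKernel_comp continuous_id n hq)
    (fun _ hq => (hu.continuousAt_rightKernel_comp hF n hq).neg) hp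

theorem tendsto_rightKernel_comp (hu : IsKruzhkovSolution F u M) {g : ℝ → ℝ} (hg : Continuous g)
    (x : ℝ) {t : ℝ} (ht : 0 < t) :
    Tendsto (fun n => ∫ z, rightKernel n z * g (u (x + z) t)) atTop (𝓝 (g (u x t))) := by
  obtain ⟨B, hB⟩ := exists_bound_of_continuous hg M
  have h0 : (fun z => g (u (x + z) t)) 0 = g (u x t) := by simp
  rw [← h0]
  refine tendsto_integral_rightKernel_mul (h := fun z => g (u (x + z) t)) ?_ ?_
  · exact Measure.integrableOn_of_bounded (M := B) isCompact_Icc.measure_lt_top.ne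
      (hg.measurable.comp ((hu.measurable t ht).comp (measurable_const_add x))).aestronglyMeasurable
      (ae_of_all _ fun z => hB _ (hu.abs_apply_le _ t ht))
  · refine hg.continuousAt.comp_continuousWithinAt ?_
    have h1 := hu.rightContinuous t ht x
    have h2 : ContinuousWithinAt (fun z => x + z) (Ici 0) 0 := by fun_prop
    refine ContinuousWithinAt.comp (t := Ici x) (by simpa using h1) h2 ?_
    intro z hz; simpa using hz

theorem abs_rightKernel_comp_le (hu : IsKruzhkovSolution F u M) {g : ℝ → ℝ} {B : ℝ}
    (hB : ∀ r, |r| ≤ M → |g r| ≤ B) (n : ℕ) (x : ℝ) {t : ℝ} (ht : 0 < t) :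
    |∫ z, rightKernel n z * g (u (x + z) t)| ≤ B := by
  have := norm_integral_le_of_norm_le (μ := volume)
    (f := fun z => rightKernel n z * g (u (x + z) t))
    ((integrable_rightKernel n).mul_const B) (ae_of_all _ fun z => by
      rw [norm_mul, Real.norm_of_nonneg (rightKernel_nonneg n z)]
      exact mul_le_mul_of_nonneg_left (hB _ (hu.abs_apply_le _ t ht)) (rightKernel_nonneg n z))
  rwa [integral_mul_const, integral_rightKernel, one_mul] at this

theorem abs_smoothPotential_sub_le (hu : IsKruzhkovSolution F u M) (n : ℕ) (x : ℝ) {t : ℝ}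
    (ht : 0 < t) : |smoothPotential F u n x t - potential F u x t| ≤ M * (1 / ((n : ℝ) + 1)) := by
  have hUc : Continuous fun z => potential F u (x + z) t :=
    (hu.continuous_potential_left ht).comp (continuous_const.add continuous_id)
  have i1 : Integrable (fun z => rightKernel n z * potential F u (x + z) t) :=
    ((continuous_rightKernel n).mul hUc).integrable_of_hasCompactSupport
      (hasCompactSupport_rightKernel n).mul_right
  have e : smoothPotential F u n x t - potential F u x t =
      ∫ z, rightKernel n z * (potential F u (x + z) t - potential F u x t) := by
    simp_rw [mul_sub]
    rw [integral_sub i1 ((integrable_rightKernel n).mul_const _), integral_mul_const,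
      integral_rightKernel, one_mul]
    rfl
  rw [e]
  have := norm_integral_le_of_norm_le (μ := volume)
    (f := fun z => rightKernel n z * (potential F u (x + z) t - potential F u x t))
    ((integrable_rightKernel n).mul_const (M * (1 / ((n : ℝ) + 1)))) (ae_of_all _ fun z => by
      rw [norm_mul, Real.norm_of_nonneg (rightKernel_nonneg n z)]
      by_cases hz : rightKernel n z = 0
      · simp [hz]
      · have hz' := mem_Ioo_of_rightKernel_ne_zero hz
        refine mul_le_mul_of_nonneg_left ?_ (rightKernel_nonneg n z)
        refine (hu.abs_potential_sub_le ht _ _).trans (mul_le_mul_of_nonneg_left ?_ hu.nonneg)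
        rw [add_sub_cancel_left, abs_of_pos hz'.1]
        exact hz'.2.le)
  rwa [integral_mul_const, integral_rightKernel, one_mul] at this

theorem tendsto_smoothPotential (hu : IsKruzhkovSolution F u M) (x : ℝ) {t : ℝ} (ht : 0 < t) :
    Tendsto (fun n => smoothPotential F u n x t) atTop (𝓝 (potential F u x t)) := by
  rw [tendsto_iff_norm_sub_tendsto_zero]
  refine squeeze_zero (fun n => norm_nonneg _) (fun n => hu.abs_smoothPotential_sub_le n x ht) ?_
  simpa using tendsto_one_div_add_atTop_nhds_zero_nat.const_mul M

/-! ### The upper bound in the Lax–Oleinik formula -/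

/-- The easy half of the Lax–Oleinik formula. -/
theorem potential_le (hu : IsKruzhkovSolution F u M) {F₁ F₂ : ℝ → ℝ} {c : ℝ}
    (h : IsUniformlyConvexFlux F F₁ F₂ c) {s t : ℝ} (hs : 0 < s) (hst : s < t) (x y : ℝ) :
    potential F u x t ≤ potential F u y s + (t - s) * legendre F F₁ ((x - y) / (t - s)) := by
  have hts : 0 < t - s := sub_pos.2 hst
  set p := (x - y) / (t - s)
  have key : ∀ n, smoothPotential F u n x t - smoothPotential F u n y s
      ≤ (t - s) * legendre F F₁ p := fun n => by
    -- The straight segment of slope `p` from `(y, s)` to `(x, t)`. The mollified potential is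
    -- differentiable along it, which `U` itself need not be.
    have hγ : ∀ r : ℝ, HasDerivAt (fun r => (y + p * (r - s), r)) (p, 1) r := fun r => by
      have h1 : HasDerivAt (fun r => y + p * (r - s)) p r := by
        simpa using (((hasDerivAt_id r).sub_const s).const_mul p).const_add y
      exact h1.prodMk (hasDerivAt_id r)
    have hd : ∀ r, 0 < r → HasDerivAt (fun r => smoothPotential F u n (y + p * (r - s)) r)
        (p * (∫ z, rightKernel n z * u (y + p * (r - s) + z) r)
          - ∫ z, rightKernel n z * F (u (y + p * (r - s) + z) r)) r := fun r hr => by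
      have := HasFDerivAt.comp_hasDerivAt (f := fun r => (y + p * (r - s), r)) r
        (hu.hasFDerivAt_smoothPotential h.continuous n (p := (y + p * (r - s), r)) hr) (hγ r)
      refine this.congr_deriv ?_
      simp
      ring
    -- The mollified expression is an average of `p * u - F(u)` against a probability kernel, so
    -- Young's inequality bounds it by `L(p)`.
    have hle : ∀ r, 0 < r → p * (∫ z, rightKernel n z * u (y + p * (r - s) + z) r)
          - (∫ z, rightKernel n z * F (u (y + p * (r - s) + z) r)) ≤ legendre F F₁ p := by
      intro r hr
      have hi : ∀ {g : ℝ → ℝ}, Continuous g → Integrable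
          (fun z => rightKernel n z * g (u (y + p * (r - s) + z) r)) := fun {g} hg => by
        obtain ⟨B, hB⟩ := exists_bound_of_continuous hg M
        exact (integrable_rightKernel n).mul_bdd (hg.measurable.comp ((hu.measurable r hr).comp
          (measurable_const_add _))).aestronglyMeasurable
          (ae_of_all _ fun z => hB _ (hu.abs_apply_le _ r hr))
      have i1 := hi continuous_id
      have i2 := hi h.continuous
      simp only [id] at i1
      rw [← integral_const_mul, ← integral_sub (i1.const_mul p) i2]
      calc _ ≤ ∫ z, rightKernel n z * legendre F F₁ p := by
            refine integral_mono ((i1.const_mul p).sub i2)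
              ((integrable_rightKernel n).mul_const _) fun z => ?_
            have := mul_le_mul_of_nonneg_left
              (h.mul_sub_le_legendre (u (y + p * (r - s) + z) r) p) (rightKernel_nonneg n z)
            simp only
            linarith
        _ = _ := by rw [integral_mul_const, integral_rightKernel, one_mul]
    have := Convex.image_sub_le_mul_sub_of_deriv_le (convex_Icc s t)
      (f := fun r => smoothPotential F u n (y + p * (r - s)) r)
      (fun r hr => (hd r (lt_of_lt_of_le hs hr.1)).continuousAt.continuousWithinAt)
      (fun r hr => (hd r (lt_of_lt_of_le hs
        (interior_subset hr).1)).differentiableAt.differentiableWithinAt)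
      (C := legendre F F₁ p) (fun r hr => by
        have hr' : 0 < r := lt_of_lt_of_le hs (interior_subset hr).1
        rw [(hd r hr').deriv]; exact hle r hr')
      s (left_mem_Icc.2 hst.le) t (right_mem_Icc.2 hst.le) hst.le
    have hx : y + p * (t - s) = x := by
      simp only [p]; field_simp; ring
    simp only [sub_self, mul_zero, add_zero, hx] at this
    linarith
  have hlim := (hu.tendsto_smoothPotential x (hs.trans hst)).sub (hu.tendsto_smoothPotential y hs)
  have := le_of_tendsto' hlim key
  linarith

end IsKruzhkovSolution

/-! ### Kruzhkov's inequality relative to a compression fan -/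

theorem integrable_prod_restrict_of_bounded {K : Set (ℝ × ℝ)} (hK : IsCompact K) {a b : ℝ}
    {f : (ℝ × ℝ) × ℝ → ℝ} {C : ℝ}
    (hf : AEStronglyMeasurable f ((volume.restrict posTime).prod (volume.restrict (Icc a b))))
    (hC : ∀ p ∈ posTime, p ∈ K → ∀ k ∈ Icc a b, |f (p, k)| ≤ C)
    (h0 : ∀ p, p ∉ K → ∀ k, f (p, k) = 0) :
    Integrable f ((volume.restrict posTime).prod (volume.restrict (Icc a b))) := by
  have h1 : Integrable (K.indicator fun _ => C) (volume.restrict posTime) := by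
    refine Integrable.restrict ?_
    rw [integrable_indicator_iff hK.measurableSet]
    exact integrableOn_const hK.measure_lt_top.ne
  refine Integrable.mono' (h1.comp_fst (volume.restrict (Icc a b))) hf ?_
  rw [Measure.prod_restrict]
  refine ae_restrict_of_forall_mem (measurableSet_posTime.prod measurableSet_Icc) fun z hz => ?_
  by_cases hzK : z.1 ∈ K
  · rw [indicator_of_mem hzK]
    exact hC z.1 hz.1 hzK z.2 hz.2
  · rw [indicator_of_notMem hzK, h0 z.1 hzK z.2, norm_zero]

namespace IsUniformlyConvexFlux

variable {F F₁ F₂ : ℝ → ℝ} {c : ℝ}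

/-- Differentiating `|r - k|` and the entropy flux in `k` produces the same term `-sgn(r - k) * F₁
k`; the two cancel and only the derivative of `F₁` survives. -/
theorem hasDerivAt_abs_sub_mul_sub_kruzhkovFlux (h : IsUniformlyConvexFlux F F₁ F₂ c) {r k : ℝ}
    (hk : k ≠ r) :
    HasDerivAt (fun k => |r - k| * F₁ k - kruzhkovFlux F r k) (F₂ k * |r - k|) k := by
  have h1 : HasDerivAt (fun k => (r - k) * F₁ k - (F r - F k)) (F₂ k * (r - k)) k := by
    refine ((((hasDerivAt_id k).const_sub r).mul (h.hasDerivAt_deriv k)).sub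
      ((h.hasDerivAt k).const_sub (F r))).congr_deriv ?_
    simp only [id]
    ring
  rcases lt_or_gt_of_ne hk with hlt | hlt
  · refine (h1.congr_of_eventuallyEq ?_).congr_deriv ?_
    · filter_upwards [gt_mem_nhds hlt] with s hs
      rw [kruzhkovFlux, max_eq_left hs.le, min_eq_right hs.le, abs_of_pos (by linarith)]
    · rw [abs_of_pos (by linarith)]
  · refine (h1.neg.congr_of_eventuallyEq ?_).congr_deriv ?_
    · filter_upwards [lt_mem_nhds hlt] with s hs
      rw [kruzhkovFlux, max_eq_right hs.le, min_eq_left hs.le, abs_of_neg (by linarith)]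
      simp only [Pi.neg_apply]
      ring
    · rw [abs_of_neg (by linarith)]
      ring

/-- Averaging the Kruzhkov entropies over a pencil of characteristics: the terms in which the
derivative falls on the kernel cancel exactly. -/
theorem integral_fan_kernel (h : IsUniformlyConvexFlux F F₁ F₂ c) {R : ℝ → ℝ}
    (hR : ContDiff ℝ 1 R) (hR0 : ∀ ξ, ξ ≤ 0 → R ξ = 0) (hR1 : ∀ ξ, 1 ≤ ξ → R ξ = 0)
    {a S N : ℝ} (hS : S ≠ 0) (hNa : a ≤ F₁ N * S) (hNb : F₁ (-N) * S ≤ a - 1) (r b bt bx : ℝ) :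
    ∫ k in (-N)..N,
      (|r - k| * (F₂ k * (-(R (a - F₁ k * S) * b) + S * (deriv R (a - F₁ k * S) * F₁ k) * b
          + S * R (a - F₁ k * S) * bt))
        + kruzhkovFlux F r k * (F₂ k * (-(S * deriv R (a - F₁ k * S) * b)
          + S * R (a - F₁ k * S) * bx))) =
      ∫ ξ, R ξ * (|r - invDeriv F₁ ((a - ξ) / S)| * bt
        + kruzhkovFlux F r (invDeriv F₁ ((a - ξ) / S)) * bx) := by
  have hF := h.continuous
  have hF₁ := h.continuous_deriv
  have hF₂ := h.continuous_deriv_deriv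
  have hRc := hR.continuous
  have hR' : Continuous (deriv R) := hR.continuous_deriv (by simp)
  have hg := h.continuous_invDeriv
  have hξ : ∀ k, HasDerivAt (fun k => a - F₁ k * S) (-(F₂ k * S)) k := fun k =>
    ((h.hasDerivAt_deriv k).mul_const S).const_sub a
  have hξc : Continuous fun k => a - F₁ k * S := by fun_prop
  set ξ : ℝ → ℝ := fun k => a - F₁ k * S with hξdef
  have hE : Continuous fun k => |r - k| * bt + kruzhkovFlux F r k * bx := by
    unfold kruzhkovFlux; fun_prop
  have hD : Continuous fun k => |r - k| * F₁ k - kruzhkovFlux F r k := by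
    unfold kruzhkovFlux; fun_prop
  have c1 : Continuous fun k => F₂ k * S * R (ξ k) * (|r - k| * bt + kruzhkovFlux F r k * bx) := by
    fun_prop
  have c2 : Continuous fun k => F₂ k * |r - k| * R (ξ k)
      + (|r - k| * F₁ k - kruzhkovFlux F r k) * (deriv R (ξ k) * -(F₂ k * S)) := by fun_prop
  -- The integrand is the `k`-derivative of `(|r - k| * F₁ k - kruzhkovFlux F r k) * R (ξ k)` except
  -- at the kink `k = r`. The boundary terms vanish because `ξ N ≤ 0` and `1 ≤ ξ (-N)` lie where `R`
  -- is zero.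
  have hcancel : ∫ k in (-N)..N, (F₂ k * |r - k| * R (ξ k)
      + (|r - k| * F₁ k - kruzhkovFlux F r k) * (deriv R (ξ k) * -(F₂ k * S))) = 0 := by
    rw [integral_eq_of_hasDerivAt_off_countable
      (fun k => (|r - k| * F₁ k - kruzhkovFlux F r k) * R (ξ k)) _ (countable_singleton r)
      (by fun_prop) (fun k hk => ?_) (c2.intervalIntegrable _ _)]
    · rw [hR0 (ξ N) (by simp only [hξdef]; linarith), hR1 (ξ (-N)) (by simp only [hξdef]; linarith)]
      ring
    · exact (h.hasDerivAt_abs_sub_mul_sub_kruzhkovFlux hk.2).mul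
        (((hR.differentiable (by simp) _).hasDerivAt).comp k (hξ k))
  -- Change of variables from `k` to `ξ = a - F₁ k * S`: the weight `F₂ k * S` is exactly the
  -- Jacobian, up to sign.
  have hsubst := intervalIntegral.integral_comp_mul_deriv (a := -N) (b := N) (f := ξ)
    (f' := fun k => -(F₂ k * S))
    (g := fun s => R s * (|r - invDeriv F₁ ((a - s) / S)| * bt
        + kruzhkovFlux F r (invDeriv F₁ ((a - s) / S)) * bx))
    (fun k _ => hξ k) (by fun_prop)
    (hRc.mul (hE.comp (hg.comp (by fun_prop : Continuous fun s => (a - s) / S))))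
  have hinv : ∀ k, invDeriv F₁ ((a - ξ k) / S) = k := fun k => by
    have : (a - ξ k) / S = F₁ k := by simp only [hξdef]; field_simp; ring
    rw [this, h.invDeriv_apply]
  simp only [Function.comp, hinv] at hsubst
  have hfull : ∫ s in (ξ N)..(ξ (-N)), R s * (|r - invDeriv F₁ ((a - s) / S)| * bt
        + kruzhkovFlux F r (invDeriv F₁ ((a - s) / S)) * bx) =
      ∫ s, R s * (|r - invDeriv F₁ ((a - s) / S)| * bt
        + kruzhkovFlux F r (invDeriv F₁ ((a - s) / S)) * bx) := by
    have h1 : ξ N ≤ 0 := by simp only [hξdef]; linarith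
    have h2 : 1 ≤ ξ (-N) := by simp only [hξdef]; linarith
    rw [intervalIntegral.integral_of_le (by linarith)]
    refine setIntegral_eq_integral_of_forall_compl_eq_zero fun s hs => ?_
    rw [mem_Ioc, not_and_or, not_lt, not_le] at hs
    rcases hs with hs | hs
    · rw [hR0 s (by linarith), zero_mul]
    · rw [hR1 s (by linarith), zero_mul]
  rw [← hfull, intervalIntegral.integral_symm (ξ (-N)) (ξ N), ← hsubst, ← intervalIntegral.integral_neg]
  have hz := congrArg (fun x => -b * x) hcancel
  simp only [mul_zero] at hz
  rw [← intervalIntegral.integral_const_mul] at hz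
  rw [← sub_eq_zero, ← intervalIntegral.integral_sub]
  · refine Eq.trans (intervalIntegral.integral_congr fun k _ => ?_) hz
    ring
  · refine Continuous.intervalIntegrable ?_ _ _
    have : Continuous fun k => kruzhkovFlux F r k := by unfold kruzhkovFlux; fun_prop
    fun_prop
  · refine Continuous.intervalIntegrable ?_ _ _
    fun_prop

end IsUniformlyConvexFlux

/-- The value at `p` of the compression fan focusing at the point `(x₀, T)`. -/
noncomputable def fan (F₁ : ℝ → ℝ) (x₀ T : ℝ) (p : ℝ × ℝ) : ℝ := invDeriv F₁ ((x₀ - p.1) / (T - p.2))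

/-- The open strip between the times `0` and `T`. -/
def strip (T : ℝ) : Set (ℝ × ℝ) := {p | 0 < p.2 ∧ p.2 < T}

theorem isOpen_strip (T : ℝ) : IsOpen (strip T) :=
  (isOpen_lt continuous_const continuous_snd).inter (isOpen_lt continuous_snd continuous_const)

theorem strip_subset_posTime (T : ℝ) : strip T ⊆ posTime := fun _ hp => hp.1

namespace IsKruzhkovSolution

variable {F F₁ F₂ : ℝ → ℝ} {u : ℝ → ℝ → ℝ} {M c : ℝ}

/-- For each `k` the test function is `(T - τ) R(x₀ - y - F₁(k)(T - τ)) β`, concentrated near the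
characteristic on which the fan equals `k`. Weighting by `F₂ k ≥ 0`, integrating over `k` and
exchanging the integrals leads to `integral_fan_kernel`. -/
theorem integral_fan_kernel_nonneg (hu : IsKruzhkovSolution F u M)
    (h : IsUniformlyConvexFlux F F₁ F₂ c) {x₀ T N : ℝ} {β : ℝ × ℝ → ℝ} (hβ : ContDiff ℝ 1 β)
    (hs : HasCompactSupport β) (ht : tsupport β ⊆ strip T) (h0 : ∀ p, 0 ≤ β p) (hN : 0 ≤ N)
    (hNa : ∀ p ∈ tsupport β, x₀ - p.1 ≤ F₁ N * (T - p.2))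
    (hNb : ∀ p ∈ tsupport β, F₁ (-N) * (T - p.2) ≤ x₀ - p.1 - 1)
    {R : ℝ → ℝ} (hR : ContDiff ℝ ∞ R) (hRn : ∀ ξ, 0 ≤ R ξ) (hR0 : ∀ ξ, ξ ≤ 0 → R ξ = 0)
    (hR1 : ∀ ξ, 1 ≤ ξ → R ξ = 0) :
    Integrable (fun p => ∫ ξ, R ξ *
      (|u p.1 p.2 - invDeriv F₁ ((x₀ - p.1 - ξ) / (T - p.2))| * fderiv ℝ β p (0, 1)
        + kruzhkovFlux F (u p.1 p.2) (invDeriv F₁ ((x₀ - p.1 - ξ) / (T - p.2)))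
          * fderiv ℝ β p (1, 0))) (volume.restrict posTime) ∧
    0 ≤ ∫ p in posTime, ∫ ξ, R ξ *
      (|u p.1 p.2 - invDeriv F₁ ((x₀ - p.1 - ξ) / (T - p.2))| * fderiv ℝ β p (0, 1)
        + kruzhkovFlux F (u p.1 p.2) (invDeriv F₁ ((x₀ - p.1 - ξ) / (T - p.2)))
          * fderiv ℝ β p (1, 0)) := by
  have hF₁ := h.continuous_deriv
  have hF₂ := h.continuous_deriv_deriv
  have hRs : ContDiff ℝ 1 R := hR.of_le (by simp)
  have hRc := hR.continuous
  have hR' : Continuous (deriv R) := hR.continuous_deriv (by simp)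
  have hβc := hβ.continuous
  have hd : ∀ v, Continuous fun p => fderiv ℝ β p v := fun v =>
    (hβ.continuous_fderiv (by simp)).clm_apply continuous_const
  have hd0 : ∀ v, ∀ p, p ∉ tsupport β → fderiv ℝ β p v = 0 := fun v p hp => by
    rw [fderiv_of_notMem_tsupport ℝ hp]; simp
  have hdt := hd (0, 1)
  have hdx := hd (1, 0)
  let Dt : (ℝ × ℝ) × ℝ → ℝ := fun z =>
    -(R (x₀ - z.1.1 - F₁ z.2 * (T - z.1.2)) * β z.1)
      + (T - z.1.2) * (deriv R (x₀ - z.1.1 - F₁ z.2 * (T - z.1.2)) * F₁ z.2) * β z.1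
      + (T - z.1.2) * R (x₀ - z.1.1 - F₁ z.2 * (T - z.1.2)) * fderiv ℝ β z.1 (0, 1)
  let Dx : (ℝ × ℝ) × ℝ → ℝ := fun z =>
    -((T - z.1.2) * deriv R (x₀ - z.1.1 - F₁ z.2 * (T - z.1.2)) * β z.1)
      + (T - z.1.2) * R (x₀ - z.1.1 - F₁ z.2 * (T - z.1.2)) * fderiv ℝ β z.1 (1, 0)
  have hDt : Continuous Dt := by fun_prop
  have hDx : Continuous Dx := by fun_prop
  have hDt0 : ∀ p, p ∉ tsupport β → ∀ k, Dt (p, k) = 0 := fun p hp k => by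
    simp only [Dt, hd0 _ p hp, image_eq_zero_of_notMem_tsupport hp]; ring
  have hDx0 : ∀ p, p ∉ tsupport β → ∀ k, Dx (p, k) = 0 := fun p hp k => by
    simp only [Dx, hd0 _ p hp, image_eq_zero_of_notMem_tsupport hp]; ring
  let G : (ℝ × ℝ) × ℝ → ℝ := fun z => |u z.1.1 z.1.2 - z.2| * (F₂ z.2 * Dt z)
    + kruzhkovFlux F (u z.1.1 z.1.2) z.2 * (F₂ z.2 * Dx z)
  have hm := (hu.aestronglyMeasurable.comp_fst (ν := volume.restrict (Icc (-N) N)))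
  have hm2 : AEStronglyMeasurable (fun z : (ℝ × ℝ) × ℝ => z.2)
      ((volume.restrict posTime).prod (volume.restrict (Icc (-N) N))) :=
    continuous_snd.aestronglyMeasurable
  have hK := hs.isCompact
  have hkf := continuous_kruzhkovFlux h.continuous
  have hGm : AEStronglyMeasurable G
      ((volume.restrict posTime).prod (volume.restrict (Icc (-N) N))) := by
    refine AEStronglyMeasurable.add ?_ ?_
    · exact (hm.sub hm2).norm.mul
        ((hF₂.comp continuous_snd).mul hDt).aestronglyMeasurable
    · exact (hkf.comp_aestronglyMeasurable (hm.prodMk hm2)).mul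
        ((hF₂.comp continuous_snd).mul hDx).aestronglyMeasurable
  obtain ⟨C, hC⟩ := ((isCompact_Icc (a := -M) (b := M)).prod
    (hK.prod (isCompact_Icc (a := -N) (b := N)))).exists_bound_of_continuousOn
    (f := fun z : ℝ × ((ℝ × ℝ) × ℝ) => |z.1 - z.2.2| * (F₂ z.2.2 * Dt z.2)
      + kruzhkovFlux F z.1 z.2.2 * (F₂ z.2.2 * Dx z.2)) (by
      have : Continuous fun z : ℝ × ((ℝ × ℝ) × ℝ) => kruzhkovFlux F z.1 z.2.2 :=
        hkf.comp (continuous_fst.prodMk (continuous_snd.comp continuous_snd))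
      fun_prop)
  have hGi : Integrable G ((volume.restrict posTime).prod (volume.restrict (Icc (-N) N))) := by
    refine integrable_prod_restrict_of_bounded hK (C := C) hGm (fun p hp hpK k hk => ?_)
      (fun p hp k => ?_)
    · exact hC (u p.1 p.2, (p, k)) ⟨abs_le.1 (hu.abs_apply_le _ _ hp), hpK, hk⟩
    · simp only [G, hDt0 p hp, hDx0 p hp]; ring
  have hinner : ∀ p, ∫ k in Icc (-N) N, G (p, k) = ∫ ξ, R ξ *
      (|u p.1 p.2 - invDeriv F₁ ((x₀ - p.1 - ξ) / (T - p.2))| * fderiv ℝ β p (0, 1)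
        + kruzhkovFlux F (u p.1 p.2) (invDeriv F₁ ((x₀ - p.1 - ξ) / (T - p.2)))
          * fderiv ℝ β p (1, 0)) := fun p => by
    by_cases hp : p ∈ tsupport β
    · rw [integral_Icc_eq_integral_Ioc, ← intervalIntegral.integral_of_le (by linarith)]
      exact h.integral_fan_kernel hRs hR0 hR1 (sub_pos.2 (ht hp).2).ne' (hNa p hp) (hNb p hp)
        (u p.1 p.2) (β p) (fderiv ℝ β p (0, 1)) (fderiv ℝ β p (1, 0))
    · simp only [G, hDt0 p hp, hDx0 p hp, hd0 _ p hp]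
      simp
  have hk : ∀ k, 0 ≤ ∫ p in posTime, G (p, k) := fun k => by
    let Φ : ℝ × ℝ → ℝ := fun p => (T - p.2) * R (x₀ - p.1 - F₁ k * (T - p.2)) * β p
    have hΦ : ContDiff ℝ 1 Φ := by
      refine ContDiff.mul (ContDiff.mul (contDiff_const.sub contDiff_snd) (hRs.comp ?_)) hβ
      exact (contDiff_const.sub contDiff_fst).sub
        (contDiff_const.mul (contDiff_const.sub contDiff_snd))
    have hΦt : tsupport Φ ⊆ tsupport β :=
      closure_mono (Function.support_mul_subset_right _ _)
    have hfd : ∀ p : ℝ × ℝ, fderiv ℝ Φ p (0, 1) = Dt (p, k) ∧ fderiv ℝ Φ p (1, 0) = Dx (p, k) := by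
      intro p
      have h1 : HasFDerivAt (fun p : ℝ × ℝ => T - p.2) (-ContinuousLinearMap.snd ℝ ℝ ℝ) p :=
        hasFDerivAt_snd.const_sub T
      have h2 : HasFDerivAt (fun p : ℝ × ℝ => x₀ - p.1 - F₁ k * (T - p.2))
          (-ContinuousLinearMap.fst ℝ ℝ ℝ - F₁ k • (-ContinuousLinearMap.snd ℝ ℝ ℝ)) p :=
        (hasFDerivAt_fst.const_sub x₀).sub (h1.const_mul (F₁ k))
      have h3 := ((hRs.differentiable (by simp)
        (x₀ - p.1 - F₁ k * (T - p.2))).hasDerivAt).comp_hasFDerivAt p h2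
      have h4 := (h1.mul h3).mul (hβ.differentiable (by simp) p).hasFDerivAt
      have h5 : fderiv ℝ Φ p = _ := h4.fderiv
      rw [h5]
      simp [Dt, Dx]
      constructor <;> ring
    have hent := hu.entropy k Φ hΦ (hs.mono' (subset_closure.trans hΦt))
      (hΦt.trans (ht.trans (strip_subset_posTime T))) fun p => by
        by_cases hp : p ∈ tsupport β
        · exact mul_nonneg (mul_nonneg (sub_pos.2 (ht hp).2).le (hRn _)) (h0 p)
        · simp only [Φ, image_eq_zero_of_notMem_tsupport hp, mul_zero]; exact le_rfl
    have e : ∫ p in posTime, G (p, k) = F₂ k * ∫ p in posTime,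
        (|u p.1 p.2 - k| * fderiv ℝ Φ p (0, 1)
          + kruzhkovFlux F (u p.1 p.2) k * fderiv ℝ Φ p (1, 0)) := by
      rw [← integral_const_mul]
      refine integral_congr_ae (ae_of_all _ fun p => ?_)
      simp only [G, (hfd p).1, (hfd p).2]
      ring
    rw [e]
    exact mul_nonneg (h.pos.le.trans (h.le k)) hent
  have hsw := integral_integral_swap (f := fun p k => G (p, k)) hGi
  have hI := hGi.integral_prod_left
  simp only [hinner] at hsw hI
  exact ⟨hI, hsw ▸ integral_nonneg fun k => hk k⟩

/-- Kruzhkov's inequality with the constant replaced by a compression fan. -/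
theorem integral_fan_nonneg (hu : IsKruzhkovSolution F u M)
    (h : IsUniformlyConvexFlux F F₁ F₂ c) (x₀ : ℝ) {T : ℝ} {β : ℝ × ℝ → ℝ} (hβ : ContDiff ℝ 1 β)
    (hs : HasCompactSupport β) (ht : tsupport β ⊆ strip T) (h0 : ∀ p, 0 ≤ β p) :
    0 ≤ ∫ p in posTime, (|u p.1 p.2 - fan F₁ x₀ T p| * fderiv ℝ β p (0, 1)
      + kruzhkovFlux F (u p.1 p.2) (fan F₁ x₀ T p) * fderiv ℝ β p (1, 0)) := by
  have hK := hs.isCompact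
  have hcont : ∀ e : ℝ, ContinuousOn (fun p : ℝ × ℝ => (x₀ - p.1 - e) / (T - p.2)) (tsupport β) :=
    fun e => ContinuousOn.div (by fun_prop) (by fun_prop) fun p hp => (sub_pos.2 (ht hp).2).ne'
  obtain ⟨A, hA⟩ := hK.exists_bound_of_continuousOn (hcont 0)
  obtain ⟨A', hA'⟩ := hK.exists_bound_of_continuousOn (hcont 1)
  -- Uniform convexity gives `F₁ N ≥ A` and `F₁ (-N) ≤ -A'`, so `[-N, N]` contains all fan values on
  -- the support of `β`. `A'` covers the shift by `1`, since the kernels are supported in `[0, 1]`.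
  set N := (max (max A A') 0 + |F₁ 0|) / c with hNdef
  have hc := h.pos
  have hN : 0 ≤ N := by positivity
  have hcN : c * N = max (max A A') 0 + |F₁ 0| := by rw [hNdef]; field_simp
  have hN1 : max (max A A') 0 ≤ F₁ N := by
    have h1 := h.mul_sub_le hN
    have h2 := neg_abs_le (F₁ 0)
    rw [sub_zero, hcN] at h1
    linarith
  have hN2 : F₁ (-N) ≤ -max (max A A') 0 := by
    have h1 := h.mul_sub_le (neg_nonpos.2 hN)
    have h2 := le_abs_self (F₁ 0)
    rw [sub_neg_eq_add, zero_add, hcN] at h1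
    linarith
  have hAN : ∀ p ∈ tsupport β, (x₀ - p.1) / (T - p.2) ≤ F₁ N := fun p hp => by
    have h1 := (le_abs_self _).trans (hA p hp)
    rw [sub_zero] at h1
    exact h1.trans ((le_max_left _ _).trans ((le_max_left _ _).trans hN1))
  have hAN' : ∀ p ∈ tsupport β, F₁ (-N) ≤ (x₀ - p.1 - 1) / (T - p.2) := fun p hp => by
    have h1 := (abs_le.1 (hA' p hp)).1
    have h2 : A' ≤ max (max A A') 0 := (le_max_right _ _).trans (le_max_left _ _)
    linarith
  have hpos : ∀ p ∈ tsupport β, 0 < T - p.2 := fun p hp => sub_pos.2 (ht hp).2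
  have key := fun n => hu.integral_fan_kernel_nonneg h hβ hs ht h0 hN
    (fun p hp => (div_le_iff₀ (hpos p hp)).1 (hAN p hp))
    (fun p hp => (le_div_iff₀ (hpos p hp)).1 (hAN' p hp)) (contDiff_rightKernel n)
    (rightKernel_nonneg n) (fun ξ hξ => rightKernel_eq_zero_of_nonpos hξ)
    (fun ξ hξ => rightKernel_eq_zero_of_one_le hξ)
  have hd0 : ∀ v, ∀ p, p ∉ tsupport β → fderiv ℝ β p v = 0 := fun v p hp => by
    rw [fderiv_of_notMem_tsupport ℝ hp]; simp
  have hd : ∀ v, Continuous fun p => fderiv ℝ β p v := fun v =>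
    (hβ.continuous_fderiv (by simp)).clm_apply continuous_const
  have hdt := hd (0, 1)
  have hdx := hd (1, 0)
  have hkf := continuous_kruzhkovFlux h.continuous
  obtain ⟨C, hC⟩ := ((isCompact_Icc (a := -M) (b := M)).prod
    (hK.prod (isCompact_Icc (a := -N) (b := N)))).exists_bound_of_continuousOn
    (f := fun z : ℝ × ((ℝ × ℝ) × ℝ) => |z.1 - z.2.2| * fderiv ℝ β z.2.1 (0, 1)
      + kruzhkovFlux F z.1 z.2.2 * fderiv ℝ β z.2.1 (1, 0)) (by
      have : Continuous fun z : ℝ × ((ℝ × ℝ) × ℝ) => kruzhkovFlux F z.1 z.2.2 :=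
        hkf.comp (continuous_fst.prodMk (continuous_snd.comp continuous_snd))
      fun_prop)
  refine ge_of_tendsto' (tendsto_integral_of_dominated_convergence
    ((tsupport β).indicator fun _ => C) (fun n => (key n).1.aestronglyMeasurable) ?_ (fun n => ?_)
    (ae_of_all _ fun p => ?_)) fun n => (key n).2
  · refine Integrable.restrict ?_
    rw [integrable_indicator_iff hK.measurableSet]
    exact integrableOn_const hK.measure_lt_top.ne
  · refine ae_restrict_of_forall_mem measurableSet_posTime fun p hp => ?_
    by_cases hpK : p ∈ tsupport β
    · rw [indicator_of_mem hpK]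
      have := norm_integral_le_of_norm_le (μ := volume)
        (f := fun ξ => rightKernel n ξ *
          (|u p.1 p.2 - invDeriv F₁ ((x₀ - p.1 - ξ) / (T - p.2))| * fderiv ℝ β p (0, 1)
          + kruzhkovFlux F (u p.1 p.2) (invDeriv F₁ ((x₀ - p.1 - ξ) / (T - p.2)))
            * fderiv ℝ β p (1, 0)))
        ((integrable_rightKernel n).mul_const C) (ae_of_all _ fun ξ => by
          rw [norm_mul, Real.norm_of_nonneg (rightKernel_nonneg n ξ)]
          by_cases hξ : rightKernel n ξ = 0
          · simp [hξ]
          · have hξ' := mem_Ioo_of_rightKernel_ne_zero hξ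
            refine mul_le_mul_of_nonneg_left ?_ (rightKernel_nonneg n ξ)
            refine hC (u p.1 p.2, (p, invDeriv F₁ ((x₀ - p.1 - ξ) / (T - p.2))))
              ⟨abs_le.1 (hu.abs_apply_le _ _ hp), hpK, ?_, ?_⟩
            · rw [← h.strictMono.le_iff_le, h.apply_invDeriv]
              refine (hAN' p hpK).trans (div_le_div_of_nonneg_right ?_ (hpos p hpK).le)
              linarith [hξ'.2, one_div_nat_add_one_le n]
            · rw [← h.strictMono.le_iff_le, h.apply_invDeriv]
              refine le_trans (div_le_div_of_nonneg_right ?_ (hpos p hpK).le) (hAN p hpK)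
              linarith [hξ'.1])
      rwa [integral_mul_const, integral_rightKernel, one_mul] at this
    · rw [indicator_of_notMem hpK]
      simp [hd0 _ p hpK]
  · have hc1 : Continuous fun ξ => |u p.1 p.2 - invDeriv F₁ ((x₀ - p.1 - ξ) / (T - p.2))|
        * fderiv ℝ β p (0, 1) + kruzhkovFlux F (u p.1 p.2) (invDeriv F₁ ((x₀ - p.1 - ξ) / (T - p.2)))
        * fderiv ℝ β p (1, 0) := by
      have h1 : Continuous fun ξ => invDeriv F₁ ((x₀ - p.1 - ξ) / (T - p.2)) :=
        h.continuous_invDeriv.comp (by fun_prop)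
      have h2 : Continuous fun ξ =>
          kruzhkovFlux F (u p.1 p.2) (invDeriv F₁ ((x₀ - p.1 - ξ) / (T - p.2))) :=
        hkf.comp (continuous_const.prodMk h1)
      fun_prop
    have := tendsto_integral_rightKernel_mul hc1.continuousOn.integrableOn_Icc
      hc1.continuousAt.continuousWithinAt
    simpa only [sub_zero, fan] using this

end IsKruzhkovSolution

/-! ### The Lax sum and its cutoff -/

/-- The sum `V(y, τ) + (T - τ) L((x₀ - y) / (T - τ))` which is minimized in the Lax–Oleinik
formula. -/
noncomputable def laxSum (F F₁ : ℝ → ℝ) (x₀ T : ℝ) (V : ℝ → ℝ → ℝ) (y τ : ℝ) : ℝ :=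
  V y τ + (T - τ) * legendre F F₁ ((x₀ - y) / (T - τ))

namespace IsUniformlyConvexFlux

variable {F F₁ F₂ : ℝ → ℝ} {c x₀ T : ℝ}

theorem continuousAt_fan (h : IsUniformlyConvexFlux F F₁ F₂ c) {p : ℝ × ℝ} (hp : p ∈ strip T) :
    ContinuousAt (fan F₁ x₀ T) p := by
  have : ContinuousAt (fun p : ℝ × ℝ => (x₀ - p.1) / (T - p.2)) p :=
    ContinuousAt.div (by fun_prop) (by fun_prop) (sub_pos.2 hp.2).ne'
  exact h.continuous_invDeriv.continuousAt.comp this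

theorem measurable_fan (h : IsUniformlyConvexFlux F F₁ F₂ c) : Measurable (fan F₁ x₀ T) := by
  have := h.continuous_invDeriv.measurable
  exact this.comp (by fun_prop)

theorem hasDerivAt_laxSum_left (h : IsUniformlyConvexFlux F F₁ F₂ c) {V : ℝ → ℝ → ℝ} {v : ℝ}
    {S : Set ℝ} {y τ : ℝ} (hτ : τ < T) (hV : HasDerivWithinAt (fun y => V y τ) v S y) :
    HasDerivWithinAt (fun y => laxSum F F₁ x₀ T V y τ) (v - fan F₁ x₀ T (y, τ)) S y := by
  have hT : T - τ ≠ 0 := (sub_pos.2 hτ).ne'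
  have h1 : HasDerivAt (fun y => (x₀ - y) / (T - τ)) (-1 / (T - τ)) y :=
    ((hasDerivAt_id y).const_sub x₀).div_const _
  have h2 := ((h.hasDerivAt_legendre ((x₀ - y) / (T - τ))).comp y h1).const_mul (T - τ)
  refine (hV.add h2.hasDerivWithinAt).congr_deriv ?_
  simp only [fan]
  field_simp
  ring

/-- The time derivative is `p L'(p) - L(p)` at `p = (x₀ - y)/(T - τ)`, which is `F((F')⁻¹(p))` by
Legendre duality. -/
theorem hasDerivAt_fanPotential_right (h : IsUniformlyConvexFlux F F₁ F₂ c) {y τ : ℝ} (hτ : τ < T) :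
    HasDerivAt (fun τ => (T - τ) * legendre F F₁ ((x₀ - y) / (T - τ))) (F (fan F₁ x₀ T (y, τ))) τ := by
  have hT : T - τ ≠ 0 := (sub_pos.2 hτ).ne'
  have h0 : HasDerivAt (fun τ => T - τ) (-1) τ := (hasDerivAt_id τ).const_sub T
  have h1 : HasDerivAt (fun τ => (x₀ - y) / (T - τ)) ((x₀ - y) / (T - τ) ^ 2) τ :=
    ((hasDerivAt_const τ (x₀ - y)).div h0 hT).congr_deriv (by ring)
  have h2 := h0.mul ((h.hasDerivAt_legendre ((x₀ - y) / (T - τ))).comp τ h1)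
  refine h2.congr_deriv ?_
  simp only [fan, legendre, Function.comp]
  field_simp
  ring

theorem continuousAt_laxSum (h : IsUniformlyConvexFlux F F₁ F₂ c) {V : ℝ → ℝ → ℝ} {p : ℝ × ℝ}
    (hp : p ∈ strip T) (hV : ContinuousAt (fun p : ℝ × ℝ => V p.1 p.2) p) :
    ContinuousAt (fun p : ℝ × ℝ => laxSum F F₁ x₀ T V p.1 p.2) p := by
  have h1 : ContinuousAt (fun p : ℝ × ℝ => (x₀ - p.1) / (T - p.2)) p :=
    ContinuousAt.div (by fun_prop) (by fun_prop) (sub_pos.2 hp.2).ne'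
  have h2 : ContinuousAt (fun p : ℝ × ℝ => T - p.2) p := by fun_prop
  exact hV.add (h2.mul (h.continuous_legendre.continuousAt.comp h1))

/-- Coercivity: Young's inequality with `k = ±(M + 1)` gives the Legendre term linear growth of
slope `M + 1`, beating the Lipschitz constant `M` of `V` by one. -/
theorem add_abs_sub_le_laxSum (h : IsUniformlyConvexFlux F F₁ F₂ c) {V : ℝ → ℝ → ℝ} {M τ : ℝ}
    (hτ : τ < T) (hV : ∀ a b, |V b τ - V a τ| ≤ M * |b - a|) (y : ℝ) :
    V x₀ τ + |y - x₀| - (T - τ) * max (F (M + 1)) (F (-(M + 1))) ≤ laxSum F F₁ x₀ T V y τ := by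
  have hT : 0 < T - τ := sub_pos.2 hτ
  have h1 : ∀ k, k * (x₀ - y) - (T - τ) * F k ≤ (T - τ) * legendre F F₁ ((x₀ - y) / (T - τ)) :=
    fun k => by
      have := mul_le_mul_of_nonneg_left (h.mul_sub_le_legendre k ((x₀ - y) / (T - τ))) hT.le
      refine le_trans (le_of_eq ?_) this
      field_simp
  have h2 := (abs_le.1 (hV x₀ y)).1
  have h3 := mul_le_mul_of_nonneg_left (le_max_left (F (M + 1)) (F (-(M + 1)))) hT.le
  have h4 := mul_le_mul_of_nonneg_left (le_max_right (F (M + 1)) (F (-(M + 1)))) hT.le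
  unfold laxSum
  rcases le_total 0 (y - x₀) with h0 | h0
  · rw [abs_of_nonneg h0] at h2 ⊢
    linarith [h1 (-(M + 1))]
  · rw [abs_of_nonpos h0] at h2 ⊢
    linarith [h1 (M + 1)]

end IsUniformlyConvexFlux

namespace IsKruzhkovSolution

variable {F F₁ F₂ : ℝ → ℝ} {u : ℝ → ℝ → ℝ} {M c : ℝ}

theorem abs_smoothPotential_sub_smoothPotential_le (hu : IsKruzhkovSolution F u M) (n : ℕ) {t : ℝ}
    (ht : 0 < t) (a b : ℝ) :
    |smoothPotential F u n b t - smoothPotential F u n a t| ≤ M * |b - a| := by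
  have := Convex.norm_image_sub_le_of_norm_hasDerivWithin_le (s := univ)
    (fun x _ => (hu.hasDerivAt_smoothPotential_left n x ht).hasDerivWithinAt)
    (fun x _ => hu.abs_rightKernel_comp_le (g := id) (fun r hr => hr) n x ht) convex_univ
    (mem_univ a) (mem_univ b)
  exact this

theorem exists_forall_le_laxSum (hu : IsKruzhkovSolution F u M)
    (h : IsUniformlyConvexFlux F F₁ F₂ c) (x₀ m : ℝ) {a b T : ℝ} (ha : 0 < a) (hb : b < T) :
    ∃ ρ : ℝ, ∀ τ ∈ Icc a b, ∀ y, ρ < |y| → m ≤ laxSum F F₁ x₀ T (potential F u) y τ ∧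
      ∀ n, m ≤ laxSum F F₁ x₀ T (smoothPotential F u n) y τ := by
  have hc : ContinuousOn (fun τ => potential F u x₀ τ
      - (T - τ) * max (F (M + 1)) (F (-(M + 1)))) (Icc a b) := fun τ hτ =>
    ((hu.continuousAt_potential_right h.continuous (ha.trans_le hτ.1) x₀).sub
      (by fun_prop)).continuousWithinAt
  obtain ⟨B, hB⟩ := isCompact_Icc.exists_bound_of_continuousOn hc
  -- The last `M` absorbs the mollification error, at most `M / (n + 1)`, making the radius
  -- independent of `n`.
  refine ⟨|x₀| + B + m + M, fun τ hτ y hy => ?_⟩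
  have hτ0 : 0 < τ := ha.trans_le hτ.1
  have hτT : τ < T := hτ.2.trans_lt hb
  have h1 := (abs_le.1 (hB τ hτ)).1
  have h2 := abs_sub_abs_le_abs_sub y x₀
  have hM := hu.nonneg
  refine ⟨?_, fun n => ?_⟩
  · have := h.add_abs_sub_le_laxSum hτT (x₀ := x₀) (hu.abs_potential_sub_le hτ0) y
    linarith
  · have h3 := h.add_abs_sub_le_laxSum hτT (x₀ := x₀)
      (hu.abs_smoothPotential_sub_smoothPotential_le n hτ0) y
    have h4 := (abs_le.1 (hu.abs_smoothPotential_sub_le n x₀ hτ0)).1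
    have h5 := mul_le_mul_of_nonneg_left (one_div_nat_add_one_le n) hM
    linarith

theorem hasFDerivAt_laxSum (hu : IsKruzhkovSolution F u M) (h : IsUniformlyConvexFlux F F₁ F₂ c)
    {x₀ T : ℝ} (n : ℕ) {p : ℝ × ℝ} (hp : p ∈ strip T) :
    HasFDerivAt (fun q : ℝ × ℝ => laxSum F F₁ x₀ T (smoothPotential F u n) q.1 q.2)
      (((∫ z, rightKernel n z * u (p.1 + z) p.2) - fan F₁ x₀ T p) • ContinuousLinearMap.fst ℝ ℝ ℝ
        + (-(∫ z, rightKernel n z * F (u (p.1 + z) p.2)) + F (fan F₁ x₀ T p))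
          • ContinuousLinearMap.snd ℝ ℝ ℝ) p ∧
    ContDiffAt ℝ 1 (fun q : ℝ × ℝ => laxSum F F₁ x₀ T (smoothPotential F u n) q.1 q.2) p := by
  have ha : ∀ q ∈ strip T, HasDerivAt (fun x => laxSum F F₁ x₀ T (smoothPotential F u n) x q.2)
      ((∫ z, rightKernel n z * u (q.1 + z) q.2) - fan F₁ x₀ T (q.1, q.2)) q.1 := fun q hq =>
    hasDerivWithinAt_univ.1 (h.hasDerivAt_laxSum_left hq.2
      (hu.hasDerivAt_smoothPotential_left n q.1 hq.1).hasDerivWithinAt)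
  have hb : ∀ q ∈ strip T, HasDerivAt (fun t => laxSum F F₁ x₀ T (smoothPotential F u n) q.1 t)
      (-(∫ z, rightKernel n z * F (u (q.1 + z) q.2)) + F (fan F₁ x₀ T (q.1, q.2))) q.2 := fun q hq =>
    (hu.hasDerivAt_smoothPotential_right h.continuous n q.1 hq.1).add
      (h.hasDerivAt_fanPotential_right hq.2)
  have ca : ∀ q ∈ strip T, ContinuousAt (fun q : ℝ × ℝ =>
      (∫ z, rightKernel n z * u (q.1 + z) q.2) - fan F₁ x₀ T (q.1, q.2)) q := fun q hq =>
    (hu.continuousAt_rightKernel_comp continuous_id n hq.1).sub (h.continuousAt_fan hq)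
  have cb : ∀ q ∈ strip T, ContinuousAt (fun q : ℝ × ℝ =>
      -(∫ z, rightKernel n z * F (u (q.1 + z) q.2)) + F (fan F₁ x₀ T (q.1, q.2))) q := fun q hq =>
    (hu.continuousAt_rightKernel_comp h.continuous n hq.1).neg.add
      (h.continuous.continuousAt.comp (h.continuousAt_fan hq))
  exact ⟨hasFDerivAt_of_partials (f := laxSum F F₁ x₀ T (smoothPotential F u n))
    (a := fun x t => (∫ z, rightKernel n z * u (x + z) t) - fan F₁ x₀ T (x, t))
    (b := fun x t => -(∫ z, rightKernel n z * F (u (x + z) t)) + F (fan F₁ x₀ T (x, t)))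
    (isOpen_strip T) ha hb ca cb hp,
    contDiffAt_of_partials (f := laxSum F F₁ x₀ T (smoothPotential F u n))
    (a := fun x t => (∫ z, rightKernel n z * u (x + z) t) - fan F₁ x₀ T (x, t))
    (b := fun x t => -(∫ z, rightKernel n z * F (u (x + z) t)) + F (fan F₁ x₀ T (x, t)))
    (isOpen_strip T) ha hb ca cb hp⟩

end IsKruzhkovSolution

namespace IsKruzhkovSolution

variable {F F₁ F₂ : ℝ → ℝ} {u : ℝ → ℝ → ℝ} {M c : ℝ}

/-- The distance between `u` and the fan, localized to where the Lax sum is below `m`. -/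
theorem integral_deriv_mul_cutoff_nonneg (hu : IsKruzhkovSolution F u M)
    (h : IsUniformlyConvexFlux F F₁ F₂ c) (x₀ m : ℝ) {a b T : ℝ} (ha : 0 < a) (hb : b < T)
    {θ : ℝ → ℝ} (hθ : ContDiff ℝ ∞ θ) (hθs : tsupport θ ⊆ Icc a b) (hθ0 : ∀ t, 0 ≤ θ t) :
    Integrable (fun p : ℝ × ℝ => deriv θ p.2 *
      (Real.smoothTransition (m - laxSum F F₁ x₀ T (potential F u) p.1 p.2)
        * |u p.1 p.2 - fan F₁ x₀ T p|)) (volume.restrict posTime) ∧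
    0 ≤ ∫ p in posTime, deriv θ p.2 *
      (Real.smoothTransition (m - laxSum F F₁ x₀ T (potential F u) p.1 p.2)
        * |u p.1 p.2 - fan F₁ x₀ T p|) := by
  obtain ⟨ρ, hρ⟩ := hu.exists_forall_le_laxSum h x₀ m ha hb
  set K : Set (ℝ × ℝ) := Icc (-ρ) ρ ×ˢ Icc a b with hKdef
  have hK : IsCompact K := isCompact_Icc.prod isCompact_Icc
  have hKs : K ⊆ strip T := fun p hp => ⟨ha.trans_le hp.2.1, hp.2.2.trans_lt hb⟩
  set σ := Real.smoothTransition with hσ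
  have hσd : ContDiff ℝ 1 σ := Real.smoothTransition.contDiff
  have hσc := hσd.continuous
  have hσ' : Continuous (deriv σ) := hσd.continuous_deriv (by simp)
  have hθc := hθ.continuous
  have hθ' : Continuous (deriv θ) := hθ.continuous_deriv (by simp)
  have hFc := h.continuous
  have hkf := continuous_kruzhkovFlux h.continuous
  set w : ℝ × ℝ → ℝ := fun p => laxSum F F₁ x₀ T (potential F u) p.1 p.2 with hw
  set wn : ℕ → ℝ × ℝ → ℝ := fun n p => laxSum F F₁ x₀ T (smoothPotential F u n) p.1 p.2 with hwn
  set A : ℕ → ℝ × ℝ → ℝ := fun n p => ∫ z, rightKernel n z * u (p.1 + z) p.2 with hA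
  set Bf : ℕ → ℝ × ℝ → ℝ := fun n p => ∫ z, rightKernel n z * F (u (p.1 + z) p.2) with hBf
  -- The cutoff uses the mollified potential because test functions must be C¹. Coercivity keeps all
  -- supports in the compact set `K`, and the mollification is removed in the limit `n → ∞`.
  set β : ℕ → ℝ × ℝ → ℝ := fun n p => θ p.2 * σ (m - wn n p) with hβdef
  have hβK : ∀ n p, p ∉ K → β n p = 0 := fun n p hp => by
    simp only [hβdef]
    by_cases ht : p.2 ∈ Icc a b
    · have hx : ρ < |p.1| := by
        by_contra hlt
        exact hp ⟨abs_le.1 (not_lt.1 hlt), ht⟩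
      have := (hρ p.2 ht p.1 hx).2 n
      rw [hσ, Real.smoothTransition.zero_of_nonpos (by linarith), mul_zero]
    · rw [image_eq_zero_of_notMem_tsupport fun h => ht (hθs h), zero_mul]
  have hβt : ∀ n, tsupport (β n) ⊆ K := fun n =>
    closure_minimal (fun p hp => by by_contra hpK; exact hp (hβK n p hpK)) hK.isClosed
  have hβs : ∀ n, HasCompactSupport (β n) := fun n =>
    hK.of_isClosed_subset (isClosed_tsupport _) (hβt n)
  have hd : ∀ n, ∀ p ∈ strip T, ContDiffAt ℝ 1 (β n) p ∧
      fderiv ℝ (β n) p (0, 1) = deriv θ p.2 * σ (m - wn n p)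
        + θ p.2 * (deriv σ (m - wn n p) * (Bf n p - F (fan F₁ x₀ T p))) ∧
      fderiv ℝ (β n) p (1, 0) = θ p.2 * (deriv σ (m - wn n p) * (fan F₁ x₀ T p - A n p)) := by
    intro n p hp
    obtain ⟨h1, h2⟩ := hu.hasFDerivAt_laxSum h (x₀ := x₀) n hp
    have h3 : HasFDerivAt (fun p : ℝ × ℝ => θ p.2) (deriv θ p.2 • ContinuousLinearMap.snd ℝ ℝ ℝ) p :=
      ((hθ.differentiable (by simp) p.2).hasDerivAt).comp_hasFDerivAt p hasFDerivAt_snd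
    have h4 := ((hσd.differentiable (by simp) (m - wn n p)).hasDerivAt).comp_hasFDerivAt p
      (h1.const_sub m)
    have h5 : fderiv ℝ (β n) p = _ := (h3.mul h4).fderiv
    refine ⟨?_, ?_, ?_⟩
    · exact ((hθ.of_le (by simp)).comp contDiff_snd).contDiffAt.mul
        (hσd.contDiffAt.comp p (contDiffAt_const.sub h2))
    · rw [h5]
      simp [hBf, hwn]
      ring
    · rw [h5]
      simp [hA, hwn]
      ring
  have hβd : ∀ n, ContDiff ℝ 1 (β n) := fun n =>
    contDiff_iff_contDiffAt.2 fun p => by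
      by_cases hp : p ∈ tsupport (β n)
      · exact (hd n p (hKs (hβt n hp))).1
      · exact (contDiffAt_const (c := (0 : ℝ))).congr_of_eventuallyEq
          (notMem_tsupport_iff_eventuallyEq.1 hp)
  have key := fun n => hu.integral_fan_nonneg h x₀ (hβd n) (hβs n) ((hβt n).trans hKs) fun p =>
    mul_nonneg (hθ0 _) (Real.smoothTransition.nonneg _)
  -- The integrand in terms of the time and of the values of `u`, the fan, the Lax sum, and the
  -- mollifications of `u` and `F(u)`.
  let Φ : ℝ × ℝ × ℝ × ℝ × ℝ × ℝ → ℝ := fun q =>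
    |q.2.1 - q.2.2.1| * (deriv θ q.1 * σ (m - q.2.2.2.1)
        + θ q.1 * (deriv σ (m - q.2.2.2.1) * (q.2.2.2.2.2 - F q.2.2.1)))
      + kruzhkovFlux F q.2.1 q.2.2.1 * (θ q.1 * (deriv σ (m - q.2.2.2.1) * (q.2.2.1 - q.2.2.2.2.1)))
  have hΦ : Continuous Φ := by
    have : Continuous fun q : ℝ × ℝ × ℝ × ℝ × ℝ × ℝ => kruzhkovFlux F q.2.1 q.2.2.1 :=
      hkf.comp (by fun_prop : Continuous fun q : ℝ × ℝ × ℝ × ℝ × ℝ × ℝ => (q.2.1, q.2.2.1))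
    fun_prop
  have hΦn : ∀ n, ∀ p ∈ K, |u p.1 p.2 - fan F₁ x₀ T p| * fderiv ℝ (β n) p (0, 1)
      + kruzhkovFlux F (u p.1 p.2) (fan F₁ x₀ T p) * fderiv ℝ (β n) p (1, 0) =
      Φ (p.2, u p.1 p.2, fan F₁ x₀ T p, wn n p, A n p, Bf n p) := fun n p hp => by
    rw [(hd n p (hKs hp)).2.1, (hd n p (hKs hp)).2.2]
  -- In the limit the terms with `deriv σ` add up to `|u - v| (F(u) - F(v)) + kruzhkovFlux F u v *
  -- (v - u) = 0`, where `v` is the fan.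
  have hΦ0 : ∀ p : ℝ × ℝ, deriv θ p.2 * (σ (m - w p) * |u p.1 p.2 - fan F₁ x₀ T p|) =
      Φ (p.2, u p.1 p.2, fan F₁ x₀ T p, w p, u p.1 p.2, F (u p.1 p.2)) := fun p => by
    have := kruzhkovFlux_mul_sub F (u p.1 p.2) (fan F₁ x₀ T p)
    simp only [Φ]
    linear_combination (θ p.2 * deriv σ (m - w p)) * this
  have hout : ∀ n, ∀ p, p ∉ K → |u p.1 p.2 - fan F₁ x₀ T p| * fderiv ℝ (β n) p (0, 1)
      + kruzhkovFlux F (u p.1 p.2) (fan F₁ x₀ T p) * fderiv ℝ (β n) p (1, 0) = 0 := fun n p hp => by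
    rw [fderiv_of_notMem_tsupport ℝ fun h => hp (hβt n h)]
    simp
  have hout0 : ∀ p : ℝ × ℝ, p ∉ K →
      deriv θ p.2 * (σ (m - w p) * |u p.1 p.2 - fan F₁ x₀ T p|) = 0 := fun p hp => by
    by_cases ht : p.2 ∈ Icc a b
    · have hx : ρ < |p.1| := by
        by_contra hlt
        exact hp ⟨abs_le.1 (not_lt.1 hlt), ht⟩
      have := (hρ p.2 ht p.1 hx).1
      rw [hσ, Real.smoothTransition.zero_of_nonpos (sub_nonpos.2 this)]
      ring
    · rw [image_eq_zero_of_notMem_tsupport fun h => ht (hθs (tsupport_deriv_subset (𝕜 := ℝ) h)),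
        zero_mul]
  have hwc : ContinuousOn w K := fun p hp =>
    (h.continuousAt_laxSum (hKs hp) (hu.continuousAt_potential hFc (hKs hp).1)).continuousWithinAt
  obtain ⟨W, hW⟩ := hK.exists_bound_of_continuousOn hwc
  obtain ⟨V, hV⟩ := hK.exists_bound_of_continuousOn fun p hp =>
    (h.continuousAt_fan (x₀ := x₀) (hKs hp)).continuousWithinAt
  obtain ⟨B, hB⟩ := exists_bound_of_continuous hFc M
  have hM := hu.nonneg
  have hwdiff : ∀ n p, wn n p - w p = smoothPotential F u n p.1 p.2 - potential F u p.1 p.2 :=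
    fun n p => by simp only [hw, hwn, laxSum]; ring
  obtain ⟨C, hC⟩ := ((isCompact_Icc (a := a) (b := b)).prod ((isCompact_Icc (a := -M) (b := M)).prod
    ((isCompact_Icc (a := -V) (b := V)).prod ((isCompact_Icc (a := -(W + M)) (b := W + M)).prod
      ((isCompact_Icc (a := -M) (b := M)).prod
        (isCompact_Icc (a := -B) (b := B))))))).exists_bound_of_continuousOn hΦ.continuousOn
  have hCn : ∀ n, ∀ p ∈ K, |Φ (p.2, u p.1 p.2, fan F₁ x₀ T p, wn n p, A n p, Bf n p)| ≤ C :=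
    fun n p hp => by
      have ht := (hKs hp).1
      refine hC _ ⟨hp.2, abs_le.1 (hu.abs_apply_le _ _ ht), abs_le.1 (hV p hp), abs_le.1 ?_,
        abs_le.1 (hu.abs_rightKernel_comp_le (g := id) (fun r hr => hr) n p.1 ht),
        abs_le.1 (hu.abs_rightKernel_comp_le hB n p.1 ht)⟩
      have h1 := hu.abs_smoothPotential_sub_le n p.1 ht
      rw [← hwdiff] at h1
      have h2 := mul_le_mul_of_nonneg_left (one_div_nat_add_one_le n) hM
      have h3 : |w p| ≤ W := hW p hp
      calc |wn n p| = |(wn n p - w p) + w p| := by ring_nf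
        _ ≤ |wn n p - w p| + |w p| := abs_add_le _ _
        _ ≤ W + M := by linarith
  have hC0 : ∀ p ∈ K, |Φ (p.2, u p.1 p.2, fan F₁ x₀ T p, w p, u p.1 p.2, F (u p.1 p.2))| ≤ C :=
    fun p hp => by
      have ht := (hKs hp).1
      refine hC _ ⟨hp.2, abs_le.1 (hu.abs_apply_le _ _ ht), abs_le.1 (hV p hp), abs_le.1 ?_,
        abs_le.1 (hu.abs_apply_le _ _ ht), abs_le.1 (hB _ (hu.abs_apply_le _ _ ht))⟩
      have h3 : |w p| ≤ W := hW p hp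
      linarith
  have hbi : Integrable (K.indicator fun _ => C) (volume.restrict posTime) := by
    refine Integrable.restrict ?_
    rw [integrable_indicator_iff hK.measurableSet]
    exact integrableOn_const hK.measure_lt_top.ne
  have hmeas : ∀ n, AEStronglyMeasurable (fun p => |u p.1 p.2 - fan F₁ x₀ T p|
      * fderiv ℝ (β n) p (0, 1) + kruzhkovFlux F (u p.1 p.2) (fan F₁ x₀ T p)
      * fderiv ℝ (β n) p (1, 0)) (volume.restrict posTime) := fun n => by
    have hdc : ∀ v, Continuous fun p => fderiv ℝ (β n) p v := fun v =>
      ((hβd n).continuous_fderiv (by simp)).clm_apply continuous_const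
    have hv := (h.measurable_fan (x₀ := x₀) (T := T)).aestronglyMeasurable
      (μ := volume.restrict posTime)
    exact ((hu.aestronglyMeasurable.sub hv).norm.mul (hdc _).aestronglyMeasurable).add
      ((hkf.comp_aestronglyMeasurable (hu.aestronglyMeasurable.prodMk hv)).mul
        (hdc _).aestronglyMeasurable)
  have hlim : ∀ p ∈ posTime, Tendsto (fun n => |u p.1 p.2 - fan F₁ x₀ T p|
      * fderiv ℝ (β n) p (0, 1) + kruzhkovFlux F (u p.1 p.2) (fan F₁ x₀ T p)
      * fderiv ℝ (β n) p (1, 0)) atTop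
      (𝓝 (deriv θ p.2 * (σ (m - w p) * |u p.1 p.2 - fan F₁ x₀ T p|))) := fun p hp => by
    by_cases hpK : p ∈ K
    · simp_rw [hΦn _ p hpK]
      rw [hΦ0 p]
      refine (hΦ.tendsto _).comp (tendsto_const_nhds.prodMk_nhds (tendsto_const_nhds.prodMk_nhds
        (tendsto_const_nhds.prodMk_nhds (Tendsto.prodMk_nhds ?_ (Tendsto.prodMk_nhds
          (hu.tendsto_rightKernel_comp continuous_id p.1 hp)
          (hu.tendsto_rightKernel_comp hFc p.1 hp))))))
      exact (hu.tendsto_smoothPotential p.1 hp).add tendsto_const_nhds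
    · simp_rw [hout _ p hpK]
      rw [hout0 p hpK]
      exact tendsto_const_nhds
  have hlim' := ae_restrict_of_forall_mem (μ := volume) measurableSet_posTime hlim
  refine ⟨Integrable.mono' hbi (aestronglyMeasurable_of_tendsto_ae atTop hmeas hlim')
    (ae_of_all _ fun p => ?_), ge_of_tendsto' (tendsto_integral_of_dominated_convergence
      (K.indicator fun _ => C) hmeas hbi (fun n => ae_of_all _ fun p => ?_) hlim') key⟩
  · by_cases hpK : p ∈ K
    · rw [indicator_of_mem hpK, hΦ0 p]
      exact hC0 p hpK
    · rw [indicator_of_notMem hpK, hout0 p hpK, norm_zero]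
  · by_cases hpK : p ∈ K
    · rw [indicator_of_mem hpK, hΦn n p hpK]
      exact hCn n p hpK
    · rw [indicator_of_notMem hpK, hout n p hpK, norm_zero]

end IsKruzhkovSolution

namespace IsKruzhkovSolution

variable {F F₁ F₂ : ℝ → ℝ} {u : ℝ → ℝ → ℝ} {M c : ℝ}

theorem measurable_cutoff_mul (hu : IsKruzhkovSolution F u M)
    (h : IsUniformlyConvexFlux F F₁ F₂ c) (x₀ m : ℝ) {T τ : ℝ} (hτ : 0 < τ) :
    Measurable fun y => Real.smoothTransition (m - laxSum F F₁ x₀ T (potential F u) y τ)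
      * |u y τ - fan F₁ x₀ T (y, τ)| := by
  have h1 : Continuous fun y => laxSum F F₁ x₀ T (potential F u) y τ := by
    refine (hu.continuous_potential_left hτ).add (continuous_const.mul
      (h.continuous_legendre.comp (by fun_prop)))
  have h2 : Measurable fun y => fan F₁ x₀ T (y, τ) := h.measurable_fan.comp (by fun_prop)
  have h3 := hu.measurable τ hτ
  have h4 := Real.smoothTransition.continuous
  have h5 : Measurable fun y => Real.smoothTransition
      (m - laxSum F F₁ x₀ T (potential F u) y τ) := by fun_prop
  exact h5.mul (h3.sub h2).norm

theorem exists_bound_cutoff_mul (hu : IsKruzhkovSolution F u M)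
    (h : IsUniformlyConvexFlux F F₁ F₂ c) (x₀ m : ℝ) {a b T : ℝ} (ha : 0 < a) (hb : b < T) :
    ∃ B R : ℝ, ∀ τ ∈ Icc a b, ∀ y r, |r| ≤ M →
      ‖Real.smoothTransition (m - laxSum F F₁ x₀ T (potential F u) y τ)
        * |r - fan F₁ x₀ T (y, τ)|‖ ≤ B ∧
      (R < |y| → Real.smoothTransition (m - laxSum F F₁ x₀ T (potential F u) y τ)
        * |r - fan F₁ x₀ T (y, τ)| = 0) := by
  obtain ⟨ρ, hρ⟩ := hu.exists_forall_le_laxSum h x₀ m ha hb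
  obtain ⟨V, hV⟩ := ((isCompact_Icc (a := -ρ) (b := ρ)).prod
    (isCompact_Icc (a := a) (b := b))).exists_bound_of_continuousOn fun p hp =>
    (h.continuousAt_fan (x₀ := x₀) (T := T)
      ⟨ha.trans_le hp.2.1, hp.2.2.trans_lt hb⟩).continuousWithinAt
  have hM := hu.nonneg
  refine ⟨max (M + V) 0, ρ, fun τ hτ y r hr => ?_⟩
  have h0 : ρ < |y| → Real.smoothTransition (m - laxSum F F₁ x₀ T (potential F u) y τ)
        * |r - fan F₁ x₀ T (y, τ)| = 0 := fun hy => by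
    rw [Real.smoothTransition.zero_of_nonpos (sub_nonpos.2 (hρ τ hτ y hy).1), zero_mul]
  refine ⟨?_, h0⟩
  by_cases hy : ρ < |y|
  · rw [h0 hy, norm_zero]
    exact le_max_right _ _
  · have h1 : |fan F₁ x₀ T (y, τ)| ≤ V := hV (y, τ) ⟨abs_le.1 (not_lt.1 hy), hτ⟩
    rw [norm_mul, Real.norm_eq_abs |r - fan F₁ x₀ T (y, τ)|, abs_abs, Real.norm_of_nonneg (Real.smoothTransition.nonneg _)]
    calc _ ≤ 1 * |r - fan F₁ x₀ T (y, τ)| :=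
          mul_le_mul_of_nonneg_right (Real.smoothTransition.le_one _) (abs_nonneg _)
      _ ≤ |r| + |fan F₁ x₀ T (y, τ)| := by rw [one_mul]; exact abs_sub _ _
      _ ≤ M + V := add_le_add hr h1
      _ ≤ _ := le_max_left _ _

theorem integrable_cutoff_mul (hu : IsKruzhkovSolution F u M)
    (h : IsUniformlyConvexFlux F F₁ F₂ c) (x₀ m : ℝ) {T τ : ℝ} (hτ : 0 < τ) (hτT : τ < T) :
    Integrable fun y => Real.smoothTransition (m - laxSum F F₁ x₀ T (potential F u) y τ)
      * |u y τ - fan F₁ x₀ T (y, τ)| := by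
  obtain ⟨B, R, hBR⟩ := hu.exists_bound_cutoff_mul h x₀ m hτ hτT
  refine Integrable.mono' (g := (Icc (-R) R).indicator fun _ => B) ?_
    (hu.measurable_cutoff_mul h x₀ m hτ).aestronglyMeasurable (ae_of_all _ fun y => ?_)
  · rw [integrable_indicator_iff measurableSet_Icc]
    exact integrableOn_const isCompact_Icc.measure_lt_top.ne
  · have h1 := hBR τ ⟨le_rfl, le_rfl⟩ y (u y τ) (hu.abs_apply_le y τ hτ)
    by_cases hy : y ∈ Icc (-R) R
    · rw [indicator_of_mem hy]
      exact h1.1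
    · rw [indicator_of_notMem hy, h1.2 (by by_contra hlt; exact hy (abs_le.1 (not_lt.1 hlt))),
        norm_zero]

/-- The inequality from `integral_deriv_mul_cutoff_nonneg`, tested against all `θ ≥ 0`, says that
the localized distance is nonincreasing in time as a distribution; its continuity in time gives
every pair `s ≤ τ < T`. -/
theorem integral_cutoff_mul_le (hu : IsKruzhkovSolution F u M)
    (h : IsUniformlyConvexFlux F F₁ F₂ c) (x₀ m : ℝ) {s τ T : ℝ} (hs : 0 < s) (hsτ : s ≤ τ)
    (hτ : τ < T) :
    ∫ y, Real.smoothTransition (m - laxSum F F₁ x₀ T (potential F u) y τ)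
        * |u y τ - fan F₁ x₀ T (y, τ)| ≤
      ∫ y, Real.smoothTransition (m - laxSum F F₁ x₀ T (potential F u) y s)
        * |u y s - fan F₁ x₀ T (y, s)| := by
  have hσ := Real.smoothTransition.continuous
  have hcont : ∀ t, 0 < t → t < T → ContinuousAt (fun t =>
      ∫ y, Real.smoothTransition (m - laxSum F F₁ x₀ T (potential F u) y t)
        * |u y t - fan F₁ x₀ T (y, t)|) t := fun t ht htT => by
    obtain ⟨a, ha, hat⟩ := exists_between ht
    obtain ⟨b, htb, hb⟩ := exists_between htT
    obtain ⟨B, R, hBR⟩ := hu.exists_bound_cutoff_mul h x₀ m ha hb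
    have hev : ∀ᶠ t in 𝓝 t, t ∈ Icc a b := Icc_mem_nhds hat htb
    refine hu.continuousAt_integral_comp (X := ℝ) (τ := id) (B := B) (R := R)
      (Ψ := fun t y r => Real.smoothTransition (m - laxSum F F₁ x₀ T (potential F u) y t)
        * |r - fan F₁ x₀ T (y, t)|) continuousAt_id ht (fun y r => ?_) ?_ ?_ ?_
    · have hp : ((y, t) : ℝ × ℝ) ∈ strip T := ⟨ht, htT⟩
      have h0 : ContinuousAt (fun q : ℝ × ℝ => ((y, q.1) : ℝ × ℝ)) (t, r) := by fun_prop
      have h1 := ContinuousAt.comp (f := fun q : ℝ × ℝ => ((y, q.1) : ℝ × ℝ)) (x := (t, r))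
        (h.continuousAt_laxSum (x₀ := x₀) hp (hu.continuousAt_potential h.continuous ht)) h0
      have h2 := ContinuousAt.comp (f := fun q : ℝ × ℝ => ((y, q.1) : ℝ × ℝ)) (x := (t, r))
        (h.continuousAt_fan (x₀ := x₀) hp) h0
      exact (hσ.continuousAt.comp (continuousAt_const.sub h1)).mul (continuousAt_snd.sub h2).abs
    · filter_upwards [hev] with t ht y r hr using (hBR t ht y r hr).1
    · filter_upwards [hev] with t ht y r hr using (hBR t ht y r hr).2
    · filter_upwards [hev] with t ht
      exact (hu.measurable_cutoff_mul h x₀ m (ha.trans_le ht.1)).aestronglyMeasurable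
  obtain ⟨b, hτb, hb⟩ := exists_between hτ
  refine le_of_integral_mul_deriv_nonneg (g := fun t =>
      ∫ y, Real.smoothTransition (m - laxSum F F₁ x₀ T (potential F u) y t)
        * |u y t - fan F₁ x₀ T (y, t)|) hsτ hτb ?_ (hcont s hs (hsτ.trans_lt hτ)).continuousWithinAt
    (hcont τ (hs.trans_le hsτ) hτ).continuousWithinAt fun θ hθ _ hθt hθ0 => ?_
  · have : ContinuousOn (fun t =>
      ∫ y, Real.smoothTransition (m - laxSum F F₁ x₀ T (potential F u) y t)
        * |u y t - fan F₁ x₀ T (y, t)|) (Icc s b) := fun t ht =>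
      (hcont t (hs.trans_le ht.1) (ht.2.trans_lt hb)).continuousWithinAt
    exact this.integrableOn_Icc
  · obtain ⟨hi, hn⟩ := hu.integral_deriv_mul_cutoff_nonneg h x₀ m hs hb hθ hθt hθ0
    rw [integral_posTime hi] at hn
    simp only [integral_const_mul] at hn
    rw [setIntegral_eq_integral_of_forall_compl_eq_zero] at hn
    · simpa only [mul_comm] using hn
    · intro t ht
      rw [image_eq_zero_of_notMem_tsupport fun hmem =>
        ht (hs.trans_le (hθt (tsupport_deriv_subset (𝕜 := ℝ) hmem)).1), zero_mul]

/-! ### The lower bound in the Lax–Oleinik formula, semiconcavity and Oleinik's estimate -/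

/-- The localized distance to the fan vanishes at time `s`, hence at time `τ`. As `u - v` is the
slope of the Lax sum, the cutoff is then constant in `y`; it vanishes at a remote point `y₁` by
coercivity, hence at `y₀`. -/
theorem le_laxSum_of_forall_le (hu : IsKruzhkovSolution F u M)
    (h : IsUniformlyConvexFlux F F₁ F₂ c) {x₀ m s τ T : ℝ} (hs : 0 < s) (hsτ : s ≤ τ)
    (hτ : τ < T) (hm : ∀ y, m ≤ laxSum F F₁ x₀ T (potential F u) y s) (y₀ : ℝ) :
    m ≤ laxSum F F₁ x₀ T (potential F u) y₀ τ := by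
  have hτ0 := hs.trans_le hsτ
  set σ := Real.smoothTransition with hσdef
  have hσd : ContDiff ℝ 1 σ := Real.smoothTransition.contDiff
  have hle := hu.integral_cutoff_mul_le h x₀ m hs hsτ hτ
  have hz : ∀ y, σ (m - laxSum F F₁ x₀ T (potential F u) y s) * |u y s - fan F₁ x₀ T (y, s)| = 0 :=
    fun y => by rw [hσdef, Real.smoothTransition.zero_of_nonpos (sub_nonpos.2 (hm y)), zero_mul]
  rw [integral_congr_ae (ae_of_all _ hz), integral_zero] at hle
  have hnn : ∀ y, 0 ≤ σ (m - laxSum F F₁ x₀ T (potential F u) y τ)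
      * |u y τ - fan F₁ x₀ T (y, τ)| := fun y =>
    mul_nonneg (Real.smoothTransition.nonneg _) (abs_nonneg _)
  have hae := (integral_eq_zero_iff_of_nonneg hnn (hu.integrable_cutoff_mul h x₀ m hτ0 hτ)).1
    (le_antisymm hle (integral_nonneg hnn))
  obtain ⟨ρ, hρ⟩ := hu.exists_forall_le_laxSum h x₀ m hτ0 hτ
  set y₁ := max (ρ + 1) (|y₀| + 1)
  have hy₁ : ρ < |y₁| := lt_of_lt_of_le (by linarith [le_max_left (ρ + 1) (|y₀| + 1)]) (le_abs_self _)
  have hy₀₁ : y₀ ≤ y₁ := by linarith [le_max_right (ρ + 1) (|y₀| + 1), le_abs_self y₀]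
  have hd : ∀ y, HasDerivWithinAt (fun y => σ (m - laxSum F F₁ x₀ T (potential F u) y τ))
      (deriv σ (m - laxSum F F₁ x₀ T (potential F u) y τ) * -(u y τ - fan F₁ x₀ T (y, τ)))
      (Ioi y) y := fun y =>
    ((hσd.differentiable (by simp) _).hasDerivAt).comp_hasDerivWithinAt y
      ((h.hasDerivAt_laxSum_left hτ (hu.hasDerivWithinAt_potential hτ0 y)).const_sub m)
  have hcont : Continuous fun y => σ (m - laxSum F F₁ x₀ T (potential F u) y τ) :=
    hσd.continuous.comp (continuous_const.sub ((hu.continuous_potential_left hτ0).add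
      (continuous_const.mul (h.continuous_legendre.comp (by fun_prop)))))
  have hd0 : ∀ᵐ y, deriv σ (m - laxSum F F₁ x₀ T (potential F u) y τ)
      * -(u y τ - fan F₁ x₀ T (y, τ)) = 0 := by
    filter_upwards [hae] with y hy
    rcases mul_eq_zero.1 hy with h0 | h0
    -- Where `σ` vanishes it attains its minimum, so its derivative vanishes too.
    · have : IsLocalMin σ (m - laxSum F F₁ x₀ T (potential F u) y τ) :=
        Eventually.of_forall fun r => by rw [h0]; exact Real.smoothTransition.nonneg r
      rw [this.deriv_eq_zero, zero_mul]
    · rw [abs_eq_zero.1 h0, neg_zero, mul_zero]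
  have hftc := intervalIntegral.integral_eq_sub_of_hasDeriv_right_of_le hy₀₁ hcont.continuousOn
    (fun y _ => hd y) ((integrable_zero ℝ ℝ volume).congr
      (hd0.mono fun y hy => hy.symm)).intervalIntegrable
  rw [intervalIntegral.integral_zero_ae (hd0.mono fun y hy _ => hy), hσdef,
    Real.smoothTransition.zero_of_nonpos (sub_nonpos.2 (hρ τ ⟨le_rfl, le_rfl⟩ y₁ hy₁).1)] at hftc
  have := Real.smoothTransition.zero_iff_nonpos.1 (by linarith :
    Real.smoothTransition (m - laxSum F F₁ x₀ T (potential F u) y₀ τ) = 0)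
  linarith

/-- The hard half of the Lax–Oleinik formula. -/
theorem le_potential (hu : IsKruzhkovSolution F u M) (h : IsUniformlyConvexFlux F F₁ F₂ c)
    {x₀ m s T : ℝ} (hs : 0 < s) (hsT : s < T)
    (hm : ∀ y, m ≤ potential F u y s + (T - s) * legendre F F₁ ((x₀ - y) / (T - s))) :
    m ≤ potential F u x₀ T := by
  -- At `y = x₀` the Legendre term is `(T - τ) L(0)`, which tends to zero as `τ → T` from below.
  have h1 : ContinuousAt (fun τ => potential F u x₀ τ + (T - τ) * legendre F F₁ 0) T :=
    (hu.continuousAt_potential_right h.continuous (hs.trans hsT) x₀).add (by fun_prop)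
  have h2 := h1.tendsto.mono_left (nhdsWithin_le_nhds (s := Iio T))
  rw [sub_self, zero_mul, add_zero] at h2
  refine ge_of_tendsto h2 ?_
  filter_upwards [Ioo_mem_nhdsLT hsT] with τ hτ
  have := hu.le_laxSum_of_forall_le h hs hτ.1.le hτ.2 hm x₀
  rwa [laxSum, sub_self, zero_div] at this

/-- For fixed `y` each competitor `U(y, s) + (T - s) L((x - y)/(T - s))` is semiconcave in `x` with
constant `1 / (c (T - s))`, and this passes to the infimum. -/
theorem concaveOn_potential_sub (hu : IsKruzhkovSolution F u M)
    (h : IsUniformlyConvexFlux F F₁ F₂ c) {s T : ℝ} (hs : 0 < s) (hsT : s < T) :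
    ConcaveOn ℝ univ fun x => potential F u x T - x ^ 2 / (2 * (c * (T - s))) := by
  have hT : 0 < T - s := sub_pos.2 hsT
  have hc := h.pos
  refine ⟨convex_univ, fun x _ z _ α β hα hβ hαβ => ?_⟩
  simp only [smul_eq_mul]
  refine le_of_forall_pos_le_add fun δ hδ => ?_
  -- A `δ`-minimizer for the intermediate point; the same `y` then serves as competitor at both
  -- endpoints.
  obtain ⟨y, hy⟩ : ∃ y, potential F u y s
      + (T - s) * legendre F F₁ ((α * x + β * z - y) / (T - s))
        < potential F u (α * x + β * z) T + δ := by
    by_contra! hcon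
    have := hu.le_potential h hs hsT hcon
    linarith
  have h1 := mul_le_mul_of_nonneg_left (hu.potential_le h hs hsT x y) hα
  have h2 := mul_le_mul_of_nonneg_left (hu.potential_le h hs hsT z y) hβ
  have h3 := h.concaveOn_legendre_sub.2 (mem_univ ((x - y) / (T - s)))
    (mem_univ ((z - y) / (T - s))) hα hβ hαβ
  have hβ' : β = 1 - α := by linarith
  subst hβ'
  have e : α * ((x - y) / (T - s)) + (1 - α) * ((z - y) / (T - s))
      = (α * x + (1 - α) * z - y) / (T - s) := by ring
  simp only [smul_eq_mul, e] at h3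
  have h4 := mul_le_mul_of_nonneg_left h3 hT.le
  have e2 : (T - s) * (α * (((x - y) / (T - s)) ^ 2 / (2 * c))
      + (1 - α) * (((z - y) / (T - s)) ^ 2 / (2 * c))
      - ((α * x + (1 - α) * z - y) / (T - s)) ^ 2 / (2 * c)) =
      α * (x ^ 2 / (2 * (c * (T - s)))) + (1 - α) * (z ^ 2 / (2 * (c * (T - s))))
        - (α * x + (1 - α) * z) ^ 2 / (2 * (c * (T - s))) := by
    field_simp
    ring
  linarith

/-- The right derivative of the concave function `U(·, t) - x² / (2c(t - s))` is nonincreasing, and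
that of `U` is `u`. No initial time is available, so `s = t / 2` is taken; this produces the factor
`2`. -/
theorem sub_le_div (hu : IsKruzhkovSolution F u M) (h : IsUniformlyConvexFlux F F₁ F₂ c) {t x y : ℝ}
    (ht : 0 < t) (hxy : x ≤ y) : u y t - u x t ≤ 2 / c / t * (y - x) := by
  rcases hxy.eq_or_lt with rfl | hlt
  · simp
  have hc := h.pos
  have hconc := (hu.concaveOn_potential_sub h (half_pos ht) (half_lt_self ht)).neg
  have hd : ∀ x, HasDerivWithinAt
      (-fun x => potential F u x t - x ^ 2 / (2 * (c * (t - t / 2))))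
      (-(u x t - 2 / c / t * x)) (Ioi x) x := fun x => by
    refine ((hu.hasDerivWithinAt_potential ht x).sub
      (((hasDerivAt_pow 2 x).div_const _).hasDerivWithinAt)).neg.congr_deriv ?_
    field_simp
    norm_num
  have hmono := hconc.monotoneOn_rightDeriv (a := x) (b := y) (by simp) (by simp) hxy
  simp only [(hd _).derivWithin (uniqueDiffWithinAt_Ioi _)] at hmono
  linarith

end IsKruzhkovSolution

/-- Oleinik's one-sided bound. -/
theorem IsEntropySolution.exists_oneSidedBound {f : ℝ → ℝ} (hf : ContDiff ℝ ∞ f)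
    (hconv : ∀ v, 0 < deriv (deriv f) v) {u : ℝ → ℝ → ℝ} (hu : IsEntropySolution f u) :
    ∃ C, OneSidedBound u C := by
  obtain ⟨M, hM⟩ := hu.bounded
  have hM0 : 0 ≤ M := (abs_nonneg _).trans (hM 0 1 one_pos)
  obtain ⟨F, F₁, F₂, c, h, hF⟩ := exists_isUniformlyConvexFlux hf hconv hM0
  have hK : IsKruzhkovSolution F u M :=
    hu.isKruzhkovSolution hf.continuous h.continuous hM hF
  exact ⟨2 / c, fun t ht => distribDerivLE_of_sub_le fun x y hxy => hK.sub_le_div h ht hxy⟩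

end ScalarLaw

theorem lemma4p1 (f : ℝ → ℝ) (hf : ContDiff ℝ ∞ f) (hconv : ∀ v : ℝ, 0 < deriv (deriv f) v)
    (uI uII : ℝ → ℝ → ℝ) (hI : ScalarLaw.IsEntropySolution f uI)
    (hII : ScalarLaw.IsEntropySolution f uII) :
    (∃ CI : ℝ, ScalarLaw.OneSidedBound uI CI) ∧
    (∃ CII : ℝ, ScalarLaw.OneSidedBound uII CII) ∧
    ∀ CI CII : ℝ, ScalarLaw.OneSidedBound uI CI → ScalarLaw.OneSidedBound uII CII →
      ScalarLaw.OneSidedBound (ScalarLaw.averagedSpeed f uI uII)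
        (ScalarLaw.supSecondDeriv f uI uII * (CI + CII) / 2) :=
  ⟨hI.exists_oneSidedBound hf hconv, hII.exists_oneSidedBound hf hconv,
    fun _ _ bI bII => ScalarLaw.oneSidedBound_averagedSpeed hf hconv hI hII bI bII⟩
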